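/- Let $q,p\in\mathbb C$ with $0<|q|<1$ and $p^5=q$; write $q^{i/5}:=p^i$ and $\alpha_k:=q^{k/5}$ ($k=1,\dots,4$). Put $(a;q)_d=\prod_{j=0}^{d-1}(1-aq^j)$ for $d\in\mathbb N\cup\{\infty\}$, $(a_1,\dots,a_r;q)_\infty=\prod_i(a_i;q)_\infty$, $\theta_q(Q)=\sum_{d\in\mathbb Z}q^{d(d-1)/2}Q^d$, $e_{q,\lambda}(Q)=\theta_q(Q)/\theta_q(\lambda Q)$, $\ell_q(Q)=-Q\theta_q'(Q)/\theta_q(Q)$, $\binom{\ell}{a}=\ell(\ell-1)\cdots(\ell-a+1)/a!$, and $(\sigma_qF)(Q)=F(qQ)$. Let ${}_4\phi_3(a_1,\dots,a_4;b_1,b_2,b_3;q;z)=\sum_{d\ge0}\frac{(a_1;q)_d\cdots(a_4;q)_d}{(q;q)_d(b_1;q)_d(b_2;q)_d(b_3;q)_d}z^d$. Let $\Omega=\mathbb C^*\setminus\{\pm p^n:n\in\mathbb Z\}$. Consider the $q$-difference equation $$\Big[(1-\sigma_q)^4-Q\prod_{i=1}^4(1-q^{i/5}\sigma_q)\Big]F(Q)=0.\tag{$*$}$$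 *Notation.* Let $K=\mathbb C[P]/((1-P)^4)$, and let $$\sum_{d\ge0}\frac{\prod_{i=1}^4(Pq^{i/5};q)_d}{(Pq;q)_d^4}Q^d=\sum_{b=0}^3X_b(Q)(1-P)^b\in K,\qquad F_{4,4}(Q)=P^{\ell_q(Q)}\sum_{b=0}^3X_b(Q)(1-P)^b,$$ where $P^{\ell}=\sum_{a=0}^3(-1)^a\binom{\ell}{a}(1-P)^a$. Let $W_k(w)=e_{q,q^{k/5}}(w)\,{}_4\phi_3\big(q^{k/5},q^{k/5},q^{k/5},q^{k/5};\underline b^{(k)};q;q^2w\big)$ with $\underline b^{(1)}=(q^{4/5},q^{3/5},q^{2/5})$, $\underline b^{(2)}=(q^{6/5},q^{4/5},q^{3/5})$, $\underline b^{(3)}=(q^{7/5},q^{6/5},q^{4/5})$, $\underline b^{(4)}=(q^{8/5},q^{7/5},q^{6/5})$. For $r=1,2,3$ let $f_r(x)=\sum_{i_1<\dots<i_r}\prod_{s=1}^r\frac{xq^{i_s}}{1-xq^{i_s}}$ (sums over $i_s\ge0$) and, for $x=(x_1,\dots,x_4)$, $$F_1=\sum_i f_1(x_i),\quad F_2=\sum_i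 f_2(x_i)+\sum_{i<j}f_1(x_i)f_1(x_j),$$ $$F_3=\sum_i f_3(x_i)+\sum_{i<j}\big(f_1(x_i)f_2(x_j)+f_2(x_i)f_1(x_j)\big)+\sum_{i<j<l}f_1(x_i)f_1(x_j)f_1(x_l).$$ Let $D_d(x)=(1-xq^d)(1-qx^{-1}q^d)$, $u_d(x)=xq^d(1-qx^{-2})/D_d(x)$, $v_d(x)=q^{d+1}x^{-1}/D_d(x)$ and $$g_1=\sum_d u_d,\quad g_2=\sum_{i<j}u_iu_j-\sum_dv_d,\quad g_3=\sum_{i<j<l}u_iu_ju_l-\sum_{i\ne j}\frac{q^{i+j+1}(1-qx^{-2})}{D_i(x)D_j(x)}-\sum_dv_d .$$ For triples $B,A$ put $R_1(B,A)=B_1-A_1$, $R_2(B,A)=A_1^2-B_1A_1-A_2+B_2$, $R_3(B,A)=-A_1^3+B_1(A_1^2-A_2)+2A_1A_2-A_1B_2-A_3+B_3$. Define $\mathbb F_j=R_j(B,A)$ with $B_i=F_i(q^{1/5},q^{2/5},q^{3/5},q^{4/5})$, $A_i=F_i(q,q,q,q)$, and $\mathbb G_j=\mathbb G_j^{(k)}(Q)=R_j(B,A)$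 with $B_i=g_i(q^{k/5}Q)$, $A_i=g_i(q^{k/5})$. *Claim.* (1) As $P\to1$ in $\mathbb C$, $$\frac{\prod_{i=1}^4(Pq^{i/5};q)_\infty}{(Pq;q)_\infty^4}=\frac{\prod_{i=1}^4(q^{i/5};q)_\infty}{(q;q)_\infty^4}\Big[1+\sum_{j=1}^3\mathbb F_j(1-P)^j\Big]+O((1-P)^4),$$ and for $k=1,\dots,4$ and $Q\in\Omega$ $$\frac{(Pq^{k/5}Q,P^{-1}Q^{-1}q^{1-k/5};q)_\infty}{(Pq^{k/5},P^{-1}q^{1-k/5};q)_\infty}=\frac{\theta_q(-q^{k/5}Q)}{\theta_q(-q^{k/5})}\Big[1+\sum_{j=1}^3\mathbb G_j(1-P)^j\Big]+O((1-P)^4).$$ (2) The series $X_b(Q)$ converge for $|Q|<1$, the series ${}_4\phi_3$ in $W_k(w)$ converge for $|q^2w|<1$, and the functions $X_b(Q)$, $W_k(w)$ ($0\le b\le3$, $1\le k\le4$) continue to meromorphic functions on $\mathbb C^*$ that are analytic on $\Omega$. In particular $X_0(Q)=\sum_{d\ge0}\frac{\prod_{i=1}^4(q^{i/5};q)_d}{(q;q)_d^4}Q^d$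 for $|Q|<1$. The statements below are about these continuations and hold at every $Q\in\Omega$. (3) The coefficients of $(1-P)^m$ in $F_{4,4}$, $$S_m(Q)=\sum_{a+b=m}(-1)^a\binom{\ell_q(Q)}{a}X_b(Q),\qquad m=0,1,2,3,$$ are solutions of $(*)$, and they form a fundamental system: the matrix $\mathcal X_0(Q)=(S_m(q^iQ))_{0\le i,m\le3}$ is invertible. (4) $W_1(1/Q),\dots,W_4(1/Q)$ are solutions of $(*)$, and they form a fundamental system: the matrix $\mathcal X_\infty(Q)=(W_k(1/(q^iQ)))_{0\le i\le3,\,1\le k\le4}$ is invertible. (5) With $$c_k(Q)=\frac{\prod_{i\ne k}(q^{i/5};q)_\infty\,(q^{1-k/5};q)_\infty^3}{\prod_{i\neq k}(q^{(i-k)/5};q)_\infty\,(q;q)_\infty^3}\cdot\frac{(q^{k/5}Q,\,q^{(5-k)/5}/Q;q)_\infty}{(Q,\,q/Q;q)_\infty}\,e_{q,q^{k/5}}(1/Q)^{-1}$$ and $E_{k,0}=1$, $E_{k,1}=\mathbb G_1+\mathbb F_1$, $E_{k,2}=\mathbb G_2+\mathbb F_2+\mathbb G_1\mathbb F_1$,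 $E_{k,3}=\mathbb G_3+\mathbb F_3+\mathbb G_2\mathbb F_1+\mathbb G_1\mathbb F_2$ (where $\mathbb G_j=\mathbb G_j^{(k)}(Q)$), $$X_b(Q)=\sum_{k=1}^4c_k(Q)\,E_{k,b}(Q)\,W_k(1/Q),\qquad b=0,1,2,3.$$ (6) Consequently the connection matrix $M(Q)=\mathcal X_\infty(Q)^{-1}\mathcal X_0(Q)$ has the entries $$M_{k,m}(Q)=\sum_{a+b=m}(-1)^a\binom{\ell_q(Q)}{a}c_k(Q)E_{k,b}(Q),$$ and $M(qQ)=M(Q)$. -/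

import Mathlib

namespace QConn

open PowerSeries

/-! ### Special functions -/

/-- The finite `q`-Pochhammer symbol `(a; q)_d = (1 - a)(1 - a q) ⋯ (1 - a q ^ (d - 1))`. -/
def qPoch {R : Type*} [CommRing R] (q a : R) (d : ℕ) : R :=
  ∏ j ∈ Finset.range d, (1 - a * q ^ j)

/-- The infinite `q`-Pochhammer symbol `(a; q)_∞`. -/
noncomputable def qPochInf (q a : ℂ) : ℂ :=
  ∏' j : ℕ, (1 - a * q ^ j)

/-- Jacobi's theta function `θ_q(Q) = ∑_{d ∈ ℤ} q ^ (d (d - 1) / 2) Q ^ d`. -/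
noncomputable def theta (q Q : ℂ) : ℂ :=
  ∑' d : ℤ, q ^ (d * (d - 1) / 2) * Q ^ d

/-- The `q`-character `e_{q,l}(Q) = θ_q(Q) / θ_q(l Q)`. -/
noncomputable def qChar (q l Q : ℂ) : ℂ :=
  theta q Q / theta q (l * Q)

/-- The `q`-logarithm `ℓ_q(Q) = - Q θ_q'(Q) / θ_q(Q)`. -/
noncomputable def qLog (q Q : ℂ) : ℂ :=
  -Q * deriv (theta q) Q / theta q Q

/-- The binomial coefficient `l (l - 1) ⋯ (l - k + 1) / k!`. -/
noncomputable def binom (l : ℂ) (k : ℕ) : ℂ :=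
  (∏ r ∈ Finset.range k, (l - r)) / (k.factorial : ℂ)

/-- The basic hypergeometric series `₄φ₃(a₀, a₁, a₂, a₃; b₀, b₁, b₂; q; z)`, term by term. -/
noncomputable def phiTerm (a : Fin 4 → ℂ) (b : Fin 3 → ℂ) (q z : ℂ) (d : ℕ) : ℂ :=
  (∏ i, qPoch q (a i) d) / (qPoch q q d * ∏ j, qPoch q (b j) d) * z ^ d

/-! ### The `q`-difference equation

`p` is a fixed fifth root of `q`; thus `q ^ (i / 5)` is `p ^ i`. -/

/-- The operator `1 - a σ_q`, where `(σ_q F)(Q) = F (q Q)`. -/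
def oneSub (q a : ℂ) (F : ℂ → ℂ) : ℂ → ℂ :=
  fun Q => F Q - a * F (q * Q)

/-- The operator `(1 - σ_q)^4 - Q (1 - p σ_q)(1 - p² σ_q)(1 - p³ σ_q)(1 - p⁴ σ_q)`. -/
def quinticOp (q p : ℂ) (F : ℂ → ℂ) : ℂ → ℂ := fun Q =>
  (oneSub q 1)^[4] F Q
    - Q * oneSub q p (oneSub q (p ^ 2) (oneSub q (p ^ 3) (oneSub q (p ^ 4) F))) Q

/-- The domain `ℂ^* ∖ {± p ^ n : n ∈ ℤ}`; for `q = p ^ 5` it is stable under `Q ↦ q Q` and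
`Q ↦ 1 / Q`, and it contains no zero and no pole of any theta quotient that is used. -/
def regularSet (p : ℂ) : Set ℂ :=
  {Q | Q ≠ 0 ∧ ∀ n : ℤ, Q ≠ p ^ n ∧ Q ≠ -p ^ n}

/-- The matrix `(f_m (q ^ i Q))_{i, m}` of four functions, i.e. the solution matrix of the companion
system attached to four solutions of a scalar `q`-difference equation of order four. -/
def casorati (q : ℂ) (f : Fin 4 → ℂ → ℂ) (Q : ℂ) : Matrix (Fin 4) (Fin 4) ℂ :=
  Matrix.of fun i m => f m (q ^ (i : ℕ) * Q)

/-! ### The `K`-theoretic series at `Q = 0`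

The ring `K(ℙ³) ⊗ ℂ = ℂ[P] / ((1 - P)^4)` is treated as `ℂ⟦y⟧ / (y ^ 4)` with `y = 1 - P`: an element
is represented by a power series in `y = 1 - P`, of which only the coefficients of
`y ^ 0, …, y ^ 3` are used. -/

/-- The class `P = 1 - y`. -/
noncomputable def classP : ℂ⟦X⟧ := 1 - X

/-- The coefficient of `Q ^ d`, i.e. `∏_{i=1}^4 (P q^{i/5}; q)_d / (P q; q)_d ^ 4`. -/
noncomputable def serCoeff (q p : ℂ) (d : ℕ) : ℂ⟦X⟧ :=
  (∏ i : Fin 4, qPoch (C q) (classP * C (p ^ ((i : ℕ) + 1))) d)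
    * ((qPoch (C q) (classP * C q) d) ^ 4)⁻¹

/-- `P ^ l = (1 - y) ^ l = ∑_k (-1) ^ k binom(l, k) y ^ k`. -/
noncomputable def powP (l : ℂ) : ℂ⟦X⟧ :=
  PowerSeries.mk fun k => (-1) ^ k * binom l k

/-- `F_{4,4}(Q) = P ^ (ℓ_q(Q)) ∑_d ∏_{i=1}^4 (P q^{i/5}; q)_d / (P q; q)_d ^ 4 Q ^ d`; the series is
summed in each coefficient with respect to `(1 - P) ^ b`. -/
noncomputable def F44 (q p Q : ℂ) : ℂ⟦X⟧ :=
  powP (qLog q Q) * PowerSeries.mk fun b => ∑' d : ℕ, coeff b (serCoeff q p d) * Q ^ d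

/-- `∑_{a + b = m} (-1) ^ a binom(l, a) v_b`. -/
noncomputable def twist (l : ℂ) (v : Fin 4 → ℂ) (m : Fin 4) : ℂ :=
  ∑ a : Fin 4, ∑ b : Fin 4,
    if (a : ℕ) + (b : ℕ) = (m : ℕ) then (-1) ^ (a : ℕ) * binom l a * v b else 0

/-! ### The series at `Q = ∞` -/

/-- The lower parameters of the four series `₄φ₃`. -/
def lowerParam (p : ℂ) : Fin 4 → Fin 3 → ℂ :=
  ![![p ^ 4, p ^ 3, p ^ 2], ![p ^ 6, p ^ 4, p ^ 3], ![p ^ 7, p ^ 6, p ^ 4], ![p ^ 8, p ^ 7, p ^ 6]]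

/-- The terms of `₄φ₃(q^{k/5}, q^{k/5}, q^{k/5}, q^{k/5}; …; q; q² w)`
(the index `k : Fin 4` stands for `k + 1`). -/
noncomputable def wTerm (q p : ℂ) (k : Fin 4) (w : ℂ) (d : ℕ) : ℂ :=
  phiTerm (fun _ => p ^ ((k : ℕ) + 1)) (lowerParam p k) q (q ^ 2 * w) d

/-! ### The expansion coefficients `𝔽` and `𝔾` -/

/-- `∑_{i₁ < ⋯ < i_k} u_{i₁} ⋯ u_{i_k}`. -/
noncomputable def elemSum (k : ℕ) (u : ℕ → ℂ) : ℂ :=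
  ∑' s : {s : Finset ℕ // s.card = k}, ∏ i ∈ s.1, u i

/-- `f_k(x)`, the elementary symmetric sum of degree `k` of the numbers `x q ^ i / (1 - x q ^ i)`. -/
noncomputable def fSum (q : ℂ) (k : ℕ) (x : ℂ) : ℂ :=
  elemSum k fun i => x * q ^ i / (1 - x * q ^ i)

noncomputable def F1 (q : ℂ) (x : Fin 4 → ℂ) : ℂ :=
  ∑ i, fSum q 1 (x i)

noncomputable def F2 (q : ℂ) (x : Fin 4 → ℂ) : ℂ :=
  ∑ i, fSum q 2 (x i)
    + ∑ i, ∑ j, if i < j then fSum q 1 (x i) * fSum q 1 (x j) else 0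

noncomputable def F3 (q : ℂ) (x : Fin 4 → ℂ) : ℂ :=
  ∑ i, fSum q 3 (x i)
    + (∑ i, ∑ j, if i < j then
        fSum q 1 (x i) * fSum q 2 (x j) + fSum q 2 (x i) * fSum q 1 (x j) else 0)
    + ∑ i, ∑ j, ∑ l, if i < j ∧ j < l then
        fSum q 1 (x i) * fSum q 1 (x j) * fSum q 1 (x l) else 0

/-- The coefficients `1, B₁ - A₁, …` of `(1 + B₁ y + B₂ y² + B₃ y³) / (1 + A₁ y + A₂ y² + A₃ y³)`. -/
def quotCoeff (B1 B2 B3 A1 A2 A3 : ℂ) : Fin 4 → ℂ :=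
  ![1,
    B1 - A1,
    A1 ^ 2 - B1 * A1 - A2 + B2,
    -A1 ^ 3 + B1 * (A1 ^ 2 - A2) + 2 * A1 * A2 - A1 * B2 - A3 + B3]

/-- `q^{1/5}, q^{2/5}, q^{3/5}, q^{4/5}`. -/
def alphas (p : ℂ) : Fin 4 → ℂ := fun i => p ^ ((i : ℕ) + 1)

/-- `𝔽_0 = 1, 𝔽_1, 𝔽_2, 𝔽_3`. -/
noncomputable def bbF (q p : ℂ) : Fin 4 → ℂ :=
  quotCoeff (F1 q (alphas p)) (F2 q (alphas p)) (F3 q (alphas p))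
    (F1 q fun _ => q) (F2 q fun _ => q) (F3 q fun _ => q)

/-- `(1 - x q ^ d) (1 - q x⁻¹ q ^ d)`. -/
noncomputable def gDen (q x : ℂ) (d : ℕ) : ℂ :=
  (1 - x * q ^ d) * (1 - q * x⁻¹ * q ^ d)

/-- `x q ^ d (1 - q x⁻²) / ((1 - x q ^ d) (1 - q x⁻¹ q ^ d))`. -/
noncomputable def gU (q x : ℂ) (d : ℕ) : ℂ :=
  x * q ^ d * (1 - q * (x ^ 2)⁻¹) / gDen q x d

/-- `q ^ (d + 1) x⁻¹ / ((1 - x q ^ d) (1 - q x⁻¹ q ^ d))`. -/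
noncomputable def gV (q x : ℂ) (d : ℕ) : ℂ :=
  q ^ (d + 1) * x⁻¹ / gDen q x d

noncomputable def g1 (q x : ℂ) : ℂ :=
  ∑' d : ℕ, gU q x d

noncomputable def g2 (q x : ℂ) : ℂ :=
  elemSum 2 (gU q x) - ∑' d : ℕ, gV q x d

noncomputable def g3 (q x : ℂ) : ℂ :=
  elemSum 3 (gU q x)
    - (∑' ij : ℕ × ℕ, if ij.1 ≠ ij.2 then
        q ^ (ij.1 + ij.2 + 1) * (1 - q * (x ^ 2)⁻¹) / (gDen q x ij.1 * gDen q x ij.2) else 0)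
    - ∑' d : ℕ, gV q x d

/-- `𝔾_0 = 1, 𝔾_1, 𝔾_2, 𝔾_3` for the index `k` (which stands for `k + 1`) at the point `Q`. -/
noncomputable def bbG (q p : ℂ) (k : Fin 4) (Q : ℂ) : Fin 4 → ℂ :=
  quotCoeff (g1 q (alphas p k * Q)) (g2 q (alphas p k * Q)) (g3 q (alphas p k * Q))
    (g1 q (alphas p k)) (g2 q (alphas p k)) (g3 q (alphas p k))

/-- `∏_{i=1}^4 (P q^{i/5}; q)_∞ / (P q; q)_∞ ^ 4`, for a complex number `P`. -/
noncomputable def ratioF (q p P : ℂ) : ℂ :=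
  (∏ i, qPochInf q (P * alphas p i)) / qPochInf q (P * q) ^ 4

/-- `(P q^{k/5} Q, P⁻¹ Q⁻¹ q^{1 - k/5}; q)_∞ / (P q^{k/5}, P⁻¹ q^{1 - k/5}; q)_∞`, for a complex
number `P`. -/
noncomputable def ratioG (q p : ℂ) (k : Fin 4) (Q P : ℂ) : ℂ :=
  (qPochInf q (P * alphas p k * Q) * qPochInf q (P⁻¹ * Q⁻¹ * (q / alphas p k)))
    / (qPochInf q (P * alphas p k) * qPochInf q (P⁻¹ * (q / alphas p k)))

/-! ### The connection coefficients -/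

/-- The factor in front of `W_k(1/Q)` in the expression of `X_0`. -/
noncomputable def baseCoeff (q p : ℂ) (k : Fin 4) (Q : ℂ) : ℂ :=
  ((∏ i ∈ Finset.univ.erase k, qPochInf q (alphas p i)) * qPochInf q (q / alphas p k) ^ 3)
    / ((∏ i ∈ Finset.univ.erase k, qPochInf q (alphas p i / alphas p k)) * qPochInf q q ^ 3)
  * ((qPochInf q (alphas p k * Q) * qPochInf q (q / (alphas p k * Q)))
      / (qPochInf q Q * qPochInf q (q / Q)))
  * (qChar q (alphas p k) (1 / Q))⁻¹

/-- The four factors by which `baseCoeff` is multiplied in the expressions of `X_0, …, X_3`. -/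
noncomputable def expCoeff (q p : ℂ) (k : Fin 4) (Q : ℂ) : Fin 4 → ℂ :=
  ![1,
    bbG q p k Q 1 + bbF q p 1,
    bbG q p k Q 2 + bbF q p 2 + bbG q p k Q 1 * bbF q p 1,
    bbG q p k Q 3 + bbF q p 3 + bbG q p k Q 2 * bbF q p 1 + bbG q p k Q 1 * bbF q p 2]

/-- The connection matrix from the solutions at `Q = ∞` (rows) to the solutions at `Q = 0`
(columns). -/
noncomputable def connMatrix (q p Q : ℂ) : Matrix (Fin 4) (Fin 4) ℂ :=
  Matrix.of fun k m =>
    twist (qLog q Q) (fun b => baseCoeff q p k Q * expCoeff q p k Q b) m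

end QConn

open QConn

/-!
Everything rests on one identity between theta functions of the variable `P`. Put
`T(x) = (x; q)_∞ (q / x; q)_∞` (`thetaProd`), which is `θ_q(-x)` up to a non-zero constant
(`exists_theta_neg_eq`). For `|q| < |Q| < 1` the bilateral series
`∑_{d ∈ ℤ} Q^d ∏ (P α_l; q)_d / (P q; q)_d^4`, multiplied by `(P q; q)_∞^4 ∏ (q / (P α_l); q)_∞`, is a
holomorphic function of `P ∈ ℂ^*` (`bilateral`), and `P ↦ q P` shifts its index, which makes it a theta
function of degree four. Such a function is determined by its values at the four points
`P = 1 / α_k`, where half of the series vanishes and the other half is the series `₄φ₃` of `W_k(1/Q)`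
(`bilateral_inv_alphas`, `bilateral_eq_sum`).

Divide this interpolation formula by `(P q; q)_∞^4 ∏ (q / (P α_l); q)_∞` and expand at `P = 1` modulo
`(1 - P)^4`. The terms with `d < 0` carry the factor `(1 / P; q)_n^4` and disappear, so that the left-hand
side gives the functions `X_b`; the `k`-th term on the right becomes a constant times
`ratioF(P) ratioG_k(Q, P)`, whose coefficients are those of `𝔽` and `𝔾`. Comparison of the coefficients
is the connection formula on the annulus (`connection_formula_annulus`), and the identity theorem
carries it to the regular set, which is connected as the complement of a countable set
(`connection_formula`). The predicate `Expands` is a calculus of such expansions. Those of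
`ratioF` and `ratioG` come from the expansion of `∏ (1 + a_d)` into elementary symmetric sums
(`tprod_one_add_sub_isBigO`).

The series continue meromorphically because their coefficients are the values `H(q^d)` of a function `H`
that is holomorphic on a disc of radius larger than one: with `H(z) = ∑ a_m z^m`, the series
`∑_d H(q^d) Q^d` is the Lambert series `∑_m a_m / (1 - q^m Q)` (`exists_lambert_continuation`).

The `q`-difference equation is checked term by term where the series converge
(`quinticOp_twist_eq_zero`, `quinticOp_infty_eq_zero`), and extends by the identity theorem. The
determinant of a solution matrix satisfies an equation of order one (`det_casorati_mul_q`), so if it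
vanishes at `Q`, it vanishes along the sequence `q^n Q`, or `q^{-n} Q`; but there its limit, suitably
normalized, is the determinant of the coefficients of the powers `P^i`, respectively the Vandermonde
determinant of the `1 / α_k`. Finally, the connection matrix is `q`-periodic because
`P · ratioG_k(q Q, P)` is proportional to `ratioG_k(Q, P)` (`connMatrix_mul_q`), and the connection
formula takes the matrix form `casorati_twist_eq_mul`.
-/


namespace QConn

open Filter Topology Asymptotics PowerSeries

/-! ### Infinite products -/

section Pochhammer

variable {q : ℂ}

lemma qPoch_succ {R : Type*} [CommRing R] (q a : R) (d : ℕ) :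
    qPoch q a (d + 1) = qPoch q a d * (1 - a * q ^ d) := by
  simp [qPoch, Finset.prod_range_succ]

lemma summable_norm_mul_pow (hq1 : ‖q‖ < 1) (a : ℂ) : Summable fun j : ℕ => ‖-(a * q ^ j)‖ := by
  simp only [norm_neg, norm_mul, norm_pow]
  exact (summable_geometric_of_lt_one (norm_nonneg _) hq1).mul_left _

lemma multipliable_one_sub_mul_pow (hq1 : ‖q‖ < 1) (a : ℂ) :
    Multipliable fun j : ℕ => 1 - a * q ^ j := by
  simpa [sub_eq_add_neg] using multipliable_one_add_of_summable (summable_norm_mul_pow hq1 a)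

lemma qPoch_mul_qPochInf (hq1 : ‖q‖ < 1) (a : ℂ) (d : ℕ) :
    qPoch q a d * qPochInf q (a * q ^ d) = qPochInf q a := by
  have h : Multipliable fun j : ℕ => 1 - a * q ^ (j + d) := by
    have := multipliable_one_sub_mul_pow hq1 (a * q ^ d)
    refine this.congr fun j => ?_
    ring
  have h2 := Multipliable.prod_mul_tprod_nat_mul' (f := fun j : ℕ => 1 - a * q ^ j) h
  have h3 : qPochInf q (a * q ^ d) = ∏' j : ℕ, (1 - a * q ^ (j + d)) :=
    tprod_congr fun j => by ring
  rw [h3]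
  exact h2

lemma qPochInf_eq_one_sub_mul (hq1 : ‖q‖ < 1) (a : ℂ) :
    qPochInf q a = (1 - a) * qPochInf q (a * q) := by
  have := qPoch_mul_qPochInf hq1 a 1
  simpa [qPoch] using this.symm

lemma qPochInf_ne_zero (hq1 : ‖q‖ < 1) {a : ℂ} (h : ∀ j : ℕ, a * q ^ j ≠ 1) :
    qPochInf q a ≠ 0 := by
  have := tprod_one_add_ne_zero_of_summable (f := fun j : ℕ => -(a * q ^ j))
    (fun j => by
      rw [← sub_eq_add_neg]
      exact sub_ne_zero.2 (h j).symm) (summable_norm_mul_pow hq1 a)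
  simpa [qPochInf, sub_eq_add_neg] using this

lemma qPoch_ne_zero {a : ℂ} (h : ∀ j : ℕ, a * q ^ j ≠ 1) (d : ℕ) : qPoch q a d ≠ 0 :=
  Finset.prod_ne_zero_iff.2 fun j _ => sub_ne_zero.2 (h j).symm

lemma differentiable_qPoch (d : ℕ) : Differentiable ℂ fun a => qPoch q a d := by
  unfold qPoch
  fun_prop

lemma norm_qPoch_le (hq1 : ‖q‖ < 1) {a : ℂ} {r : ℝ} (hr : ‖a‖ ≤ r) (d : ℕ) :
    ‖qPoch q a d‖ ≤ Real.exp (r * (1 - ‖q‖)⁻¹) := by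
  have hr0 : 0 ≤ r := (norm_nonneg _).trans hr
  calc ‖qPoch q a d‖ ≤ ∏ j ∈ Finset.range d, (1 + r * ‖q‖ ^ j) := by
        rw [qPoch, norm_prod]
        refine Finset.prod_le_prod (fun _ _ => norm_nonneg _) fun j _ => ?_
        refine (norm_sub_le _ _).trans ?_
        rw [norm_one, norm_mul, norm_pow]
        gcongr
    _ ≤ Real.exp (∑ j ∈ Finset.range d, r * ‖q‖ ^ j) :=
        Real.prod_one_add_le_exp_sum _ fun _ => by positivity
    _ ≤ Real.exp (r * (1 - ‖q‖)⁻¹) := by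
        rw [← Finset.mul_sum, ← tsum_geometric_of_lt_one (norm_nonneg q) hq1]
        gcongr
        exact (summable_geometric_of_lt_one (norm_nonneg q) hq1).sum_le_tsum _
          fun _ _ => by positivity

lemma norm_qPochInf_le (hq1 : ‖q‖ < 1) {a : ℂ} {r : ℝ} (hr : ‖a‖ ≤ r) :
    ‖qPochInf q a‖ ≤ Real.exp (r * (1 - ‖q‖)⁻¹) := by
  have h := (multipliable_one_sub_mul_pow hq1 a).hasProd.tendsto_prod_nat.norm
  exact le_of_tendsto h (Eventually.of_forall fun d => norm_qPoch_le hq1 hr d)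

lemma differentiable_qPochInf (hq1 : ‖q‖ < 1) : Differentiable ℂ (qPochInf q) := by
  intro a₀
  set r : ℝ := ‖a₀‖ + 1
  have hU : IsOpen (Metric.ball (0 : ℂ) r) := Metric.isOpen_ball
  have hs : Summable fun j : ℕ => r * ‖q‖ ^ j :=
    (summable_geometric_of_lt_one (norm_nonneg q) hq1).mul_left _
  have h := hs.hasProdLocallyUniformlyOn_one_add (f := fun (j : ℕ) (a : ℂ) => -(a * q ^ j)) hU
    (Eventually.of_forall fun j a ha => by
      rw [norm_neg, norm_mul, norm_pow]
      have : ‖a‖ ≤ r := by simpa using (mem_ball_zero_iff.1 ha).le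
      gcongr) (fun j => by fun_prop)
  have hd : DifferentiableOn ℂ (fun a => ∏' j : ℕ, (1 + -(a * q ^ j))) (Metric.ball (0 : ℂ) r) := by
    refine h.differentiableOn (Eventually.of_forall fun s => ?_) hU
    simpa [Finset.prod_fn] using DifferentiableOn.finsetProd (fun _ _ => by fun_prop)
  have := hd.differentiableAt (hU.mem_nhds (by simp [r] : a₀ ∈ Metric.ball (0 : ℂ) r))
  have e : qPochInf q = fun a => ∏' j : ℕ, (1 + -(a * q ^ j)) :=
    funext fun a => tprod_congr fun j => sub_eq_add_neg _ _
  rwa [e]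

lemma qPoch_one_succ (q : ℂ) (d : ℕ) : qPoch q (1 : ℂ) (d + 1) = 0 := by
  simp [qPoch, Finset.prod_range_succ']

end Pochhammer

/-! ### The theta product -/

section ThetaProd

variable {q : ℂ}

/-- The product `(x; q)_∞ (q / x; q)_∞`, which is the theta function `θ_q(-x)` up to a constant. -/
noncomputable def thetaProd (q x : ℂ) : ℂ :=
  qPochInf q x * qPochInf q (q / x)

lemma thetaProd_mul_q (hq0 : q ≠ 0) (hq1 : ‖q‖ < 1) {x : ℂ} (hx : x ≠ 0) :
    thetaProd q (q * x) = -(thetaProd q x / x) := by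
  have h1 := qPochInf_eq_one_sub_mul hq1 x
  have h2 := qPochInf_eq_one_sub_mul hq1 (1 / x)
  have e1 : q / (q * x) = 1 / x := by field_simp
  have e2 : 1 / x * q = q / x := by ring
  rw [e2] at h2
  rw [thetaProd, thetaProd, e1, h1, h2, mul_comm q x]
  field_simp
  ring

lemma thetaProd_ne_zero (hq0 : q ≠ 0) (hq1 : ‖q‖ < 1) {x : ℂ} (hx : x ≠ 0)
    (h : ∀ n : ℤ, x ≠ q ^ n) : thetaProd q x ≠ 0 := by
  refine mul_ne_zero (qPochInf_ne_zero hq1 fun j hj => h (-j) ?_)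
    (qPochInf_ne_zero hq1 fun j hj => h (j + 1) ?_)
  · rw [zpow_neg, zpow_natCast]
    exact eq_inv_of_mul_eq_one_left hj
  · have : x = q * q ^ j := by
      field_simp at hj
      exact hj.symm
    rw [this, zpow_add_one₀ hq0, zpow_natCast, mul_comm]

lemma differentiableOn_thetaProd (hq1 : ‖q‖ < 1) : DifferentiableOn ℂ (thetaProd q) {0}ᶜ := by
  intro x hx
  have hx : x ≠ 0 := hx
  have h := differentiable_qPochInf hq1
  exact ((h x).mul ((h (q / x)).comp x (by fun_prop (disch := assumption))
    : DifferentiableAt ℂ (fun x => qPochInf q (q / x)) x)).differentiableWithinAt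

lemma differentiableAt_thetaProd (hq1 : ‖q‖ < 1) {x : ℂ} (hx : x ≠ 0) :
    DifferentiableAt ℂ (thetaProd q) x :=
  (differentiableOn_thetaProd hq1).differentiableAt (isOpen_compl_singleton.mem_nhds hx)

lemma thetaProd_one (hq1 : ‖q‖ < 1) : thetaProd q 1 = 0 := by
  rw [thetaProd, qPochInf_eq_one_sub_mul hq1]; simp

/-- A property invariant under `x ↦ q x` is invariant under multiplication by powers of `q`. -/
lemma q_zpow_induction (hq0 : q ≠ 0) {S : ℂ → Prop} (h : ∀ x ≠ 0, S (q * x) ↔ S x) {x : ℂ}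
    (hx : x ≠ 0) (n : ℤ) : S (q ^ n * x) ↔ S x := by
  induction n with
  | zero => simp
  | succ n ih =>
    rw [← ih, zpow_add_one₀ hq0, mul_comm (q ^ _) q, mul_assoc]
    exact h _ (mul_ne_zero (zpow_ne_zero _ hq0) hx)
  | pred n ih =>
    rw [← ih, ← h _ (mul_ne_zero (zpow_ne_zero _ hq0) hx), ← mul_assoc, ← zpow_one_add₀ hq0]
    ring_nf

lemma thetaProd_eq_zero_iff (hq0 : q ≠ 0) (hq1 : ‖q‖ < 1) {x : ℂ} (hx : x ≠ 0) :
    thetaProd q x = 0 ↔ ∃ n : ℤ, x = q ^ n := by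
  refine ⟨fun h => ?_, ?_⟩
  · by_contra! h'
    exact thetaProd_ne_zero hq0 hq1 hx h' h
  · rintro ⟨n, rfl⟩
    have := q_zpow_induction hq0 (S := fun x => thetaProd q x = 0)
      (fun x hx => by simp [thetaProd_mul_q hq0 hq1 hx, hx]) one_ne_zero n
    rw [mul_one] at this
    exact this.2 (thetaProd_one hq1)

/-- The zeros of `thetaProd` are simple. -/
lemma deriv_thetaProd_ne_zero (hq0 : q ≠ 0) (hq1 : ‖q‖ < 1) (n : ℤ) :
    deriv (thetaProd q) (q ^ n) ≠ 0 := by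
  -- to be a simple zero is a property invariant under `x ↦ q x`, so that `x = 1` is enough
  have key := q_zpow_induction hq0
    (S := fun x => thetaProd q x = 0 ∧ deriv (thetaProd q) x ≠ 0) (x := 1) (fun x hx => by
      have hz : thetaProd q (q * x) = 0 ↔ thetaProd q x = 0 := by
        simp [thetaProd_mul_q hq0 hq1 hx, hx]
      rw [hz]
      refine and_congr_right fun h0 => ?_
      have hd := (differentiableAt_thetaProd hq1 hx).hasDerivAt
      have hd' := (differentiableAt_thetaProd hq1 (mul_ne_zero hq0 hx)).hasDerivAt
      have e1 : HasDerivAt (fun x => thetaProd q (q * x)) (deriv (thetaProd q) (q * x) * q) x := by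
        simpa [Function.comp_def] using hd'.comp x ((hasDerivAt_id x).const_mul q)
      have e2 : HasDerivAt (fun x => thetaProd q (q * x)) (-(deriv (thetaProd q) x / x)) x := by
        have := (hd.div (hasDerivAt_id x) hx).neg
        rw [h0] at this
        have h' : -((deriv (thetaProd q) x * id x - 0 * 1) / id x ^ 2)
            = -(deriv (thetaProd q) x / x) := by
          simp only [id]
          field_simp
          ring
        rw [h'] at this
        refine this.congr_of_eventuallyEq ?_
        filter_upwards [isOpen_ne.mem_nhds hx] with y hy
        simp [thetaProd_mul_q hq0 hq1 hy]
      have := e1.unique e2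
      rw [not_iff_not]
      constructor
      · intro h
        rw [h, zero_mul, eq_comm, neg_eq_zero, div_eq_zero_iff] at this
        exact this.resolve_right hx
      · intro h
        rw [h, zero_div, neg_zero, mul_eq_zero] at this
        exact this.resolve_right hq0) one_ne_zero n
  rw [mul_one] at key
  refine (key.2 ⟨thetaProd_one hq1, ?_⟩).2
  have hqj : ∀ j : ℕ, q * q ^ j ≠ 1 := fun j hj => by
    have := congrArg norm hj
    rw [← pow_succ', norm_pow, norm_one] at this
    exact (pow_lt_one₀ (norm_nonneg _) hq1 (Nat.succ_ne_zero j)).ne this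
  have hU : DifferentiableAt ℂ (fun x => qPochInf q (x * q) * qPochInf q (q / x)) 1 := by
    have h := differentiable_qPochInf hq1
    refine DifferentiableAt.mul ((h _).comp _ (by fun_prop)) ?_
    exact (h (q / 1)).comp (1 : ℂ) (by fun_prop (disch := norm_num))
  have := ((hasDerivAt_id (1 : ℂ)).const_sub 1).fun_mul hU.hasDerivAt
  have e : HasDerivAt (thetaProd q) (-(qPochInf q q * qPochInf q q)) 1 := by
    refine HasDerivAt.congr_of_eventuallyEq (f := fun x => (1 - x) *
      (qPochInf q (x * q) * qPochInf q (q / x))) ?_ (Eventually.of_forall fun x => ?_)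
    · simpa using this
    · rw [thetaProd, qPochInf_eq_one_sub_mul hq1 x, mul_assoc]
  rw [e.deriv]
  exact neg_ne_zero.2 (mul_ne_zero (qPochInf_ne_zero hq1 hqj) (qPochInf_ne_zero hq1 hqj))

end ThetaProd

/-! ### Holomorphic functions on the punctured plane with a multiplicative quasi-period -/

section QuasiPeriodic

variable {q : ℂ}

lemma thetaProd_neg_one_ne_zero (hq0 : q ≠ 0) (hq1 : ‖q‖ < 1) : thetaProd q (-1) ≠ 0 :=
  thetaProd_ne_zero hq0 hq1 (by norm_num) fun n hn => by
    have h1 := congrArg norm hn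
    rw [norm_neg, norm_one, norm_zpow, eq_comm,
      zpow_eq_one_iff_right₀ (norm_nonneg _) hq1.ne] at h1
    rw [h1] at hn
    norm_num at hn

lemma scaling_pow (hq0 : q ≠ 0) {φ : ℂ → ℂ} {b : ℂ} (hφ : ∀ x ≠ 0, φ (q * x) = b * φ x) {x : ℂ}
    (hx : x ≠ 0) (n : ℕ) : φ (q ^ n * x) = b ^ n * φ x := by
  induction n with
  | zero => simp
  | succ n ih =>
    rw [pow_succ', mul_assoc, hφ _ (mul_ne_zero (pow_ne_zero _ hq0) hx), ih, pow_succ', mul_assoc]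

/-- A function with `φ (q x) = b φ x` is controlled near `0` by its values on the annulus
`|q| ≤ |x| ≤ 1`. -/
lemma exists_norm_le_of_scaling (hq0 : q ≠ 0) (hq1 : ‖q‖ < 1) {φ : ℂ → ℂ} {b : ℂ}
    (hc : ContinuousOn φ {0}ᶜ) (hφ : ∀ x ≠ 0, φ (q * x) = b * φ x) :
    ∃ M : ℝ, 0 ≤ M ∧ ∀ x ≠ 0, ‖x‖ ≤ 1 →
      ∃ n : ℕ, ‖q‖ ^ (n + 1) < ‖x‖ ∧ ‖φ x‖ ≤ ‖b‖ ^ n * M := by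
  have hq0' : 0 < ‖q‖ := norm_pos_iff.2 hq0
  have hK : IsCompact (Metric.closedBall (0 : ℂ) 1 ∩ {x | ‖q‖ ≤ ‖x‖}) :=
    (isCompact_closedBall _ _).inter_right (isClosed_le continuous_const continuous_norm)
  obtain ⟨M, hM⟩ := hK.exists_bound_of_continuousOn (hc.mono fun x hx h0 => by
    have h1 : ‖q‖ ≤ ‖x‖ := hx.2
    have h2 : x = 0 := h0
    rw [h2, norm_zero] at h1
    exact absurd h1 (not_le.2 hq0'))
  refine ⟨max M 0, le_max_right _ _, fun x hx hx1 => ?_⟩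
  obtain ⟨n, hn1, hn2⟩ := exists_nat_pow_near_of_lt_one (norm_pos_iff.2 hx) hx1 hq0' hq1
  refine ⟨n, hn1, ?_⟩
  have hqn : q ^ n ≠ 0 := pow_ne_zero _ hq0
  have e : x = q ^ n * (x / q ^ n) := by field_simp
  have hx' : x / q ^ n ≠ 0 := div_ne_zero hx hqn
  rw [e, scaling_pow hq0 hφ hx', norm_mul, norm_pow]
  gcongr
  refine (hM _ ⟨?_, ?_⟩).trans (le_max_left _ _)
  · rw [mem_closedBall_zero_iff, norm_div, norm_pow]
    exact div_le_one_of_le₀ hn2 (by positivity)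
  · change ‖q‖ ≤ _
    rw [norm_div, norm_pow, le_div_iff₀ (by positivity), ← pow_succ']
    exact hn1.le

lemma tendsto_zero_of_scaling (hq0 : q ≠ 0) (hq1 : ‖q‖ < 1) {φ : ℂ → ℂ} {b : ℂ}
    (hc : ContinuousOn φ {0}ᶜ) (hb : ‖b‖ < 1) (hφ : ∀ x ≠ 0, φ (q * x) = b * φ x) :
    Tendsto φ (𝓝[≠] 0) (𝓝 0) := by
  obtain ⟨M, hM0, hM⟩ := exists_norm_le_of_scaling hq0 hq1 hc hφ
  have hq0' : 0 < ‖q‖ := norm_pos_iff.2 hq0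
  rw [Metric.tendsto_nhds]
  intro ε hε
  have hlim : Tendsto (fun n : ℕ => ‖b‖ ^ n * M) atTop (𝓝 0) := by
    simpa using (tendsto_pow_atTop_nhds_zero_of_lt_one (norm_nonneg _) hb).mul_const M
  obtain ⟨N, hN⟩ := (hlim.eventually (gt_mem_nhds hε)).exists
  have hball : Metric.ball (0 : ℂ) (‖q‖ ^ N) ∈ 𝓝 (0 : ℂ) := Metric.ball_mem_nhds _ (by positivity)
  filter_upwards [mem_nhdsWithin_of_mem_nhds hball, self_mem_nhdsWithin] with x hx hx0
  have hx : ‖x‖ < ‖q‖ ^ N := mem_ball_zero_iff.1 hx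
  obtain ⟨n, hn1, hn2⟩ := hM x hx0 (hx.le.trans (pow_le_one₀ (norm_nonneg _) hq1.le))
  have hNn : N ≤ n := by
    have := (pow_lt_pow_iff_right_of_lt_one₀ hq0' hq1).1 (hn1.trans hx)
    omega
  rw [dist_zero_right]
  refine hn2.trans_lt (lt_of_le_of_lt ?_ hN)
  gcongr ?_ * _
  exact pow_le_pow_of_le_one (norm_nonneg _) hb.le hNn

/-- Liouville's theorem for a quasi-period of degree zero: a holomorphic function on `ℂ^*` with
`g (q x) = a g x` and `1 ≤ |a| < 1 / |q|` is constant. -/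
lemma exists_eq_const_of_scaling (hq0 : q ≠ 0) (hq1 : ‖q‖ < 1) {g : ℂ → ℂ} {a : ℂ}
    (hg : DifferentiableOn ℂ g {0}ᶜ) (ha1 : 1 ≤ ‖a‖) (haq : ‖a * q‖ < 1)
    (hga : ∀ x ≠ 0, g (q * x) = a * g x) : ∃ c, ∀ x ≠ 0, g x = c := by
  have ha0 : a ≠ 0 := fun h => by simp [h] at ha1; linarith
  -- `x g(x)` tends to `0` at `0`, so `g` extends to an entire function; it is bounded because
  -- `g (1 / x)` is multiplied by `a⁻¹`, of norm at most one, under `x ↦ q x`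
  set φ : ℂ → ℂ := fun x => x * g x with hφ
  have hφd : DifferentiableOn ℂ φ {0}ᶜ := differentiableOn_id.mul hg
  have h0 : Tendsto φ (𝓝[≠] 0) (𝓝 0) :=
    tendsto_zero_of_scaling hq0 hq1 hφd.continuousOn haq fun x hx => by
      simp only [hφ, hga x hx]; ring
  have hφ0 : ContinuousAt φ 0 := by
    rw [continuousAt_iff_punctured_nhds]
    simpa [hφ] using h0
  have hφD : DifferentiableOn ℂ φ Set.univ := by
    refine (Complex.differentiableOn_compl_singleton_and_continuousAt_iff univ_mem).1 ⟨?_, hφ0⟩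
    rwa [← Set.compl_eq_univ_sdiff]
  have hG : Differentiable ℂ (dslope φ 0) := by
    rw [← differentiableOn_univ]
    exact (Complex.differentiableOn_dslope univ_mem).2 hφD
  have hGg : ∀ x ≠ 0, dslope φ 0 x = g x := fun x hx => by
    rw [dslope_of_ne _ hx, slope_def_field]
    simp only [hφ]
    field_simp
    ring
  have hψ : ContinuousOn (fun x => g x⁻¹) {0}ᶜ :=
    hg.continuousOn.comp (continuousOn_inv₀) fun x hx => inv_ne_zero hx
  obtain ⟨M, hM0, hM⟩ := exists_norm_le_of_scaling (b := a⁻¹) hq0 hq1 hψ fun x hx => by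
    have := hga (q * x)⁻¹ (inv_ne_zero (mul_ne_zero hq0 hx))
    rw [mul_inv, mul_inv_cancel_left₀ hq0] at this
    rw [mul_inv, this, inv_mul_cancel_left₀ ha0]
  obtain ⟨M', hM'⟩ := (isCompact_closedBall (0 : ℂ) 1).exists_bound_of_continuousOn
    hG.continuous.continuousOn
  have hbd : Bornology.IsBounded (Set.range (dslope φ 0)) := by
    refine isBounded_iff_forall_norm_le.2 ⟨max M M', ?_⟩
    rintro _ ⟨x, rfl⟩
    rcases le_total ‖x‖ 1 with h | h
    · exact (hM' x (mem_closedBall_zero_iff.2 h)).trans (le_max_right _ _)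
    · have hx : x ≠ 0 := fun h' => by
        rw [h', norm_zero] at h
        linarith
      obtain ⟨n, -, hn⟩ := hM x⁻¹ (inv_ne_zero hx) (by rw [norm_inv]; exact inv_le_one_of_one_le₀ h)
      rw [inv_inv] at hn
      rw [hGg x hx]
      refine hn.trans (le_trans ?_ (le_max_left _ _))
      refine mul_le_of_le_one_left hM0 (pow_le_one₀ (norm_nonneg _) ?_)
      rw [norm_inv]
      exact inv_le_one_of_one_le₀ ha1
  obtain ⟨c, hc⟩ := hG.exists_const_forall_eq_of_bounded hbd
  exact ⟨c, fun x hx => by rw [← hGg x hx, hc]⟩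

/-- Division of holomorphic functions when all zeros of the denominator are simple and are zeros
of the numerator. -/
lemma exists_differentiableOn_eq_mul {U : Set ℂ} (hU : IsOpen U) {f t : ℂ → ℂ}
    (hf : DifferentiableOn ℂ f U) (ht : DifferentiableOn ℂ t U)
    (hft : ∀ x ∈ U, t x = 0 → f x = 0 ∧ deriv t x ≠ 0) :
    ∃ g, DifferentiableOn ℂ g U ∧ ∀ x ∈ U, f x = t x * g x := by
  classical
  refine ⟨fun x => if t x = 0 then deriv f x / deriv t x else f x / t x, fun x hx => ?_,
    fun x hx => ?_⟩
  · have hUx := hU.mem_nhds hx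
    by_cases h : t x = 0
    · obtain ⟨h1, h2⟩ := hft x hx h
      have hdf : DifferentiableAt ℂ (dslope f x) x :=
        ((Complex.differentiableOn_dslope hUx).2 hf).differentiableAt hUx
      have hdt : DifferentiableAt ℂ (dslope t x) x :=
        ((Complex.differentiableOn_dslope hUx).2 ht).differentiableAt hUx
      have hne : dslope t x x ≠ 0 := by rwa [dslope_same]
      refine ((hdf.div hdt hne).congr_of_eventuallyEq ?_).differentiableWithinAt
      filter_upwards [hdt.continuousAt.eventually_ne hne] with y hy
      by_cases hyx : y = x
      · subst hyx
        simp [h]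
      · have hyx' : y - x ≠ 0 := sub_ne_zero.2 hyx
        have ety := sub_smul_dslope t x y
        have efy := sub_smul_dslope f x y
        rw [h, sub_zero, smul_eq_mul] at ety
        rw [h1, sub_zero, smul_eq_mul] at efy
        have hty : t y ≠ 0 := by
          rw [← ety]
          exact mul_ne_zero hyx' hy
        rw [if_neg hty, ← ety, ← efy, Pi.div_apply, mul_div_mul_left _ _ hyx']
    · have hfx := hf.differentiableAt hUx
      have htx := ht.differentiableAt hUx
      refine ((hfx.div htx h).congr_of_eventuallyEq ?_).differentiableWithinAt
      filter_upwards [htx.continuousAt.eventually_ne h] with y hy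
      simp [hy]
  · by_cases h : t x = 0
    · simp [h, (hft x hx h).1]
    · simp only [h, if_false]
      field_simp

/-- A holomorphic function on `ℂ^*` that vanishes on a `q`-orbit is divisible by the theta function
of this orbit. -/
lemma exists_eq_thetaProd_mul (hq0 : q ≠ 0) (hq1 : ‖q‖ < 1) {f : ℂ → ℂ}
    (hf : DifferentiableOn ℂ f {0}ᶜ) {c : ℂ} (hc : c ≠ 0) (h : ∀ n : ℤ, f (q ^ n * c⁻¹) = 0) :
    ∃ g, DifferentiableOn ℂ g {0}ᶜ ∧ ∀ x ≠ 0, f x = thetaProd q (c * x) * g x := by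
  have hd : ∀ x ≠ 0, HasDerivAt (fun x => thetaProd q (c * x)) (deriv (thetaProd q) (c * x) * c) x := by
    intro x hx
    have := (differentiableAt_thetaProd hq1 (mul_ne_zero hc hx)).hasDerivAt
    simpa [Function.comp_def] using this.comp x ((hasDerivAt_id x).const_mul c)
  refine exists_differentiableOn_eq_mul isOpen_compl_singleton hf
    (t := fun x => thetaProd q (c * x))
    (fun x hx => (hd x hx).differentiableAt.differentiableWithinAt) fun x hx h0 => ?_
  obtain ⟨n, hn⟩ := (thetaProd_eq_zero_iff hq0 hq1 (mul_ne_zero hc hx)).1 h0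
  have e : x = q ^ n * c⁻¹ := by
    rw [← hn]
    field_simp
  refine ⟨by rw [e]; exact h n, ?_⟩
  rw [(hd x hx).deriv, hn]
  exact mul_ne_zero (deriv_thetaProd_ne_zero hq0 hq1 n) hc

end QuasiPeriodic

/-! ### Jacobi's theta function -/

section Theta

variable {q : ℂ}

lemma two_pi_I_ne_zero : (2 * Real.pi * Complex.I : ℂ) ≠ 0 := by
  simp [Real.pi_ne_zero]

lemma exists_exp_eq_nome (hq0 : q ≠ 0) (hq1 : ‖q‖ < 1) :
    ∃ τ : ℂ, 0 < τ.im ∧ Complex.exp (2 * Real.pi * Complex.I * τ) = q := by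
  refine ⟨Function.Periodic.invQParam 1 q,
    Function.Periodic.im_invQParam_pos_of_norm_lt_one one_pos hq1 hq0, ?_⟩
  have := Function.Periodic.qParam_right_inv (h := 1) one_ne_zero hq0
  simpa [Function.Periodic.qParam] using this

lemma theta_term_exp {τ : ℂ} (z : ℂ) (d : ℤ) :
    Complex.exp (2 * Real.pi * Complex.I * τ) ^ (d * (d - 1) / 2)
      * Complex.exp (2 * Real.pi * Complex.I * z) ^ d = jacobiTheta₂_term d (z - τ / 2) τ := by
  rw [← Complex.exp_int_mul, ← Complex.exp_int_mul, ← Complex.exp_add, jacobiTheta₂_term]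
  have h : (((d * (d - 1) / 2 : ℤ) : ℂ)) = (d * (d - 1) : ℂ) / 2 := by
    have h2 : (2 : ℤ) ∣ d * (d - 1) := (Int.even_mul_pred_self d).two_dvd
    rw [Int.cast_div h2 (by norm_num)]
    push_cast
    ring
  rw [h]
  congr 1
  ring

lemma theta_exp {τ : ℂ} (z : ℂ) :
    theta (Complex.exp (2 * Real.pi * Complex.I * τ)) (Complex.exp (2 * Real.pi * Complex.I * z))
      = jacobiTheta₂ (z - τ / 2) τ :=
  tsum_congr fun d => theta_term_exp z d

lemma summable_theta (hq0 : q ≠ 0) (hq1 : ‖q‖ < 1) {Q : ℂ} (hQ : Q ≠ 0) :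
    Summable fun d : ℤ => q ^ (d * (d - 1) / 2) * Q ^ d := by
  obtain ⟨τ, hτ, rfl⟩ := exists_exp_eq_nome hq0 hq1
  have hz : Q = Complex.exp (2 * Real.pi * Complex.I * (Complex.log Q / (2 * Real.pi * Complex.I))) := by
    rw [mul_div_cancel₀ _ two_pi_I_ne_zero, Complex.exp_log hQ]
  rw [hz]
  simp only [theta_term_exp]
  exact (summable_jacobiTheta₂_term_iff _ _).2 hτ

lemma differentiableAt_theta (hq0 : q ≠ 0) (hq1 : ‖q‖ < 1) {Q : ℂ} (hQ : Q ≠ 0) :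
    DifferentiableAt ℂ (theta q) Q := by
  obtain ⟨τ, hτ, rfl⟩ := exists_exp_eq_nome hq0 hq1
  -- near `Q` a branch of the logarithm is `x ↦ log (x / Q) + log Q`
  have hlog : DifferentiableAt ℂ (fun x => (Complex.log (x / Q) + Complex.log Q)
      / (2 * Real.pi * Complex.I) - τ / 2) Q := by
    have : Q / Q ∈ Complex.slitPlane := by simp [hQ]
    fun_prop (disch := assumption)
  have := (differentiableAt_jacobiTheta₂_fst ((Complex.log (Q / Q) + Complex.log Q)
      / (2 * Real.pi * Complex.I) - τ / 2) hτ).comp Q hlog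
  refine this.congr_of_eventuallyEq ?_
  filter_upwards [isOpen_ne.mem_nhds hQ] with x hx
  rw [Function.comp_apply, ← theta_exp, mul_div_cancel₀ _ two_pi_I_ne_zero, Complex.exp_add,
    Complex.exp_log (div_ne_zero hx hQ), Complex.exp_log hQ, div_mul_cancel₀ _ hQ]

lemma theta_mul_q (hq0 : q ≠ 0) {Q : ℂ} (hQ : Q ≠ 0) : theta q (q * Q) = theta q Q / Q := by
  rw [theta, theta, ← (Equiv.addRight (1 : ℤ)).tsum_eq (fun d : ℤ => q ^ (d * (d - 1) / 2) * Q ^ d),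
    ← tsum_div_const]
  refine tsum_congr fun d => ?_
  have h : (d + 1) * (d + 1 - 1) / 2 = d * (d - 1) / 2 + d := by
    have : (d + 1) * (d + 1 - 1) = d * (d - 1) + d * 2 := by ring
    rw [this, Int.add_mul_ediv_right _ _ (by norm_num)]
  rw [Equiv.coe_addRight, h, mul_zpow, zpow_add₀ hq0, zpow_add_one₀ hQ]
  field_simp

lemma theta_neg_one (q : ℂ) : theta q (-1) = 0 := by
  -- the substitution `d ↦ 1 - d` changes the sign of the series
  have h := (Equiv.subLeft (1 : ℤ)).tsum_eq (fun d : ℤ => q ^ (d * (d - 1) / 2) * (-1 : ℂ) ^ d)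
  have h' : ∑' d : ℤ, q ^ ((Equiv.subLeft (1 : ℤ)) d * ((Equiv.subLeft (1 : ℤ)) d - 1) / 2)
      * (-1 : ℂ) ^ ((Equiv.subLeft (1 : ℤ)) d) = - theta q (-1) := by
    rw [theta, ← tsum_neg]
    refine tsum_congr fun d => ?_
    have e : (1 - d) * (1 - d - 1) = d * (d - 1) := by ring
    rw [Equiv.subLeft_apply, e, zpow_sub₀ (by norm_num), zpow_one]
    rcases Int.even_or_odd d with hd | hd
    · simp [hd.neg_one_zpow]
    · simp [hd.neg_one_zpow]
  rw [h'] at h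
  exact CharZero.eq_neg_self_iff.1 h.symm

/-- The mean of `θ_q` over the unit circle is its constant coefficient `1`. -/
lemma integral_theta (hq0 : q ≠ 0) (hq1 : ‖q‖ < 1) :
    ∫ t in (0 : ℝ)..2 * Real.pi, theta q (Complex.exp (Complex.I * t)) = 2 * Real.pi := by
  have hs := (summable_theta hq0 hq1 one_ne_zero).norm
  have hs' : Summable fun d : ℤ => ‖q ^ (d * (d - 1) / 2)‖ := by simpa using hs
  have h := intervalIntegral.hasSum_intervalIntegral_of_summable_norm (a := 0) (b := 2 * Real.pi)
    (f := fun d : ℤ => (⟨fun t : ℝ => q ^ (d * (d - 1) / 2)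
      * Complex.exp (Complex.I * t) ^ d, by
        have : ∀ t : ℝ, Complex.exp (Complex.I * t) ≠ 0 := fun t => Complex.exp_ne_zero _
        refine continuous_const.mul ((by fun_prop : Continuous fun t : ℝ =>
          Complex.exp (Complex.I * t)).zpow₀ d fun t => Or.inl (this t))⟩ : C(ℝ, ℂ))) ?_
  · refine (h.unique (hasSum_single (0 : ℤ) ?_)).trans ?_
    · intro d hd
      have hd' : (d : ℂ) * Complex.I ≠ 0 := mul_ne_zero (Int.cast_ne_zero.2 hd) Complex.I_ne_zero
      have e : ∀ t : ℝ, q ^ (d * (d - 1) / 2) * Complex.exp (Complex.I * t) ^ d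
          = q ^ (d * (d - 1) / 2) * Complex.exp ((d * Complex.I) * t) := fun t => by
        rw [← Complex.exp_int_mul, mul_assoc]
      simp only [ContinuousMap.coe_mk, e]
      rw [intervalIntegral.integral_const_mul, integral_exp_mul_complex hd']
      have : Complex.exp (d * Complex.I * ((2 * Real.pi : ℝ) : ℂ)) = 1 := by
        rw [Complex.exp_eq_one_iff]
        exact ⟨d, by push_cast; ring⟩
      rw [this]
      simp
    · simp
  · refine hs'.of_nonneg_of_le (fun _ => norm_nonneg _) fun d => ?_
    rw [ContinuousMap.norm_le _ (norm_nonneg _)]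
    intro t
    simp [Complex.norm_exp]

/-- Two holomorphic functions on `ℂ^*` that agree where `t` does not vanish are equal. -/
lemma eq_of_eq_off_zeros {f₁ f₂ t : ℂ → ℂ} (h₁ : DifferentiableOn ℂ f₁ {0}ᶜ)
    (h₂ : DifferentiableOn ℂ f₂ {0}ᶜ) (ht : DifferentiableOn ℂ t {0}ᶜ) {x₀ : ℂ} (hx₀ : x₀ ≠ 0)
    (htx : t x₀ ≠ 0) (h : ∀ x ≠ 0, t x ≠ 0 → f₁ x = f₂ x) : ∀ x ≠ 0, f₁ x = f₂ x := by
  have hU : IsOpen ({0}ᶜ : Set ℂ) := isOpen_compl_singleton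
  have hpre : IsPreconnected ({0}ᶜ : Set ℂ) :=
    (isConnected_compl_singleton_of_one_lt_rank (by simp) 0).isPreconnected
  refine (h₁.analyticOnNhd hU).eqOn_of_preconnected_of_eventuallyEq (h₂.analyticOnNhd hU) hpre
    hx₀ ?_
  filter_upwards [(ht.differentiableAt (hU.mem_nhds hx₀)).continuousAt.eventually_ne htx,
    hU.mem_nhds hx₀] with x h1 h2 using h x h2 h1

/-- Jacobi's triple product up to the value of the constant, which plays no role here. -/
lemma exists_theta_neg_eq (hq0 : q ≠ 0) (hq1 : ‖q‖ < 1) :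
    ∃ c : ℂ, c ≠ 0 ∧ ∀ x ≠ 0, theta q (-x) = c * thetaProd q x := by
  have hth : ∀ x ≠ 0, theta q (-(q * x)) = -(theta q (-x) / x) := fun x hx => by
    rw [← mul_neg, theta_mul_q hq0 (neg_ne_zero.2 hx), div_neg]
  have hf : DifferentiableOn ℂ (fun x => theta q (-x)) {0}ᶜ := fun x hx =>
    ((differentiableAt_theta hq0 hq1 (neg_ne_zero.2 hx)).comp x
      (by fun_prop : DifferentiableAt ℂ (fun x : ℂ => -x) x)).differentiableWithinAt
  obtain ⟨g, hg, hfg⟩ := exists_eq_thetaProd_mul hq0 hq1 hf one_ne_zero fun n => by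
    rw [inv_one]
    refine (q_zpow_induction hq0 (S := fun x => theta q (-x) = 0) (fun x hx => ?_)
      one_ne_zero n).2 (theta_neg_one q)
    rw [hth x hx, neg_eq_zero, div_eq_zero_iff, or_iff_left hx]
  simp only [one_mul] at hfg
  have hneg := thetaProd_neg_one_ne_zero hq0 hq1
  have hga : ∀ x ≠ 0, g (q * x) = 1 * g x := by
    refine eq_of_eq_off_zeros (hg.comp (by fun_prop) fun x hx => mul_ne_zero hq0 hx)
      (hg.const_mul 1) (differentiableOn_thetaProd hq1) (x₀ := -1) (by norm_num) hneg
      fun x hx hT => ?_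
    have h1 := hth x hx
    rw [hfg x hx, hfg _ (mul_ne_zero hq0 hx), thetaProd_mul_q hq0 hq1 hx] at h1
    field_simp at h1
    rw [mul_comm q x]
    linear_combination -h1
  obtain ⟨c, hc⟩ := exists_eq_const_of_scaling hq0 hq1 hg (by simp) (by simpa) hga
  have hc' : ∀ x ≠ 0, theta q (-x) = c * thetaProd q x := fun x hx => by
    rw [hfg x hx, hc x hx, mul_comm]
  refine ⟨c, ?_, hc'⟩
  -- if `c = 0`, then `θ_q` vanishes identically, but its mean over the unit circle is `1`
  rintro rfl
  have h := integral_theta hq0 hq1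
  have h0 : ∀ t : ℝ, theta q (Complex.exp (Complex.I * t)) = 0 := fun t => by
    rw [← neg_neg (Complex.exp _), hc' _ (neg_ne_zero.2 (Complex.exp_ne_zero _)), zero_mul]
  simp only [h0, intervalIntegral.integral_zero] at h
  have := Real.pi_ne_zero
  simp [eq_comm] at h

end Theta

/-! ### Expansions at `P = 1` modulo `(1 - P)^4` -/

section Expands

/-- `f P` agrees near `P = 1` up to `O((1 - P)^4)` with the power series `φ` in `1 - P`. -/
def Expands (f : ℂ → ℂ) (φ : ℂ⟦X⟧) : Prop :=
  (fun P => f P - ∑ j : Fin 4, coeff (j : ℕ) φ * (1 - P) ^ (j : ℕ)) =O[𝓝 1] fun P => (1 - P) ^ 4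

variable {f g : ℂ → ℂ} {φ ψ : ℂ⟦X⟧}

lemma coeff_mul_zero (φ ψ : ℂ⟦X⟧) : coeff 0 (φ * ψ) = coeff 0 φ * coeff 0 ψ := by
  simp

lemma coeff_mul_one (φ ψ : ℂ⟦X⟧) :
    coeff 1 (φ * ψ) = coeff 0 φ * coeff 1 ψ + coeff 1 φ * coeff 0 ψ := by
  simp [coeff_mul, Finset.Nat.antidiagonal_succ]

lemma coeff_mul_two (φ ψ : ℂ⟦X⟧) :
    coeff 2 (φ * ψ) = coeff 0 φ * coeff 2 ψ + coeff 1 φ * coeff 1 ψ + coeff 2 φ * coeff 0 ψ := by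
  simp [coeff_mul, Finset.Nat.antidiagonal_succ]
  ring

lemma coeff_mul_three (φ ψ : ℂ⟦X⟧) :
    coeff 3 (φ * ψ) = coeff 0 φ * coeff 3 ψ + coeff 1 φ * coeff 2 ψ + coeff 2 φ * coeff 1 ψ
      + coeff 3 φ * coeff 0 ψ := by
  simp [coeff_mul, Finset.Nat.antidiagonal_succ]
  ring

lemma expands_iff : Expands f φ ↔
    (fun P => f P - (coeff 0 φ + coeff 1 φ * (1 - P) + coeff 2 φ * (1 - P) ^ 2
      + coeff 3 φ * (1 - P) ^ 3)) =O[𝓝 1] fun P => (1 - P) ^ 4 := by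
  simp [Expands, Fin.sum_univ_four]

lemma isBigO_pow_mul {R : ℂ → ℂ} (hR : ContinuousAt R 1) :
    (fun P => (1 - P) ^ 4 * R P) =O[𝓝 1] fun P : ℂ => (1 - P) ^ 4 := by
  have := (isBigO_refl (fun P : ℂ => (1 - P) ^ 4) (𝓝 1)).mul (hR.tendsto.isBigO_one ℂ)
  simpa using this

lemma Expands.congr (h : Expands f φ) (hfg : f =ᶠ[𝓝 1] g) : Expands g φ :=
  IsBigO.congr' h (by filter_upwards [hfg] with P hP using by rw [hP]) EventuallyEq.rfl

lemma Expands.congr_coeff (h : Expands f φ) (hφ : ∀ j : Fin 4, coeff (j : ℕ) φ = coeff (j : ℕ) ψ) :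
    Expands f ψ := by
  simpa only [Expands, hφ] using h

lemma Expands.apply_one (h : Expands f φ) : f 1 = coeff 0 φ := by
  have := (expands_iff.1 h).eq_zero_imp.self_of_nhds (by simp)
  simpa [sub_eq_zero] using this

lemma expands_of_sub_isBigO (hf : Expands f φ)
    (h : (fun P => g P - f P) =O[𝓝 1] fun P => (1 - P) ^ 4) : Expands g φ := by
  have := IsBigO.add hf h
  refine this.congr_left fun P => ?_
  ring

/-- One step of the comparison of coefficients. -/
lemma coeff_eq_zero_of_isBigO {c : ℂ} {r F : ℂ → ℂ} {n : ℕ} (hr : ContinuousAt r 1)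
    (hF : ∀ P, F P = c + (1 - P) * r P) (h : F =O[𝓝[≠] 1] fun P => (1 - P) ^ (n + 1)) :
    c = 0 ∧ r =O[𝓝[≠] 1] fun P => (1 - P) ^ n := by
  have hc : c = 0 := by
    have h1 : Tendsto F (𝓝[≠] 1) (𝓝 0) := by
      refine h.trans_tendsto ?_
      have : ContinuousAt (fun P : ℂ => (1 - P) ^ (n + 1)) 1 := by fun_prop
      simpa using this.tendsto.mono_left nhdsWithin_le_nhds
    have h2 : Tendsto F (𝓝[≠] 1) (𝓝 c) := by
      have : ContinuousAt (fun P : ℂ => c + (1 - P) * r P) 1 := by fun_prop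
      rw [funext hF]
      simpa using this.tendsto.mono_left nhdsWithin_le_nhds
    exact tendsto_nhds_unique h2 h1
  refine ⟨hc, ?_⟩
  obtain ⟨K, hK⟩ := h.bound
  refine IsBigO.of_bound K ?_
  filter_upwards [hK, self_mem_nhdsWithin] with P hP hP1
  have h1 : 0 < ‖1 - P‖ := norm_pos_iff.2 (sub_ne_zero.2 (Ne.symm hP1))
  rw [hF, hc, zero_add, norm_mul, norm_pow, pow_succ'] at hP
  rw [norm_pow]
  refine le_of_mul_le_mul_left ?_ h1
  linarith

/-- The first four coefficients of an expansion are unique. -/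
lemma Expands.unique (hf : Expands f φ) (hg : Expands f ψ) (j : Fin 4) :
    coeff (j : ℕ) φ = coeff (j : ℕ) ψ := by
  set c : ℕ → ℂ := fun j => coeff j φ - coeff j ψ with hc
  have h : (fun P : ℂ => c 0 + (1 - P) * (c 1 + (1 - P) * (c 2 + (1 - P) * (c 3 + (1 - P) * 0))))
      =O[𝓝[≠] 1] fun P => (1 - P) ^ 4 := by
    have := (IsBigO.sub (expands_iff.1 hg) (expands_iff.1 hf)).mono
      (nhdsWithin_le_nhds (s := {1}ᶜ))
    refine this.congr_left fun P => ?_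
    simp only [hc]
    ring
  obtain ⟨h0, h⟩ := coeff_eq_zero_of_isBigO (by fun_prop) (fun _ => rfl) h
  obtain ⟨h1, h⟩ := coeff_eq_zero_of_isBigO (by fun_prop) (fun _ => rfl) h
  obtain ⟨h2, h⟩ := coeff_eq_zero_of_isBigO (by fun_prop) (fun _ => rfl) h
  obtain ⟨h3, h⟩ := coeff_eq_zero_of_isBigO (by fun_prop) (fun _ => rfl) h
  have := sub_eq_zero.1 h0
  have := sub_eq_zero.1 h1
  have := sub_eq_zero.1 h2
  have := sub_eq_zero.1 h3
  fin_cases j <;> assumption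

lemma expands_const (a : ℂ) : Expands (fun _ => a) (C a) := by
  refine expands_iff.2 (IsBigO.congr_left (isBigO_zero _ _) fun P => ?_)
  simp [coeff_C]

lemma expands_id : Expands (fun P => P) classP := by
  refine expands_iff.2 (IsBigO.congr_left (isBigO_zero _ _) fun P => ?_)
  simp [classP, coeff_X, coeff_one]

lemma Expands.sub (hf : Expands f φ) (hg : Expands g ψ) : Expands (fun P => f P - g P) (φ - ψ) := by
  refine IsBigO.congr_left (IsBigO.sub hf hg) fun P => ?_
  simp only [map_sub, sub_mul, Finset.sum_sub_distrib]
  ring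

lemma Expands.add (hf : Expands f φ) (hg : Expands g ψ) : Expands (fun P => f P + g P) (φ + ψ) := by
  refine IsBigO.congr_left (IsBigO.add hf hg) fun P => ?_
  simp only [map_add, add_mul, Finset.sum_add_distrib]
  ring

lemma Expands.sum {ι : Type*} (s : Finset ι) {f : ι → ℂ → ℂ} {φ : ι → ℂ⟦X⟧}
    (h : ∀ i ∈ s, Expands (f i) (φ i)) : Expands (fun P => ∑ i ∈ s, f i P) (∑ i ∈ s, φ i) := by
  classical
  induction s using Finset.induction_on with
  | empty => simpa using expands_const 0
  | insert a s ha ih =>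
    simp only [Finset.sum_insert ha]
    exact (h a (Finset.mem_insert_self _ _)).add
      (ih fun i hi => h i (Finset.mem_insert_of_mem hi))

lemma Expands.mul (hf : Expands f φ) (hg : Expands g ψ) : Expands (fun P => f P * g P) (φ * ψ) := by
  rw [expands_iff] at *
  set A : ℂ → ℂ := fun P => coeff 0 φ + coeff 1 φ * (1 - P) + coeff 2 φ * (1 - P) ^ 2
      + coeff 3 φ * (1 - P) ^ 3 with hA
  set B : ℂ → ℂ := fun P => coeff 0 ψ + coeff 1 ψ * (1 - P) + coeff 2 ψ * (1 - P) ^ 2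
      + coeff 3 ψ * (1 - P) ^ 3 with hB
  have hAc : ContinuousAt A 1 := by fun_prop
  have hBc : ContinuousAt B 1 := by fun_prop
  have hg' : (fun P => g P - B P) =O[𝓝 1] fun _ => (1 : ℂ) := by
    have : ContinuousAt (fun P : ℂ => (1 - P) ^ 4) 1 := by fun_prop
    exact hg.trans (this.tendsto.isBigO_one ℂ)
  have h2 := hf.mul (hBc.tendsto.isBigO_one ℂ)
  have h3 := hg.mul (hAc.tendsto.isBigO_one ℂ)
  have h4 := hf.mul hg'
  have h5 : (fun P => (1 - P) ^ 4 * ((coeff 1 φ * coeff 3 ψ + coeff 2 φ * coeff 2 ψ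
      + coeff 3 φ * coeff 1 ψ) + (coeff 2 φ * coeff 3 ψ + coeff 3 φ * coeff 2 ψ) * (1 - P)
      + coeff 3 φ * coeff 3 ψ * (1 - P) ^ 2)) =O[𝓝 1] fun P : ℂ => (1 - P) ^ 4 :=
    isBigO_pow_mul (by fun_prop)
  simp only [mul_one] at h2 h3 h4
  refine (((h2.add h3).add h4).add h5).congr_left fun P => ?_
  rw [coeff_mul_one, coeff_mul_two, coeff_mul_three, coeff_mul_zero]
  simp only [hA, hB]
  ring

lemma Expands.const_mul (a : ℂ) (hf : Expands f φ) : Expands (fun P => a * f P) (C a * φ) :=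
  (expands_const a).mul hf

lemma Expands.prod {ι : Type*} (s : Finset ι) {f : ι → ℂ → ℂ} {φ : ι → ℂ⟦X⟧}
    (h : ∀ i ∈ s, Expands (f i) (φ i)) : Expands (fun P => ∏ i ∈ s, f i P) (∏ i ∈ s, φ i) := by
  classical
  induction s using Finset.induction_on with
  | empty => simpa using expands_const 1
  | insert a s ha ih =>
    simp only [Finset.prod_insert ha]
    exact (h a (Finset.mem_insert_self _ _)).mul
      (ih fun i hi => h i (Finset.mem_insert_of_mem hi))

lemma Expands.pow (hf : Expands f φ) (n : ℕ) : Expands (fun P => f P ^ n) (φ ^ n) := by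
  simpa using Expands.prod (Finset.range n) (fun _ _ => hf)

lemma Expands.tendsto (hf : Expands f φ) : Tendsto f (𝓝 1) (𝓝 (coeff 0 φ)) := by
  rw [expands_iff] at hf
  have h1 := hf.trans_tendsto (by
    have : ContinuousAt (fun P : ℂ => (1 - P) ^ 4) 1 := by fun_prop
    simpa [ContinuousAt] using this)
  have h2 : Tendsto (fun P : ℂ => coeff 0 φ + coeff 1 φ * (1 - P) + coeff 2 φ * (1 - P) ^ 2
      + coeff 3 φ * (1 - P) ^ 3) (𝓝 1) (𝓝 (coeff 0 φ)) := by
    have : ContinuousAt (fun P : ℂ => coeff 0 φ + coeff 1 φ * (1 - P) + coeff 2 φ * (1 - P) ^ 2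
      + coeff 3 φ * (1 - P) ^ 3) 1 := by fun_prop
    simpa [ContinuousAt] using this
  simpa using h1.add h2

lemma Expands.inv (hf : Expands f φ) (h0 : coeff 0 φ ≠ 0) : Expands (fun P => (f P)⁻¹) φ⁻¹ := by
  set B : ℂ → ℂ := fun P => ∑ j : Fin 4, coeff (j : ℕ) φ⁻¹ * (1 - P) ^ (j : ℕ) with hB
  have hBe : Expands B φ⁻¹ := IsBigO.congr_left (isBigO_zero _ _) fun P => (sub_self _).symm
  have h0' : constantCoeff φ ≠ 0 := by simpa using h0
  have h1 : (fun P => 1 - f P * B P) =O[𝓝 1] fun P : ℂ => (1 - P) ^ 4 := by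
    have := (expands_const 1).sub (hf.mul hBe)
    rw [PowerSeries.mul_inv_cancel _ h0', map_one, sub_self] at this
    simpa [Expands] using this
  have h2 := h1.mul ((hf.tendsto.inv₀ h0).isBigO_one ℂ)
  simp only [mul_one] at h2
  refine IsBigO.congr' h2 ?_ EventuallyEq.rfl
  filter_upwards [hf.tendsto.eventually_ne h0] with P hP
  field_simp
  rfl

lemma Expands.div (hf : Expands f φ) (hg : Expands g ψ) (h0 : coeff 0 ψ ≠ 0) :
    Expands (fun P => f P / g P) (φ * ψ⁻¹) := by
  simpa only [div_eq_mul_inv] using hf.mul (hg.inv h0)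

lemma expands_of_eq {c₀ c₁ c₂ c₃ : ℂ} {R : ℂ → ℂ} (hR : ContinuousAt R 1)
    (h : ∀ᶠ P in 𝓝 1, f P = c₀ + c₁ * (1 - P) + c₂ * (1 - P) ^ 2 + c₃ * (1 - P) ^ 3
      + (1 - P) ^ 4 * R P)
    (h₀ : coeff 0 φ = c₀) (h₁ : coeff 1 φ = c₁) (h₂ : coeff 2 φ = c₂) (h₃ : coeff 3 φ = c₃) :
    Expands f φ := by
  rw [expands_iff, h₀, h₁, h₂, h₃]
  refine IsBigO.congr' (isBigO_pow_mul hR) ?_ EventuallyEq.rfl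
  filter_upwards [h] with P hP
  rw [hP]
  ring

/-- The Taylor coefficients at `P = 1`, with respect to `1 - P`, of `P ↦ h (P z)`. -/
noncomputable def dilationJet (h : ℂ → ℂ) (z : ℂ) : ℂ⟦X⟧ :=
  PowerSeries.mk fun j => (-z) ^ j * (iteratedDeriv j h z / j.factorial)

lemma expands_dilation {h : ℂ → ℂ} {z : ℂ} (hz : AnalyticAt ℂ h z) :
    Expands (fun P => h (P * z)) (dilationJet h z) := by
  have h1 := hz.hasFPowerSeriesAt.isBigO_sub_partialSum_pow 4
  have hlim : Tendsto (fun P : ℂ => (P - 1) * z) (𝓝 1) (𝓝 0) := by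
    have : ContinuousAt (fun P : ℂ => (P - 1) * z) 1 := by fun_prop
    simpa [ContinuousAt] using this
  have h2 := h1.comp_tendsto hlim
  have h3 : ((fun y : ℂ => ‖y‖ ^ 4) ∘ fun P : ℂ => (P - 1) * z) =O[𝓝 1]
      fun P : ℂ => (1 - P) ^ 4 := by
    refine IsBigO.of_bound (‖z‖ ^ 4) (Eventually.of_forall fun P => ?_)
    simp only [Function.comp_apply, norm_mul, norm_pow, norm_norm]
    rw [norm_sub_rev, mul_pow, mul_comm]
  refine (h2.trans h3).congr_left fun P => ?_
  have e : z + (P - 1) * z = P * z := by ring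
  simp only [Function.comp_apply, e, dilationJet, coeff_mk, FormalMultilinearSeries.partialSum,
    FormalMultilinearSeries.ofScalars_apply_eq, smul_eq_mul, Fin.sum_univ_four,
    Finset.sum_range_succ, Finset.sum_range_zero]
  simp
  ring

lemma analyticAt_coeff_dilationJet {h : ℂ → ℂ} {z : ℂ} (hz : AnalyticAt ℂ h z) (j : ℕ) :
    AnalyticAt ℂ (fun z => coeff j (dilationJet h z)) z := by
  simp only [dilationJet, coeff_mk]
  have : AnalyticAt ℂ (iteratedDeriv j h) z := by
    rw [iteratedDeriv_eq_iterate]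
    exact hz.iterated_deriv j
  fun_prop

end Expands

/-! ### Elementary symmetric sums -/

section ElemSum

variable {u : ℕ → ℂ}

lemma summable_prod_of_summable_norm (hu : Summable fun i => ‖u i‖) :
    Summable fun s : Finset ℕ => ∏ i ∈ s, u i :=
  summable_finsetProd_of_summable_norm hu

/-- Elementary symmetric sums as parts of the absolutely convergent sum over all finite subsets, to
which the infinite product `∏ (1 + u_i)` expands. -/
lemma elemSum_eq_tsum_ite (k : ℕ) (u : ℕ → ℂ) :
    elemSum k u = ∑' s : Finset ℕ, if s.card = k then ∏ i ∈ s, u i else 0 := by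
  have := tsum_subtype {s : Finset ℕ | s.card = k} fun s => ∏ i ∈ s, u i
  simp only [Set.indicator_apply, Set.mem_ofPred_eq] at this
  exact this

lemma summable_card_ite (hu : Summable fun i => ‖u i‖) (k : ℕ) :
    Summable fun s : Finset ℕ => if s.card = k then ∏ i ∈ s, u i else 0 := by
  refine (summable_prod_of_summable_norm hu).norm.of_norm_bounded fun s => ?_
  split_ifs
  · exact le_rfl
  · rw [norm_zero]
    exact norm_nonneg _

lemma tendsto_elemSum (hu : Summable fun i => ‖u i‖) (k : ℕ) :
    Tendsto (fun N => ∑ s ∈ (Finset.range N).powersetCard k, ∏ i ∈ s, u i) atTop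
      (𝓝 (elemSum k u)) := by
  have h := (summable_card_ite hu k).hasSum
  rw [← elemSum_eq_tsum_ite] at h
  have h2 := (h.comp tendsto_finset_powerset_atTop_atTop).comp tendsto_finset_range
  refine h2.congr fun N => ?_
  simp only [Function.comp_apply]
  rw [Finset.powersetCard_eq_filter, Finset.sum_filter]

lemma elemSum_one (u : ℕ → ℂ) : elemSum 1 u = ∑' i, u i := by
  let e : ℕ ≃ {s : Finset ℕ // s.card = 1} :=
    Equiv.ofBijective (fun i => ⟨{i}, Finset.card_singleton i⟩)
      ⟨fun i j h => by simpa using h, fun s => by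
        obtain ⟨i, hi⟩ := Finset.card_eq_one.1 s.2
        exact ⟨i, Subtype.ext hi.symm⟩⟩
  rw [elemSum, ← e.tsum_eq]
  exact tsum_congr fun i => Finset.prod_singleton _ _

lemma sum_powersetCard_insert {S : Finset ℕ} {a : ℕ} (ha : a ∉ S) (k : ℕ) :
    ∑ s ∈ (insert a S).powersetCard (k + 1), ∏ i ∈ s, u i
      = ∑ s ∈ S.powersetCard (k + 1), ∏ i ∈ s, u i
        + u a * ∑ s ∈ S.powersetCard k, ∏ i ∈ s, u i := by
  have hmem : ∀ {m : ℕ} {s : Finset ℕ}, s ∈ S.powersetCard m → a ∉ s := fun hs h =>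
    ha ((Finset.mem_powersetCard.1 hs).1 h)
  rw [Finset.powersetCard_succ_insert ha, Finset.sum_union, Finset.sum_image, Finset.mul_sum]
  · congr 1
    exact Finset.sum_congr rfl fun s hs => Finset.prod_insert (hmem hs)
  · intro s hs t ht h
    rw [← Finset.erase_insert (hmem hs), h, Finset.erase_insert (hmem ht)]
  · rw [Finset.disjoint_left]
    intro s hs hs'
    obtain ⟨t, -, rfl⟩ := Finset.mem_image.1 hs'
    exact hmem hs (Finset.mem_insert_self _ _)

/-- Newton's identities in degrees two and three. -/
lemma newton_finset (u : ℕ → ℂ) (S : Finset ℕ) :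
    ∑ s ∈ S.powersetCard 2, ∏ i ∈ s, u i = ((∑ i ∈ S, u i) ^ 2 - ∑ i ∈ S, u i ^ 2) / 2 ∧
    ∑ s ∈ S.powersetCard 3, ∏ i ∈ s, u i = ((∑ i ∈ S, u i) ^ 3
      - 3 * (∑ i ∈ S, u i) * (∑ i ∈ S, u i ^ 2) + 2 * ∑ i ∈ S, u i ^ 3) / 6 := by
  induction S using Finset.induction_on with
  | empty =>
    rw [Finset.powersetCard_eq_empty.2 (by simp), Finset.powersetCard_eq_empty.2 (by simp)]
    simp
  | insert a S ha ih =>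
    have h1 : ∑ s ∈ S.powersetCard 1, ∏ i ∈ s, u i = ∑ i ∈ S, u i := by
      rw [Finset.powersetCard_one, Finset.sum_map]
      simp
    rw [sum_powersetCard_insert ha, sum_powersetCard_insert ha, ih.1, ih.2, h1]
    simp only [Finset.sum_insert ha]
    constructor <;> ring

lemma summable_norm_mul_of_summable_norm {v : ℕ → ℂ} (hu : Summable fun i => ‖u i‖)
    (hv : Summable fun i => ‖v i‖) : Summable fun i => ‖u i * v i‖ := by
  refine hu.of_norm_bounded_eventually_nat ?_
  filter_upwards [hv.tendsto_atTop_zero.eventually (ge_mem_nhds one_pos)] with i hi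
  rw [norm_norm, norm_mul]
  exact mul_le_of_le_one_right (norm_nonneg _) hi

lemma elemSum_two (hu : Summable fun i => ‖u i‖) :
    elemSum 2 u = ((∑' i, u i) ^ 2 - ∑' i, u i ^ 2) / 2 := by
  have h2 := summable_norm_mul_of_summable_norm hu hu
  simp only [← sq] at h2
  have t1 := hu.of_norm.hasSum.tendsto_sum_nat
  have t2 := h2.of_norm.hasSum.tendsto_sum_nat
  refine tendsto_nhds_unique (tendsto_elemSum hu 2) ?_
  simp only [(newton_finset u _).1]
  exact ((t1.pow 2).sub t2).div_const 2

lemma elemSum_three (hu : Summable fun i => ‖u i‖) :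
    elemSum 3 u = ((∑' i, u i) ^ 3 - 3 * (∑' i, u i) * (∑' i, u i ^ 2) + 2 * ∑' i, u i ^ 3) / 6 := by
  have h2 := summable_norm_mul_of_summable_norm hu hu
  have h3 := summable_norm_mul_of_summable_norm h2 hu
  simp only [← sq, ← pow_succ] at h2 h3
  have t1 := hu.of_norm.hasSum.tendsto_sum_nat
  have t2 := h2.of_norm.hasSum.tendsto_sum_nat
  have t3 := h3.of_norm.hasSum.tendsto_sum_nat
  refine tendsto_nhds_unique (tendsto_elemSum hu 3) ?_
  simp only [(newton_finset u _).2]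
  exact (((t1.pow 3).sub ((t1.const_mul 3).mul t2)).add (t3.const_mul 2)).div_const 6

lemma elemSum_zero (u : ℕ → ℂ) : elemSum 0 u = 1 := by
  rw [elemSum_eq_tsum_ite, tsum_eq_single ∅ fun s hs => by simp [hs]]
  simp

/-- An infinite product `∏ (1 + a_d)` with `a_d = O(1 - P)` agrees up to `O((1 - P)^4)` with the
sum of its elementary symmetric parts of degree at most three. -/
lemma tprod_one_add_sub_isBigO {a : ℂ → ℕ → ℂ} {m : ℕ → ℝ} (hm : Summable m)
    (ham : ∀ᶠ P in 𝓝 1, ∀ d, ‖a P d‖ ≤ ‖1 - P‖ * m d) :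
    (fun P => ∏' d, (1 + a P d)
      - (1 + elemSum 1 (a P) + elemSum 2 (a P) + elemSum 3 (a P))) =O[𝓝 1]
      fun P => (1 - P) ^ 4 := by
  have hball : ∀ᶠ P in 𝓝 (1 : ℂ), ‖1 - P‖ < 1 := by
    have : ContinuousAt (fun P : ℂ => ‖1 - P‖) 1 := by fun_prop
    exact this.eventually_lt_const (by simp)
  have hm' : Summable fun s : Finset ℕ => ∏ i ∈ s, |m i| :=
    summable_finsetProd_of_summable_nonneg (fun _ => abs_nonneg _) hm.abs
  refine IsBigO.of_bound (∑' s : Finset ℕ, ∏ i ∈ s, |m i|) ?_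
  filter_upwards [ham, hball] with P hP hP1
  have hu : Summable fun i => ‖a P i‖ := (hm.mul_left _).of_nonneg_of_le (fun _ => norm_nonneg _) hP
  have hs := summable_prod_of_summable_norm hu
  have hk := fun k => (summable_card_ite hu k).hasSum
  simp only [← elemSum_eq_tsum_ite] at hk
  have hrem := hs.hasSum.sub ((((hk 0).add (hk 1)).add (hk 2)).add (hk 3))
  rw [elemSum_zero] at hrem
  rw [tprod_one_add hs, ← hrem.tsum_eq, ← tsum_mul_right]
  refine tsum_of_norm_bounded ((hm'.mul_right _).hasSum) fun s => ?_
  have hnn : 0 ≤ ∏ i ∈ s, |m i| := Finset.prod_nonneg fun _ _ => abs_nonneg _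
  by_cases h4 : s.card < 4
  · have : ∏ i ∈ s, a P i - ((((if s.card = 0 then ∏ i ∈ s, a P i else 0)
        + if s.card = 1 then ∏ i ∈ s, a P i else 0)
        + if s.card = 2 then ∏ i ∈ s, a P i else 0)
        + if s.card = 3 then ∏ i ∈ s, a P i else 0) = 0 := by
      generalize s.card = n at h4
      interval_cases n <;> simp
    rw [this, norm_zero]
    positivity
  · have h0 : s.card ≠ 0 := by omega
    have h1 : s.card ≠ 1 := by omega
    have h2 : s.card ≠ 2 := by omega
    have h3 : s.card ≠ 3 := by omega
    simp only [h0, h1, h2, h3, if_false, add_zero, sub_zero]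
    calc ‖∏ i ∈ s, a P i‖ ≤ ∏ i ∈ s, (‖1 - P‖ * |m i|) := by
          rw [norm_prod]
          refine Finset.prod_le_prod (fun _ _ => norm_nonneg _) fun i _ => (hP i).trans ?_
          gcongr
          exact le_abs_self _
      _ = ‖1 - P‖ ^ s.card * ∏ i ∈ s, |m i| := by
          rw [Finset.prod_mul_distrib, Finset.prod_const]
      _ ≤ ‖1 - P‖ ^ 4 * ∏ i ∈ s, |m i| := by
          gcongr ?_ * _
          exact pow_le_pow_of_le_one (norm_nonneg _) hP1.le (not_lt.1 h4)
      _ = _ := by rw [norm_pow, mul_comm]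

lemma elemSum_mul_left (k : ℕ) (y : ℂ) (u : ℕ → ℂ) :
    elemSum k (fun i => y * u i) = y ^ k * elemSum k u := by
  rw [elemSum, elemSum, ← tsum_mul_left]
  refine tsum_congr fun s => ?_
  rw [Finset.prod_mul_distrib, Finset.prod_const, s.2]

end ElemSum

/-! ### Expansions of infinite products -/

section ProductExpansions

variable {q : ℂ}

lemma norm_one_sub_inv_bdd (hq1 : ‖q‖ < 1) (x : ℂ) :
    ∃ K : ℝ, ∀ i : ℕ, ‖(1 - x * q ^ i)⁻¹‖ ≤ K := by
  have h : Tendsto (fun i : ℕ => (1 - x * q ^ i)⁻¹) atTop (𝓝 (1 - x * 0)⁻¹) := by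
    refine Tendsto.inv₀ ?_ (by simp)
    exact ((tendsto_pow_atTop_nhds_zero_of_norm_lt_one hq1).const_mul x).const_sub 1
  obtain ⟨K, hK⟩ := h.norm.bddAbove_range
  exact ⟨K, fun i => hK ⟨i, rfl⟩⟩

lemma summable_norm_fterm (hq1 : ‖q‖ < 1) (x : ℂ) :
    Summable fun i : ℕ => ‖x * q ^ i / (1 - x * q ^ i)‖ := by
  obtain ⟨K, hK⟩ := norm_one_sub_inv_bdd hq1 x
  have h := (summable_norm_mul_pow hq1 x).mul_right K
  refine h.of_nonneg_of_le (fun _ => norm_nonneg _) fun i => ?_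
  rw [div_eq_mul_inv, norm_mul, norm_neg]
  gcongr
  exact hK i

/-- The expansion of `(P x; q)_∞`. -/
lemma expands_qPochInf (hq1 : ‖q‖ < 1) {x : ℂ} (hx : ∀ j : ℕ, x * q ^ j ≠ 1) :
    Expands (fun P => qPochInf q (P * x))
      (C (qPochInf q x) * PowerSeries.mk fun k => fSum q k x) := by
  set u : ℕ → ℂ := fun i => x * q ^ i / (1 - x * q ^ i) with hu
  have hus : Summable fun i => ‖u i‖ := summable_norm_fterm hq1 x
  have h1 : Expands (fun P => ∏' d, (1 + (1 - P) * u d)) (PowerSeries.mk fun k => fSum q k x) := by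
    refine IsBigO.congr_left (tprod_one_add_sub_isBigO (a := fun P d => (1 - P) * u d) hus
      (Eventually.of_forall fun P d => (norm_mul _ _).le)) fun P => ?_
    have hf : ∀ k, fSum q k x = elemSum k u := fun _ => rfl
    simp only [elemSum_mul_left, Fin.sum_univ_four, coeff_mk, hf]
    simp [elemSum_zero]
    ring
  refine ((expands_const _).mul h1).congr (Eventually.of_forall fun P => ?_)
  have hm : Multipliable fun d => 1 + (1 - P) * u d := by
    refine multipliable_one_add_of_summable ?_
    simpa only [norm_mul] using hus.mul_left ‖1 - P‖
  simp only [qPochInf]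
  rw [← (multipliable_one_sub_mul_pow hq1 x).tprod_mul hm]
  refine tprod_congr fun j => ?_
  have := sub_ne_zero.2 (hx j).symm
  simp only [hu]
  field_simp
  ring

end ProductExpansions

section ThetaExpansion

variable {q : ℂ}

lemma summable_norm_div_gDen (hq1 : ‖q‖ < 1) (x : ℂ) {r : ℕ → ℂ} (hr : Summable fun d => ‖r d‖) :
    Summable fun d => ‖r d / gDen q x d‖ := by
  obtain ⟨K, hK⟩ := norm_one_sub_inv_bdd hq1 x
  obtain ⟨K', hK'⟩ := norm_one_sub_inv_bdd hq1 (q * x⁻¹)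
  refine (hr.mul_right (K * K')).of_nonneg_of_le (fun _ => norm_nonneg _) fun d => ?_
  have hK0 : 0 ≤ K := (norm_nonneg _).trans (hK 0)
  rw [div_eq_mul_inv, norm_mul, gDen, mul_inv, norm_mul]
  gcongr
  · exact hK d
  · exact hK' d

lemma summable_norm_gU (hq1 : ‖q‖ < 1) (x : ℂ) : Summable fun d => ‖gU q x d‖ := by
  refine summable_norm_div_gDen hq1 x ?_
  simp only [norm_mul, norm_pow]
  exact ((summable_geometric_of_lt_one (norm_nonneg _) hq1).mul_left _).mul_right _

lemma summable_norm_gV (hq1 : ‖q‖ < 1) (x : ℂ) : Summable fun d => ‖gV q x d‖ := by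
  refine summable_norm_div_gDen hq1 x ?_
  simp only [norm_mul, norm_pow, pow_succ]
  exact ((summable_geometric_of_lt_one (norm_nonneg _) hq1).mul_right _).mul_right _

lemma mul_pow_ne_one_of_forall_zpow {x : ℂ} (hx : ∀ n : ℤ, x ≠ q ^ n) (d : ℕ) :
    x * q ^ d ≠ 1 := fun h => by
  refine hx (-d) ?_
  rw [zpow_neg, zpow_natCast]
  exact eq_inv_of_mul_eq_one_left h

lemma div_mul_pow_ne_one_of_forall_zpow (hq0 : q ≠ 0) {x : ℂ} (hx0 : x ≠ 0)
    (hx : ∀ n : ℤ, x ≠ q ^ n) (d : ℕ) : q / x * q ^ d ≠ 1 := fun h => by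
  refine hx (d + 1) ?_
  rw [zpow_add_one₀ hq0, zpow_natCast]
  field_simp at h
  rw [← h]
  ring

lemma gDen_ne_zero (hq0 : q ≠ 0) {x : ℂ} (hx0 : x ≠ 0) (hx : ∀ n : ℤ, x ≠ q ^ n) (d : ℕ) :
    gDen q x d ≠ 0 :=
  mul_ne_zero (sub_ne_zero.2 (mul_pow_ne_one_of_forall_zpow hx d).symm)
    (sub_ne_zero.2 (div_mul_pow_ne_one_of_forall_zpow hq0 hx0 hx d).symm)

lemma gU_mul_gV (q x : ℂ) (i j : ℕ) (hx0 : x ≠ 0) :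
    gU q x i * gV q x j
      = q ^ (i + j + 1) * (1 - q * (x ^ 2)⁻¹) / (gDen q x i * gDen q x j) := by
  simp only [gU, gV]
  rw [div_mul_div_comm]
  congr 1
  rw [pow_add, pow_add, pow_add]
  field_simp

/-- The off-diagonal sum in `g₃` is `(∑ u)(∑ v) - ∑ u v`. -/
lemma tsum_offDiag (hq1 : ‖q‖ < 1) {x : ℂ} (hx0 : x ≠ 0) :
    (∑' ij : ℕ × ℕ, if ij.1 ≠ ij.2 then
        q ^ (ij.1 + ij.2 + 1) * (1 - q * (x ^ 2)⁻¹) / (gDen q x ij.1 * gDen q x ij.2) else 0)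
      = (∑' d, gU q x d) * (∑' d, gV q x d) - ∑' d, gU q x d * gV q x d := by
  have hU := summable_norm_gU hq1 x
  have hV := summable_norm_gV hq1 x
  have hUV := (summable_norm_mul_of_summable_norm hU hV).of_norm
  have h1 := (hU.mul_norm hV).of_norm
  have h1' := (hU.of_norm.tsum_mul_tsum hV.of_norm h1)
  have hdiag : HasSum (fun ij : ℕ × ℕ => if ij.1 = ij.2 then gU q x ij.1 * gV q x ij.2 else 0)
      (∑' d, gU q x d * gV q x d) := by
    have hinj : Function.Injective fun d : ℕ => (d, d) := fun a b h => (Prod.ext_iff.1 h).1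
    have := hinj.hasSum_iff (f := fun ij : ℕ × ℕ =>
      if ij.1 = ij.2 then gU q x ij.1 * gV q x ij.2 else 0) (a := ∑' d, gU q x d * gV q x d) ?_
    · refine this.1 ?_
      simpa [Function.comp_def] using hUV.hasSum
    · rintro ⟨i, j⟩ hij
      exact if_neg fun h => hij ⟨i, Prod.ext rfl h⟩
  rw [h1', ← hdiag.tsum_eq, ← h1.tsum_sub hdiag.summable]
  refine tsum_congr fun ij => ?_
  by_cases h : ij.1 = ij.2
  · simp [h]
  · rw [if_pos h, if_neg h, sub_zero, gU_mul_gV _ _ _ _ hx0]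

/-- The expansion of `(P x, q / (P x); q)_∞`. -/
lemma expands_thetaProd (hq0 : q ≠ 0) (hq1 : ‖q‖ < 1) {x : ℂ} (hx0 : x ≠ 0)
    (hx : ∀ n : ℤ, x ≠ q ^ n) {φ : ℂ⟦X⟧} (h₀ : coeff 0 φ = 1) (h₁ : coeff 1 φ = g1 q x)
    (h₂ : coeff 2 φ = g2 q x) (h₃ : coeff 3 φ = g3 q x) :
    Expands (fun P => thetaProd q (P * x)) (C (thetaProd q x) * φ) := by
  set u := gU q x with hu
  set v := gV q x with hv
  have hU : Summable fun d => ‖u d‖ := summable_norm_gU hq1 x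
  have hV : Summable fun d => ‖v d‖ := summable_norm_gV hq1 x
  have hUU := summable_norm_mul_of_summable_norm hU hU
  have hUV := summable_norm_mul_of_summable_norm hU hV
  have hVV := summable_norm_mul_of_summable_norm hV hV
  have hUUU := summable_norm_mul_of_summable_norm hUU hU
  have hUUV := summable_norm_mul_of_summable_norm hUU hV
  have hUVV := summable_norm_mul_of_summable_norm hUV hV
  have hVVV := summable_norm_mul_of_summable_norm hVV hV
  -- with `y = 1 - P`, each factor is `1 + y u - y² P⁻¹ v`, where `P⁻¹ = 1 + y + y² + ⋯`
  set a : ℂ → ℕ → ℂ := fun P d => (1 - P) * u d - (1 - P) ^ 2 * P⁻¹ * v d with ha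
  have hP0 : ∀ᶠ P : ℂ in 𝓝 1, P ≠ 0 := continuousAt_id.eventually_ne one_ne_zero
  have hsmall : ∀ᶠ P : ℂ in 𝓝 1, ‖(1 - P) * P⁻¹‖ < 1 := by
    have : ContinuousAt (fun P : ℂ => ‖(1 - P) * P⁻¹‖) 1 := by fun_prop (disch := norm_num)
    exact this.eventually_lt_const (by simp)
  have habound : ∀ᶠ P in 𝓝 1, ∀ d, ‖a P d‖ ≤ ‖1 - P‖ * (‖u d‖ + ‖v d‖) := by
    filter_upwards [hsmall] with P hP d
    have e : a P d = (1 - P) * (u d - ((1 - P) * P⁻¹) * v d) := by simp only [ha]; ring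
    rw [e, norm_mul]
    gcongr
    refine (norm_sub_le _ _).trans ?_
    gcongr
    rw [norm_mul]
    exact mul_le_of_le_one_left (norm_nonneg _) hP.le
  have hprod := tprod_one_add_sub_isBigO (hU.add hV) habound
  have hmain : Expands (fun P => 1 + elemSum 1 (a P) + elemSum 2 (a P) + elemSum 3 (a P)) φ := by
    set U := ∑' d, u d
    set V := ∑' d, v d
    set UU := ∑' d, u d * u d
    set UV := ∑' d, u d * v d
    set VV := ∑' d, v d * v d
    set UUU := ∑' d, u d * u d * u d
    set UUV := ∑' d, u d * u d * v d
    set UVV := ∑' d, u d * v d * v d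
    set VVV := ∑' d, v d * v d * v d
    have hg1 : g1 q x = U := rfl
    have eUU : ∑' d, u d ^ 2 = UU := tsum_congr fun d => sq _
    have eUUU : ∑' d, u d ^ 3 = UUU := tsum_congr fun d => by ring
    have hg2 : g2 q x = (U ^ 2 - UU) / 2 - V := by
      rw [g2, ← hu, elemSum_two hU, eUU]
    have hg3 : g3 q x = (U ^ 3 - 3 * U * UU + 2 * UUU) / 6 - (U * V - UV) - V := by
      rw [g3, ← hu, elemSum_three hU, eUU, eUUU, tsum_offDiag hq1 hx0]
    have p1 : ∀ P, HasSum (a P) ((1 - P) * U - (1 - P) ^ 2 * P⁻¹ * V) := fun P =>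
      (hU.of_norm.hasSum.mul_left _).sub (hV.of_norm.hasSum.mul_left _)
    have p2 : ∀ P, HasSum (fun d => a P d ^ 2) ((1 - P) ^ 2 * UU
        - 2 * (1 - P) * ((1 - P) ^ 2 * P⁻¹) * UV + ((1 - P) ^ 2 * P⁻¹) ^ 2 * VV) := fun P => by
      refine (((hUU.of_norm.hasSum.mul_left ((1 - P) ^ 2)).sub
        (hUV.of_norm.hasSum.mul_left (2 * (1 - P) * ((1 - P) ^ 2 * P⁻¹)))).add
        (hVV.of_norm.hasSum.mul_left (((1 - P) ^ 2 * P⁻¹) ^ 2))).congr_fun ?_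
      intro d
      simp only [ha]
      ring
    have p3 : ∀ P, HasSum (fun d => a P d ^ 3) ((1 - P) ^ 3 * UUU
        - 3 * (1 - P) ^ 2 * ((1 - P) ^ 2 * P⁻¹) * UUV
        + 3 * (1 - P) * ((1 - P) ^ 2 * P⁻¹) ^ 2 * UVV - ((1 - P) ^ 2 * P⁻¹) ^ 3 * VVV) := fun P => by
      refine ((((hUUU.of_norm.hasSum.mul_left ((1 - P) ^ 3)).sub
        (hUUV.of_norm.hasSum.mul_left (3 * (1 - P) ^ 2 * ((1 - P) ^ 2 * P⁻¹)))).add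
        (hUVV.of_norm.hasSum.mul_left (3 * (1 - P) * ((1 - P) ^ 2 * P⁻¹) ^ 2))).sub
        (hVVV.of_norm.hasSum.mul_left (((1 - P) ^ 2 * P⁻¹) ^ 3))).congr_fun ?_
      intro d
      simp only [ha]
      ring
    refine expands_of_eq
      (R := fun P => -P⁻¹ * V
        + (-2 * U * V * P⁻¹ + 2 * UV * P⁻¹ + (V ^ 2 - VV) * P⁻¹ ^ 2) / 2
        + (-3 * U ^ 2 * V * P⁻¹ + 3 * (1 - P) * U * V ^ 2 * P⁻¹ ^ 2
            - (1 - P) ^ 2 * V ^ 3 * P⁻¹ ^ 3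
            - 3 * (U * (-2 * P⁻¹ * UV + (1 - P) * P⁻¹ ^ 2 * VV)
              - P⁻¹ * V * (UU - 2 * (1 - P) * P⁻¹ * UV + (1 - P) ^ 2 * P⁻¹ ^ 2 * VV))
            + 2 * (-3 * P⁻¹ * UUV + 3 * (1 - P) * P⁻¹ ^ 2 * UVV
              - (1 - P) ^ 2 * P⁻¹ ^ 3 * VVV)) / 6) ?_ ?_ h₀ h₁ h₂ h₃
    · fun_prop (disch := norm_num)
    · filter_upwards [habound, hP0] with P hP hP0
      have hs : Summable fun d => ‖a P d‖ :=
        ((hU.add hV).mul_left _).of_nonneg_of_le (fun _ => norm_nonneg _) hP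
      rw [elemSum_one, elemSum_two hs, elemSum_three hs, (p1 P).tsum_eq, (p2 P).tsum_eq,
        (p3 P).tsum_eq, hg1, hg2, hg3]
      field_simp
      ring
  refine ((expands_const _).mul (expands_of_sub_isBigO hmain hprod)).congr ?_
  filter_upwards [habound, hP0] with P hP hP0
  have hs : Summable fun d => ‖a P d‖ :=
    ((hU.add hV).mul_left _).of_nonneg_of_le (fun _ => norm_nonneg _) hP
  have hm := multipliable_one_add_of_summable hs
  have hm1 := multipliable_one_sub_mul_pow hq1 x
  have hm2 := multipliable_one_sub_mul_pow hq1 (q / x)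
  simp only [thetaProd, qPochInf]
  rw [← hm1.tprod_mul hm2, ← (hm1.mul hm2).tprod_mul hm,
    ← (multipliable_one_sub_mul_pow hq1 _).tprod_mul (multipliable_one_sub_mul_pow hq1 _)]
  refine tprod_congr fun d => ?_
  have hD := gDen_ne_zero hq0 hx0 hx d
  have e : (1 - x * q ^ d) * (1 - q / x * q ^ d) = gDen q x d := by
    rw [gDen, div_eq_mul_inv]
  have e2 : gDen q x d * (1 + a P d) = gDen q x d + (1 - P) * (x * q ^ d * (1 - q * (x ^ 2)⁻¹))
      - (1 - P) ^ 2 * P⁻¹ * (q ^ (d + 1) * x⁻¹) := by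
    simp only [ha, hu, hv, gU, gV]
    field_simp
    ring
  rw [e, e2, gDen]
  field_simp
  ring

end ThetaExpansion

/-! ### The expansions of `ratioF` and `ratioG`, and the regular set -/

section Ratios

variable {q p : ℂ}

/-- The recursion for the coefficients of a quotient of power series gives `quotCoeff`. -/
lemma coeff_mul_inv_eq_quotCoeff {φ ψ : ℂ⟦X⟧} {B1 B2 B3 A1 A2 A3 : ℂ} (hφ0 : coeff 0 φ = 1)
    (hφ1 : coeff 1 φ = B1) (hφ2 : coeff 2 φ = B2) (hφ3 : coeff 3 φ = B3) (hψ0 : coeff 0 ψ = 1)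
    (hψ1 : coeff 1 ψ = A1) (hψ2 : coeff 2 ψ = A2) (hψ3 : coeff 3 ψ = A3) (j : Fin 4) :
    coeff (j : ℕ) (φ * ψ⁻¹) = quotCoeff B1 B2 B3 A1 A2 A3 j := by
  set χ := φ * ψ⁻¹ with hχ
  have h : χ * ψ = φ := by
    rw [hχ, mul_assoc, PowerSeries.inv_mul_cancel ψ (by
      rw [← coeff_zero_eq_constantCoeff_apply, hψ0]
      exact one_ne_zero), mul_one]
  have e0 := congrArg (coeff 0) h
  have e1 := congrArg (coeff 1) h
  have e2 := congrArg (coeff 2) h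
  have e3 := congrArg (coeff 3) h
  rw [coeff_mul_zero, hψ0, hφ0, mul_one] at e0
  rw [coeff_mul_one, hψ0, hψ1, hφ1, e0] at e1
  rw [coeff_mul_two, hψ0, hψ1, hψ2, hφ2, e0] at e2
  rw [coeff_mul_three, hψ0, hψ1, hψ2, hψ3, hφ3, e0] at e3
  have f1 : coeff 1 χ = B1 - A1 := by linear_combination e1
  rw [f1] at e2 e3
  have f2 : coeff 2 χ = A1 ^ 2 - B1 * A1 - A2 + B2 := by linear_combination e2
  rw [f2] at e3
  have f3 : coeff 3 χ = -A1 ^ 3 + B1 * (A1 ^ 2 - A2) + 2 * A1 * A2 - A1 * B2 - A3 + B3 := by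
    linear_combination e3
  fin_cases j
  · simpa [quotCoeff] using e0
  · simpa [quotCoeff] using f1
  · simpa [quotCoeff] using f2
  · simpa [quotCoeff] using f3

/-- `F_1, F_2, F_3` are the coefficients of a product of four series. -/
lemma F_coeffs (x : Fin 4 → ℂ) :
    coeff 0 (∏ i, PowerSeries.mk fun k => fSum q k (x i)) = 1 ∧
    coeff 1 (∏ i, PowerSeries.mk fun k => fSum q k (x i)) = F1 q x ∧
    coeff 2 (∏ i, PowerSeries.mk fun k => fSum q k (x i)) = F2 q x ∧
    coeff 3 (∏ i, PowerSeries.mk fun k => fSum q k (x i)) = F3 q x := by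
  have h0 : ∀ x, fSum q 0 x = 1 := fun x => elemSum_zero _
  refine ⟨?_, ?_, ?_, ?_⟩
  · simp only [Fin.prod_univ_four, coeff_mul_zero, coeff_mk, h0, mul_one]
  · simp only [Fin.prod_univ_four, coeff_mul_zero, coeff_mul_one, coeff_mk, h0, F1,
      Fin.sum_univ_four]
    ring
  · simp only [Fin.prod_univ_four, coeff_mul_zero, coeff_mul_one, coeff_mul_two, coeff_mk, h0, F2,
      Fin.sum_univ_four]
    simp
    ring
  · simp only [Fin.prod_univ_four, coeff_mul_zero, coeff_mul_one, coeff_mul_two, coeff_mul_three,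
      coeff_mk, h0, F3, Fin.sum_univ_four]
    simp
    ring

/-- The polynomial `∑_{j < 4} v_j y^j` as a power series. -/
noncomputable def jet (v : Fin 4 → ℂ) : ℂ⟦X⟧ :=
  PowerSeries.mk fun j => if h : j < 4 then v ⟨j, h⟩ else 0

lemma coeff_jet (v : Fin 4 → ℂ) (j : Fin 4) : coeff (j : ℕ) (jet v) = v j := by
  simp [jet]

lemma norm_lt_one_of_pow_eq (hq1 : ‖q‖ < 1) (hp : p ^ 5 = q) : ‖p‖ < 1 := by
  rw [← hp, norm_pow] at hq1
  exact (pow_lt_one_iff_of_nonneg (norm_nonneg _) (by norm_num)).1 hq1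

lemma ne_zero_of_pow_eq (hq0 : q ≠ 0) (hp : p ^ 5 = q) : p ≠ 0 := by
  rintro rfl
  exact hq0 (by rw [← hp]; norm_num)

lemma mul_pow_ne_one_of_norm_lt {a : ℂ} (ha : ‖a‖ < 1) (hq1 : ‖q‖ < 1) (j : ℕ) :
    a * q ^ j ≠ 1 := fun h => by
  have h1 := congrArg norm h
  rw [norm_mul, norm_pow, norm_one] at h1
  have : ‖a‖ * ‖q‖ ^ j < 1 :=
    mul_lt_one_of_nonneg_of_lt_one_left (norm_nonneg _) ha (pow_le_one₀ (norm_nonneg _) hq1.le)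
  exact this.ne h1

lemma alphas_ne_zero (hp0 : p ≠ 0) (k : Fin 4) : alphas p k ≠ 0 := pow_ne_zero _ hp0

lemma norm_alphas_lt_one (hp1 : ‖p‖ < 1) (k : Fin 4) : ‖alphas p k‖ < 1 := by
  rw [alphas, norm_pow]
  exact pow_lt_one₀ (norm_nonneg _) hp1 (Nat.succ_ne_zero _)

lemma zpow_injective_of_norm_lt_one (hp0 : p ≠ 0) (hp1 : ‖p‖ < 1) {m n : ℤ} (h : p ^ m = p ^ n) :
    m = n := by
  have h1 := congrArg norm h
  rw [norm_zpow, norm_zpow] at h1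
  exact zpow_right_injective₀ (norm_pos_iff.2 hp0) hp1.ne h1

lemma q_zpow (hp : p ^ 5 = q) (n : ℤ) : q ^ n = p ^ (5 * n) := by
  rw [← hp, zpow_mul]
  norm_cast

lemma alphas_eq_zpow (p : ℂ) (k : Fin 4) : alphas p k = p ^ ((k : ℤ) + 1) := by
  rw [alphas]
  norm_cast

lemma alphas_ne_q_zpow (hp0 : p ≠ 0) (hp1 : ‖p‖ < 1) (hp : p ^ 5 = q) (k : Fin 4) (n : ℤ) :
    alphas p k ≠ q ^ n := fun h => by
  rw [q_zpow hp, alphas_eq_zpow] at h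
  have := zpow_injective_of_norm_lt_one hp0 hp1 h
  omega

lemma zpow_mul_mem_regularSet (hp0 : p ≠ 0) {Q : ℂ} (hQ : Q ∈ regularSet p) (m : ℤ) :
    p ^ m * Q ∈ regularSet p := by
  refine ⟨mul_ne_zero (zpow_ne_zero _ hp0) hQ.1, fun n => ?_⟩
  have hm := zpow_ne_zero m hp0
  refine ⟨fun h => (hQ.2 (n - m)).1 ?_, fun h => (hQ.2 (n - m)).2 ?_⟩
  · rw [zpow_sub₀ hp0, ← h]
    field_simp
  · rw [zpow_sub₀ hp0, ← neg_div, ← h]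
    field_simp

lemma inv_mem_regularSet {Q : ℂ} (hQ : Q ∈ regularSet p) : Q⁻¹ ∈ regularSet p := by
  refine ⟨inv_ne_zero hQ.1, fun n => ⟨fun h => (hQ.2 (-n)).1 ?_, fun h => (hQ.2 (-n)).2 ?_⟩⟩
  · rw [zpow_neg, ← h, inv_inv]
  · rw [zpow_neg, ← inv_neg, ← h, inv_inv]

lemma alphas_mul_mem_regularSet (hp0 : p ≠ 0) {Q : ℂ} (hQ : Q ∈ regularSet p) (k : Fin 4) :
    alphas p k * Q ∈ regularSet p := by
  rw [alphas_eq_zpow]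
  exact zpow_mul_mem_regularSet hp0 hQ _

lemma q_zpow_mul_mem_regularSet (hp0 : p ≠ 0) (hp : p ^ 5 = q) {Q : ℂ} (hQ : Q ∈ regularSet p)
    (n : ℤ) : q ^ n * Q ∈ regularSet p := by
  rw [q_zpow hp]
  exact zpow_mul_mem_regularSet hp0 hQ _

lemma ne_q_zpow_of_mem_regularSet (hp : p ^ 5 = q) {Q : ℂ} (hQ : Q ∈ regularSet p) (n : ℤ) :
    Q ≠ q ^ n := by
  rw [q_zpow hp]
  exact (hQ.2 _).1

lemma ne_neg_q_zpow_of_mem_regularSet (hp : p ^ 5 = q) {Q : ℂ} (hQ : Q ∈ regularSet p) (n : ℤ) :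
    Q ≠ -q ^ n := by
  rw [q_zpow hp]
  exact (hQ.2 _).2

lemma Expands.div_normalized {f g : ℂ → ℂ} {φ ψ : ℂ⟦X⟧} {a b : ℂ} (hf : Expands f (C a * φ))
    (hg : Expands g (C b * ψ)) (hb : b ≠ 0) (hψ : coeff 0 ψ = 1) :
    Expands (fun P => f P / g P) (C (a / b) * (φ * ψ⁻¹)) := by
  have h := hf.div hg (by rwa [coeff_C_mul, hψ, mul_one])
  have e : C a * φ * (C b * ψ)⁻¹ = C (a / b) * (φ * ψ⁻¹) := by
    rw [PowerSeries.mul_inv_rev, PowerSeries.C_inv, div_eq_mul_inv, map_mul]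
    ring
  rwa [e] at h

lemma expands_ratioF (hq1 : ‖q‖ < 1) (hp : p ^ 5 = q) :
    Expands (ratioF q p) (C (ratioF q p 1) * jet (bbF q p)) := by
  have hp1 := norm_lt_one_of_pow_eq hq1 hp
  obtain ⟨a0, a1, a2, a3⟩ := F_coeffs (q := q) (alphas p)
  obtain ⟨b0, b1, b2, b3⟩ := F_coeffs (q := q) (fun _ => q)
  have hnum := Expands.prod Finset.univ fun i (_ : i ∈ Finset.univ) => expands_qPochInf hq1
    (mul_pow_ne_one_of_norm_lt (norm_alphas_lt_one hp1 i) hq1)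
  have hden := Expands.prod (Finset.univ : Finset (Fin 4)) fun i (_ : i ∈ Finset.univ) =>
    expands_qPochInf hq1 (mul_pow_ne_one_of_norm_lt hq1 hq1)
  have hqq : qPochInf q q ≠ 0 := qPochInf_ne_zero hq1 (mul_pow_ne_one_of_norm_lt hq1 hq1)
  rw [Finset.prod_mul_distrib, ← map_prod] at hnum hden
  refine ((hnum.div_normalized hden (Finset.prod_ne_zero_iff.2 fun _ _ => hqq) b0).congr
    (Eventually.of_forall fun P => ?_)).congr_coeff fun j => ?_
  · simp [ratioF]
  · rw [coeff_C_mul, coeff_C_mul, coeff_jet, bbF,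
      coeff_mul_inv_eq_quotCoeff a0 a1 a2 a3 b0 b1 b2 b3]
    simp [ratioF]

lemma ratioG_eq_thetaProd_div {Q P : ℂ} (k : Fin 4) :
    ratioG q p k Q P = thetaProd q (P * (alphas p k * Q)) / thetaProd q (P * alphas p k) := by
  have e1 : P⁻¹ * Q⁻¹ * (q / alphas p k) = q / (P * (alphas p k * Q)) := by
    simp only [div_eq_mul_inv, mul_inv]
    ring
  have e2 : P⁻¹ * (q / alphas p k) = q / (P * alphas p k) := by
    simp only [div_eq_mul_inv, mul_inv]
    ring
  rw [ratioG, thetaProd, thetaProd, e1, e2, mul_assoc P]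

lemma theta_neg_div_theta_neg (hq0 : q ≠ 0) (hq1 : ‖q‖ < 1) {x y : ℂ} (hx : x ≠ 0) (hy : y ≠ 0) :
    theta q (-x) / theta q (-y) = thetaProd q x / thetaProd q y := by
  obtain ⟨c, hc, h⟩ := exists_theta_neg_eq hq0 hq1
  rw [h x hx, h y hy, mul_div_mul_left _ _ hc]

lemma expands_ratioG (hq0 : q ≠ 0) (hq1 : ‖q‖ < 1) (hp : p ^ 5 = q) (k : Fin 4) {Q : ℂ}
    (hQ : Q ∈ regularSet p) :
    Expands (ratioG q p k Q) (C (thetaProd q (alphas p k * Q) / thetaProd q (alphas p k))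
      * jet (bbG q p k Q)) := by
  have hp0 := ne_zero_of_pow_eq hq0 hp
  have hp1 := norm_lt_one_of_pow_eq hq1 hp
  have hα := alphas_ne_zero hp0 k
  have hαq := alphas_ne_q_zpow hp0 hp1 hp k
  have hαQ := alphas_mul_mem_regularSet hp0 hQ k
  have key : ∀ x, coeff 0 (jet ![1, g1 q x, g2 q x, g3 q x]) = 1 ∧
      coeff 1 (jet ![1, g1 q x, g2 q x, g3 q x]) = g1 q x ∧
      coeff 2 (jet ![1, g1 q x, g2 q x, g3 q x]) = g2 q x ∧
      coeff 3 (jet ![1, g1 q x, g2 q x, g3 q x]) = g3 q x := fun x =>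
    ⟨coeff_jet _ 0, coeff_jet _ 1, coeff_jet _ 2, coeff_jet _ 3⟩
  obtain ⟨a0, a1, a2, a3⟩ := key (alphas p k * Q)
  obtain ⟨b0, b1, b2, b3⟩ := key (alphas p k)
  have hnum := expands_thetaProd hq0 hq1 hαQ.1 (ne_q_zpow_of_mem_regularSet hp hαQ) a0 a1 a2 a3
  have hden := expands_thetaProd hq0 hq1 hα hαq b0 b1 b2 b3
  refine ((hnum.div_normalized hden (thetaProd_ne_zero hq0 hq1 hα hαq) b0).congr
    (Eventually.of_forall fun P => (ratioG_eq_thetaProd_div k).symm)).congr_coeff fun j => ?_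
  rw [coeff_C_mul, coeff_C_mul, coeff_jet, bbG,
    coeff_mul_inv_eq_quotCoeff a0 a1 a2 a3 b0 b1 b2 b3]

lemma q_mul_mem_regularSet (hp0 : p ≠ 0) (hp : p ^ 5 = q) {Q : ℂ} (hQ : Q ∈ regularSet p) :
    q * Q ∈ regularSet p := by
  simpa using q_zpow_mul_mem_regularSet hp0 hp hQ 1

lemma q_pow_mul_mem_regularSet (hp0 : p ≠ 0) (hp : p ^ 5 = q) {Q : ℂ} (hQ : Q ∈ regularSet p)
    (n : ℕ) : q ^ n * Q ∈ regularSet p := by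
  simpa using q_zpow_mul_mem_regularSet hp0 hp hQ n

/-- The regular set is the complement of the zeros of two theta functions of base `p`. -/
lemma mem_regularSet_iff (hp0 : p ≠ 0) (hp1 : ‖p‖ < 1) {Q : ℂ} :
    Q ∈ regularSet p ↔ Q ≠ 0 ∧ thetaProd p Q ≠ 0 ∧ thetaProd p (-Q) ≠ 0 := by
  rw [regularSet, Set.mem_ofPred_eq]
  refine and_congr_right fun hQ => ?_
  rw [Ne, Ne, thetaProd_eq_zero_iff hp0 hp1 hQ, thetaProd_eq_zero_iff hp0 hp1 (neg_ne_zero.2 hQ)]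
  push Not
  rw [← forall_and]
  refine forall_congr' fun n => and_congr_right fun _ => ?_
  rw [not_iff_not, neg_eq_iff_eq_neg]

lemma isOpen_regularSet (hp0 : p ≠ 0) (hp1 : ‖p‖ < 1) : IsOpen (regularSet p) := by
  rw [isOpen_iff_mem_nhds]
  intro Q hQ
  obtain ⟨h0, h1, h2⟩ := (mem_regularSet_iff hp0 hp1).1 hQ
  have c1 := (differentiableAt_thetaProd hp1 h0).continuousAt.eventually_ne h1
  have c2 := ((differentiableAt_thetaProd hp1 (neg_ne_zero.2 h0)).continuousAt.comp
    (f := fun Q : ℂ => -Q) continuous_neg.continuousAt).eventually_ne h2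
  filter_upwards [isOpen_ne.mem_nhds h0, c1, c2] with x h0 h1 h2
  exact (mem_regularSet_iff hp0 hp1).2 ⟨h0, h1, h2⟩

/-- The regular set is connected, being the complement of a countable set. -/
lemma isPreconnected_regularSet (p : ℂ) : IsPreconnected (regularSet p) := by
  have hc : ({0} ∪ Set.range (fun n : ℤ => p ^ n) ∪ Set.range (fun n : ℤ => -p ^ n) : Set ℂ).Countable :=
    ((Set.countable_singleton _).union (Set.countable_range _)).union (Set.countable_range _)
  have e : regularSet p
      = ({0} ∪ Set.range (fun n : ℤ => p ^ n) ∪ Set.range (fun n : ℤ => -p ^ n) : Set ℂ)ᶜ := by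
    ext Q
    simp only [regularSet, Set.mem_ofPred_eq, Set.mem_compl_iff, Set.mem_union,
      Set.mem_singleton_iff, Set.mem_range, not_or, not_exists, forall_and, and_assoc]
    simp only [ne_comm (a := Q), Ne]
  rw [e]
  exact (hc.isPathConnected_compl_of_one_lt_rank (by simp)).isConnected.isPreconnected

lemma analyticAt_thetaProd (hq1 : ‖q‖ < 1) {x : ℂ} (hx : x ≠ 0) : AnalyticAt ℂ (thetaProd q) x :=
  (differentiableOn_thetaProd hq1).analyticAt (isOpen_compl_singleton.mem_nhds hx)

/-- Each coefficient of the expansion of `ratioG` is a holomorphic function of `Q`, because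
`ratioG q p k Q P` depends on `Q` only through the numerator, a function of `P Q`. -/
lemma analyticAt_bbG (hq0 : q ≠ 0) (hq1 : ‖q‖ < 1) (hp : p ^ 5 = q) (k j : Fin 4) {Q : ℂ}
    (hQ : Q ∈ regularSet p) : AnalyticAt ℂ (fun Q => bbG q p k Q j) Q := by
  have hp0 := ne_zero_of_pow_eq hq0 hp
  have hp1 := norm_lt_one_of_pow_eq hq1 hp
  have hα := alphas_ne_zero hp0 k
  have hαq := alphas_ne_q_zpow hp0 hp1 hp k
  set h : ℂ → ℂ := fun z => thetaProd q (alphas p k * z) with hh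
  have han : ∀ z ≠ 0, AnalyticAt ℂ h z := fun z hz =>
    (analyticAt_thetaProd hq1 (mul_ne_zero hα hz)).fun_comp (by fun_prop)
  have h1 : thetaProd q (alphas p k) ≠ 0 := thetaProd_ne_zero hq0 hq1 hα hαq
  have hhQ : ∀ z ∈ regularSet p, h z ≠ 0 := fun z hz =>
    have hz' := alphas_mul_mem_regularSet hp0 hz k
    thetaProd_ne_zero hq0 hq1 hz'.1 (ne_q_zpow_of_mem_regularSet hp hz')
  have key : ∀ z ∈ regularSet p, bbG q p k z j = (h z / h 1)⁻¹
      * ∑ ij ∈ Finset.HasAntidiagonal.antidiagonal (j : ℕ),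
        coeff ij.1 (dilationJet h z) * coeff ij.2 (dilationJet h 1)⁻¹ := by
    intro z hz
    have e1 := expands_dilation (han z hz.1)
    have e2 := expands_dilation (han 1 one_ne_zero)
    have e0 : coeff 0 (dilationJet h 1) = h 1 := by simp [dilationJet]
    have e3 := (e1.div e2 (by rw [e0]; simpa [hh] using h1)).congr (g := ratioG q p k z)
      (Eventually.of_forall fun P => by
        simp only [ratioG_eq_thetaProd_div, hh]
        rw [mul_left_comm P, mul_one, mul_comm P (alphas p k)])
    have := e3.unique (expands_ratioG hq0 hq1 hp k hz) j
    rw [coeff_C_mul, coeff_jet, coeff_mul] at this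
    rw [this, eq_inv_mul_iff_mul_eq₀ (div_ne_zero (hhQ z hz) (by simpa [hh] using h1))]
    simp [hh]
  have hev : (fun z => bbG q p k z j) =ᶠ[𝓝 Q] fun z => (h z / h 1)⁻¹
      * ∑ ij ∈ Finset.HasAntidiagonal.antidiagonal (j : ℕ),
        coeff ij.1 (dilationJet h z) * coeff ij.2 (dilationJet h 1)⁻¹ := by
    filter_upwards [(isOpen_regularSet hp0 hp1).mem_nhds hQ] with z hz using key z hz
  refine AnalyticAt.congr ?_ hev.symm
  have hd : h Q / h 1 ≠ 0 := div_ne_zero (hhQ Q hQ) (by simpa [hh] using h1)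
  refine AnalyticAt.mul (AnalyticAt.inv ((han Q hQ.1).div analyticAt_const ?_) hd) ?_
  · simpa [hh] using h1
  · exact Finset.analyticAt_fun_sum _ fun ij _ =>
      (analyticAt_coeff_dilationJet (han Q hQ.1) _).mul analyticAt_const

end Ratios

/-! ### Theta functions of degree four and the connection identity -/

section Interpolation

variable {q : ℂ}

/-- A holomorphic function on `ℂ^*` with the quasi-periodicity of a product of `|s|` theta
functions is divisible by the product of the theta functions attached to its zeros. -/
lemma exists_eq_prod_thetaProd_mul (hq0 : q ≠ 0) (hq1 : ‖q‖ < 1) {ι : Type*} {α : ι → ℂ}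
    (hα0 : ∀ i, α i ≠ 0) (s : Finset ι) (hα : ∀ i ∈ s, ∀ j ∈ s, i ≠ j → ∀ n : ℤ, α i / α j ≠ q ^ n) :
    ∀ {f : ℂ → ℂ} {c : ℂ}, DifferentiableOn ℂ f {0}ᶜ → c ≠ 0 →
      (∀ x ≠ 0, f (q * x) = c * (x ^ s.card)⁻¹ * f x) → (∀ i ∈ s, f (α i)⁻¹ = 0) →
      ∃ g, DifferentiableOn ℂ g {0}ᶜ ∧ (∀ x ≠ 0, f x = (∏ i ∈ s, thetaProd q (α i * x)) * g x) ∧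
        ∀ x ≠ 0, g (q * x) = (c * ∏ i ∈ s, -α i) * g x := by
  classical
  induction s using Finset.induction_on with
  | empty =>
    intro f c hf hc hfq _
    exact ⟨f, hf, by simp, by simpa using hfq⟩
  | insert a s ha ih =>
    intro f c hf hc hfq hz
    have hzero : ∀ n : ℤ, f (q ^ n * (α a)⁻¹) = 0 := fun n =>
      (q_zpow_induction hq0 (S := fun x => f x = 0) (fun x hx => by
        rw [hfq x hx]
        simp [hc, hx]) (inv_ne_zero (hα0 a)) n).2 (hz a (Finset.mem_insert_self _ _))
    obtain ⟨g, hg, hfg⟩ := exists_eq_thetaProd_mul hq0 hq1 hf (hα0 a) hzero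
    have hT : DifferentiableOn ℂ (fun x => thetaProd q (α a * x)) {0}ᶜ :=
      (differentiableOn_thetaProd hq1).comp (by fun_prop) fun x hx => mul_ne_zero (hα0 a) hx
    -- a point at which `thetaProd q (α a * x)` does not vanish
    have hneg : thetaProd q (α a * -(α a)⁻¹) ≠ 0 := by
      rw [mul_neg, mul_inv_cancel₀ (hα0 a)]
      exact thetaProd_neg_one_ne_zero hq0 hq1
    have hgq : ∀ x ≠ 0, g (q * x) = (c * -α a) * (x ^ s.card)⁻¹ * g x := by
      refine eq_of_eq_off_zeros (hg.comp (by fun_prop) fun x hx => mul_ne_zero hq0 hx)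
        (DifferentiableOn.mul ?_ hg) hT
        (neg_ne_zero.2 (inv_ne_zero (hα0 a))) hneg fun x hx hTx => ?_
      · exact (differentiableOn_const _).mul
          (DifferentiableOn.inv (by fun_prop) fun x hx => pow_ne_zero _ hx)
      · have h1 := hfq x hx
        have hax := mul_ne_zero (hα0 a) hx
        have h2 := hα0 a
        rw [hfg x hx, hfg _ (mul_ne_zero hq0 hx), mul_left_comm, thetaProd_mul_q hq0 hq1 hax,
          Finset.card_insert_of_notMem ha, pow_succ] at h1
        field_simp at h1 ⊢
        linear_combination -h1
    have hc' : c * -α a ≠ 0 := mul_ne_zero hc (neg_ne_zero.2 (hα0 a))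
    obtain ⟨k, hk, hgk, hkq⟩ := ih (fun i hi j hj => hα i (Finset.mem_insert_of_mem hi) j
      (Finset.mem_insert_of_mem hj)) hg hc' hgq fun i hi => by
        have h1 := hz i (Finset.mem_insert_of_mem hi)
        have hai : a ≠ i := fun h => ha (h ▸ hi)
        have h2 := hα a (Finset.mem_insert_self _ _) i (Finset.mem_insert_of_mem hi) hai
        rw [hfg _ (inv_ne_zero (hα0 i)), ← div_eq_mul_inv] at h1
        exact (mul_eq_zero.1 h1).resolve_left
          (thetaProd_ne_zero hq0 hq1 (div_ne_zero (hα0 a) (hα0 i)) h2)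
    refine ⟨k, hk, fun x hx => ?_, fun x hx => ?_⟩
    · rw [hfg x hx, hgk x hx, Finset.prod_insert ha, mul_assoc]
    · rw [hkq x hx, Finset.prod_insert ha, mul_assoc c]

end Interpolation

section Connection

variable {q p Q : ℂ}

lemma differentiable_tsum_of_forall_bound {F : ℕ → ℂ → ℂ} (hF : ∀ d, Differentiable ℂ (F d))
    (hb : ∀ r : ℝ, ∃ u : ℕ → ℝ, Summable u ∧ ∀ d z, ‖z‖ ≤ r → ‖F d z‖ ≤ u d) :
    Differentiable ℂ fun z => ∑' d, F d z := by
  intro z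
  obtain ⟨u, hu, hFu⟩ := hb (‖z‖ + 1)
  have := Complex.differentiableOn_tsum_of_summable_norm hu
    (fun d => (hF d).differentiableOn) (Metric.isOpen_ball (x := (0 : ℂ)) (ε := ‖z‖ + 1))
    fun d w hw => hFu d w (mem_ball_zero_iff.1 hw).le
  exact this.differentiableAt (Metric.isOpen_ball.mem_nhds (by simp))

/-- The terms `Q^d (P q^{d+1}; q)_∞^4 ∏ (P α_l; q)_d`. -/
noncomputable def posTerm (q p Q : ℂ) (d : ℕ) (P : ℂ) : ℂ :=
  Q ^ d * (qPochInf q (P * q ^ (d + 1)) ^ 4 * ∏ l, qPoch q (P * alphas p l) d)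

/-- The terms `(q² / Q)^{n+1} (w; q)_{n+1}^4 ∏ (q^{n+2} w / α_l; q)_∞` with `w = 1 / P`. -/
noncomputable def negTerm (q p Q : ℂ) (n : ℕ) (w : ℂ) : ℂ :=
  (q ^ 2 / Q) ^ (n + 1)
    * (qPoch q w (n + 1) ^ 4 * ∏ l, qPochInf q (w * (q / alphas p l) * q ^ (n + 1)))

lemma norm_mul_pow_le {a : ℂ} {r : ℝ} (ha : ‖a‖ ≤ r) (hq1 : ‖q‖ < 1) (n : ℕ) : ‖a * q ^ n‖ ≤ r := by
  rw [norm_mul, norm_pow]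
  exact (mul_le_of_le_one_right (norm_nonneg _) (pow_le_one₀ (norm_nonneg _) hq1.le)).trans ha

lemma norm_mul_le_of_norm_le_one {a b : ℂ} {r : ℝ} (ha : ‖a‖ ≤ r) (hb : ‖b‖ ≤ 1) : ‖a * b‖ ≤ r := by
  rw [norm_mul]
  exact (mul_le_of_le_one_right (norm_nonneg _) hb).trans ha

lemma q_div_alphas (hp0 : p ≠ 0) (hp : p ^ 5 = q) (k : Fin 4) :
    q / alphas p k = p ^ (4 - (k : ℕ)) := by
  rw [div_eq_iff (alphas_ne_zero hp0 k), alphas, ← pow_add, ← hp]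
  congr 1
  omega

lemma norm_q_div_alphas_lt_one (hp0 : p ≠ 0) (hp1 : ‖p‖ < 1) (hp : p ^ 5 = q) (k : Fin 4) :
    ‖q / alphas p k‖ < 1 := by
  rw [q_div_alphas hp0 hp, norm_pow]
  exact pow_lt_one₀ (norm_nonneg _) hp1 (by omega)

lemma norm_posTerm_le (hq1 : ‖q‖ < 1) (hp1 : ‖p‖ < 1) {r : ℝ} {P : ℂ} (hP : ‖P‖ ≤ r) (d : ℕ) :
    ‖posTerm q p Q d P‖ ≤ ‖Q‖ ^ d * (Real.exp (r * (1 - ‖q‖)⁻¹) ^ 4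
      * Real.exp (r * (1 - ‖q‖)⁻¹) ^ 4) := by
  rw [posTerm, norm_mul, norm_pow, norm_mul, norm_pow, norm_prod]
  gcongr
  · exact norm_qPochInf_le hq1 (norm_mul_pow_le hP hq1 _)
  · refine (Finset.prod_le_prod (g := fun _ => Real.exp (r * (1 - ‖q‖)⁻¹))
      (fun _ _ => norm_nonneg _) fun l _ => ?_).trans_eq (by simp)
    exact norm_qPoch_le hq1 (norm_mul_le_of_norm_le_one hP (norm_alphas_lt_one hp1 l).le) d

lemma norm_negTerm_le (hq1 : ‖q‖ < 1) (hp0 : p ≠ 0) (hp1 : ‖p‖ < 1) (hp : p ^ 5 = q) {r : ℝ}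
    {w : ℂ} (hw : ‖w‖ ≤ r) (n : ℕ) :
    ‖negTerm q p Q n w‖ ≤ ‖q ^ 2 / Q‖ ^ (n + 1) * (Real.exp (r * (1 - ‖q‖)⁻¹) ^ 4
      * Real.exp (r * (1 - ‖q‖)⁻¹) ^ 4) := by
  rw [negTerm, norm_mul, norm_pow, norm_mul, norm_pow, norm_prod]
  gcongr
  · exact norm_qPoch_le hq1 hw _
  · refine (Finset.prod_le_prod (g := fun _ => Real.exp (r * (1 - ‖q‖)⁻¹))
      (fun _ _ => norm_nonneg _) fun l _ => ?_).trans_eq (by simp)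
    exact norm_qPochInf_le hq1 (norm_mul_pow_le (norm_mul_le_of_norm_le_one hw
      (norm_q_div_alphas_lt_one hp0 hp1 hp l).le) hq1 _)

lemma differentiable_posTerm (hq1 : ‖q‖ < 1) (d : ℕ) : Differentiable ℂ (posTerm q p Q d) := by
  have h1 := differentiable_qPochInf hq1
  have h2 := differentiable_qPoch (q := q) d
  unfold posTerm
  have h3 : Differentiable ℂ fun P => qPochInf q (P * q ^ (d + 1)) := h1.comp (by fun_prop)
  have h4 : ∀ l, Differentiable ℂ fun P => qPoch q (P * alphas p l) d := fun l =>
    h2.comp (by fun_prop)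
  fun_prop

lemma differentiable_negTerm (hq1 : ‖q‖ < 1) (n : ℕ) : Differentiable ℂ (negTerm q p Q n) := by
  have h1 := differentiable_qPochInf hq1
  have h2 := differentiable_qPoch (q := q) (n + 1)
  unfold negTerm
  have h3 : ∀ l, Differentiable ℂ fun w => qPochInf q (w * (q / alphas p l) * q ^ (n + 1)) :=
    fun l => h1.comp (by fun_prop)
  fun_prop

lemma differentiable_posSum (hq1 : ‖q‖ < 1) (hp1 : ‖p‖ < 1) (hQ : ‖Q‖ < 1) :
    Differentiable ℂ fun P => ∑' d, posTerm q p Q d P := by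
  refine differentiable_tsum_of_forall_bound (differentiable_posTerm hq1) fun r => ⟨_, ?_,
    fun d z hz => norm_posTerm_le hq1 hp1 hz d⟩
  exact (summable_geometric_of_lt_one (norm_nonneg _) hQ).mul_right _

lemma differentiable_negSum (hq1 : ‖q‖ < 1) (hp0 : p ≠ 0) (hp1 : ‖p‖ < 1) (hp : p ^ 5 = q)
    (hQ : ‖q ^ 2 / Q‖ < 1) : Differentiable ℂ fun w => ∑' n, negTerm q p Q n w := by
  refine differentiable_tsum_of_forall_bound (differentiable_negTerm hq1) fun r => ⟨_, ?_,
    fun n z hz => norm_negTerm_le hq1 hp0 hp1 hp hz n⟩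
  exact ((summable_nat_add_iff 1).2 (summable_geometric_of_lt_one (norm_nonneg _) hQ)).mul_right _

lemma summable_posTerm (hq1 : ‖q‖ < 1) (hp1 : ‖p‖ < 1) (hQ : ‖Q‖ < 1) (P : ℂ) :
    Summable fun d => posTerm q p Q d P :=
  .of_norm_bounded ((summable_geometric_of_lt_one (norm_nonneg _) hQ).mul_right _)
    fun d => norm_posTerm_le hq1 hp1 le_rfl d

lemma summable_negTerm (hq1 : ‖q‖ < 1) (hp0 : p ≠ 0) (hp1 : ‖p‖ < 1) (hp : p ^ 5 = q)
    (hQ : ‖q ^ 2 / Q‖ < 1) (w : ℂ) : Summable fun n => negTerm q p Q n w :=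
  .of_norm_bounded (((summable_nat_add_iff 1).2
    (summable_geometric_of_lt_one (norm_nonneg _) hQ)).mul_right _)
    fun n => norm_negTerm_le hq1 hp0 hp1 hp le_rfl n

/-- The bilateral series `∑_{d ∈ ℤ} Q^d ∏ (P α_l; q)_d / (P q; q)_d^4`, multiplied by
`(P q; q)_∞^4 ∏ (q / (P α_l); q)_∞`, which makes it holomorphic in `P ∈ ℂ^*`. -/
noncomputable def bilateral (q p Q P : ℂ) : ℂ :=
  (∏ l, qPochInf q (P⁻¹ * (q / alphas p l))) * ∑' d, posTerm q p Q d P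
    + qPochInf q (P * q) ^ 4 * ∑' n, negTerm q p Q n P⁻¹

lemma differentiableOn_bilateral (hq1 : ‖q‖ < 1) (hp0 : p ≠ 0) (hp1 : ‖p‖ < 1) (hp : p ^ 5 = q)
    (hQ : ‖Q‖ < 1) (hQ' : ‖q ^ 2 / Q‖ < 1) : DifferentiableOn ℂ (bilateral q p Q) {0}ᶜ := by
  have h1 := differentiable_qPochInf hq1
  have h2 := (differentiable_posSum (Q := Q) hq1 hp1 hQ).differentiableOn (s := {0}ᶜ)
  have hinv : DifferentiableOn ℂ (fun P : ℂ => P⁻¹) {0}ᶜ := differentiableOn_inv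
  have h3 : DifferentiableOn ℂ (fun P => ∑' n, negTerm q p Q n P⁻¹) {0}ᶜ :=
    (differentiable_negSum hq1 hp0 hp1 hp hQ').comp_differentiableOn hinv
  have h4 : ∀ l, DifferentiableOn ℂ (fun P => qPochInf q (P⁻¹ * (q / alphas p l))) {0}ᶜ := fun l =>
    h1.comp_differentiableOn (hinv.mul_const _)
  have h5 : DifferentiableOn ℂ (fun P => qPochInf q (P * q)) {0}ᶜ :=
    h1.comp_differentiableOn (by fun_prop)
  unfold bilateral
  fun_prop

lemma prod_alphas (hp : p ^ 5 = q) : ∏ l, alphas p l = q ^ 2 := by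
  simp only [Fin.prod_univ_four, alphas, ← hp]
  simp
  ring

/-- The effect of `P ↦ q P` on the half `d ≥ 0` of the bilateral series is a shift of the index. -/
lemma posSum_eq (hq1 : ‖q‖ < 1) (hp1 : ‖p‖ < 1) (hQ : ‖Q‖ < 1) (P : ℂ) :
    ∑' d, posTerm q p Q d P = qPochInf q (P * q) ^ 4
      + Q * (∏ l, (1 - P * alphas p l)) * ∑' d, posTerm q p Q d (q * P) := by
  rw [(summable_posTerm hq1 hp1 hQ P).tsum_eq_zero_add, ← tsum_mul_left]
  congr 1
  · simp [posTerm, qPoch]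
  · refine tsum_congr fun d => ?_
    have e : ∀ l, qPoch q (P * alphas p l) (d + 1)
        = (1 - P * alphas p l) * qPoch q (q * P * alphas p l) d := fun l => by
      rw [qPoch, Finset.prod_range_succ', mul_comm, qPoch]
      congr 1
      · simp
      · exact Finset.prod_congr rfl fun j _ => by ring
    have e2 : q * P * q ^ (d + 1) = P * q ^ (d + 1 + 1) := by ring
    simp only [posTerm, e, e2, Finset.prod_mul_distrib]
    ring

lemma negSum_eq (hq0 : q ≠ 0) (hq1 : ‖q‖ < 1) (hp0 : p ≠ 0) (hp1 : ‖p‖ < 1) (hp : p ^ 5 = q)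
    (hQ : ‖q ^ 2 / Q‖ < 1) (w : ℂ) :
    ∑' n, negTerm q p Q n (w / q) = (1 - w / q) ^ 4 * (q ^ 2 / Q)
      * ((∏ l, qPochInf q (w * (q / alphas p l))) + ∑' n, negTerm q p Q n w) := by
  have e : ∀ n, qPoch q (w / q) (n + 1) = (1 - w / q) * qPoch q w n := fun n => by
    rw [qPoch, Finset.prod_range_succ', mul_comm, qPoch]
    congr 1
    · simp
    · refine Finset.prod_congr rfl fun j _ => ?_
      rw [pow_succ]
      field_simp
  have e2 : ∀ n l, w / q * (q / alphas p l) * q ^ (n + 1) = w * (q / alphas p l) * q ^ n :=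
    fun n l => by
      rw [pow_succ]
      field_simp
  rw [(summable_negTerm hq1 hp0 hp1 hp hQ _).tsum_eq_zero_add, mul_add, ← tsum_mul_left]
  congr 1
  · simp only [negTerm, e, e2]
    simp [qPoch]
    ring
  · refine tsum_congr fun n => ?_
    simp only [negTerm, e, e2]
    ring

/-- The bilateral series is a theta function of degree four in `P`: the boundary terms of the two
shifts of the index cancel. -/
lemma bilateral_mul_q (hq0 : q ≠ 0) (hq1 : ‖q‖ < 1) (hp : p ^ 5 = q) (hQ0 : Q ≠ 0) (hQ : ‖Q‖ < 1)
    (hQ' : ‖q ^ 2 / Q‖ < 1) {P : ℂ} (hP : P ≠ 0) :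
    bilateral q p Q (q * P) = (q ^ 2 * Q)⁻¹ * (P ^ 4)⁻¹ * bilateral q p Q P := by
  have hp0 := ne_zero_of_pow_eq hq0 hp
  have hp1 := norm_lt_one_of_pow_eq hq1 hp
  have h1 := posSum_eq (p := p) hq1 hp1 hQ P
  have h2 := negSum_eq (Q := Q) hq0 hq1 hp0 hp1 hp hQ' P⁻¹
  have h3 : ∏ l, qPochInf q ((q * P)⁻¹ * (q / alphas p l))
      = (q ^ 2)⁻¹ * (P ^ 4)⁻¹ * (∏ l, (1 - P * alphas p l))
        * ∏ l, qPochInf q (P⁻¹ * (q / alphas p l)) := by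
    have e : ∀ l, qPochInf q ((q * P)⁻¹ * (q / alphas p l))
        = -(alphas p l)⁻¹ * P⁻¹ * (1 - P * alphas p l) * qPochInf q (P⁻¹ * (q / alphas p l)) := by
      intro l
      have hα := alphas_ne_zero hp0 l
      rw [qPochInf_eq_one_sub_mul hq1]
      have e1 : (q * P)⁻¹ * (q / alphas p l) * q = P⁻¹ * (q / alphas p l) := by field_simp
      rw [e1]
      congr 1
      field_simp
      ring
    simp only [e, Finset.prod_mul_distrib]
    rw [← prod_alphas hp]
    simp only [Fin.prod_univ_four, mul_inv]
    ring
  have h4 : qPochInf q (P * q) = (1 - P * q) * qPochInf q (q * P * q) := by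
    rw [qPochInf_eq_one_sub_mul hq1, mul_comm q P]
  have e5 : (q * P)⁻¹ = P⁻¹ / q := by
    rw [mul_inv]
    field_simp
  rw [bilateral, bilateral, h3, e5, h2, h1, h4]
  field_simp
  ring

lemma alphas_div_alphas_ne_q_zpow (hp0 : p ≠ 0) (hp1 : ‖p‖ < 1) (hp : p ^ 5 = q) {k l : Fin 4}
    (hkl : k ≠ l) (n : ℤ) : alphas p k / alphas p l ≠ q ^ n := fun h => by
  rw [q_zpow hp, alphas_eq_zpow, alphas_eq_zpow, ← zpow_sub₀ hp0] at h
  have := zpow_injective_of_norm_lt_one hp0 hp1 h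
  have : (k : ℕ) ≠ l := fun h => hkl (Fin.ext h)
  omega

lemma norm_q_mul_alphas_div_lt_one (hp0 : p ≠ 0) (hp1 : ‖p‖ < 1) (hp : p ^ 5 = q) (k l : Fin 4) :
    ‖alphas p k * (q / alphas p l)‖ < 1 := by
  rw [norm_mul]
  exact mul_lt_one_of_nonneg_of_lt_one_left (norm_nonneg _) (norm_alphas_lt_one hp1 k)
    (norm_q_div_alphas_lt_one hp0 hp1 hp l).le

/-- The denominators of the series `₄φ₃` at infinity. -/
lemma qPoch_mul_prod_lowerParam (hp0 : p ≠ 0) (hp : p ^ 5 = q) (k : Fin 4) (d : ℕ) :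
    qPoch q q d * ∏ j, qPoch q (lowerParam p k j) d
      = ∏ l, qPoch q (alphas p k * (q / alphas p l)) d := by
  have e : ∀ l, alphas p k * (q / alphas p l) = p ^ ((k : ℕ) + 1 + (4 - (l : ℕ))) := fun l => by
    rw [q_div_alphas hp0 hp, alphas, ← pow_add]
  simp only [e, Fin.prod_univ_four, Fin.prod_univ_three]
  rw [← hp]
  fin_cases k <;> simp [lowerParam] <;> ring

lemma wTerm_eq (hp0 : p ≠ 0) (hp : p ^ 5 = q) (k : Fin 4) (w : ℂ) (d : ℕ) :
    wTerm q p k w d = qPoch q (alphas p k) d ^ 4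
      / (∏ l, qPoch q (alphas p k * (q / alphas p l)) d) * (q ^ 2 * w) ^ d := by
  rw [wTerm, phiTerm, qPoch_mul_prod_lowerParam hp0 hp]
  simp [alphas]

/-- At `P = 1 / α_k` the terms of the bilateral series with `d > 0` vanish, and the other ones form
the series `₄φ₃` at infinity. -/
lemma bilateral_inv_alphas (hq0 : q ≠ 0) (hq1 : ‖q‖ < 1) (hp : p ^ 5 = q)
    (hQ' : ‖q ^ 2 / Q‖ < 1) (k : Fin 4) :
    bilateral q p Q (alphas p k)⁻¹ = qPochInf q (q / alphas p k) ^ 4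
      * (∏ l, qPochInf q (alphas p k * (q / alphas p l))) * ∑' d, wTerm q p k (1 / Q) d := by
  have hp0 := ne_zero_of_pow_eq hq0 hp
  have hp1 := norm_lt_one_of_pow_eq hq1 hp
  have hα := alphas_ne_zero hp0 k
  set A := ∏ l, qPochInf q (alphas p k * (q / alphas p l)) with hA
  set B := qPochInf q (q / alphas p k) ^ 4 with hB
  have hne : ∀ l d, qPoch q (alphas p k * (q / alphas p l)) d ≠ 0 := fun l d =>
    qPoch_ne_zero (mul_pow_ne_one_of_norm_lt (norm_q_mul_alphas_div_lt_one hp0 hp1 hp k l) hq1) d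
  have hpos : ∑' d, posTerm q p Q d (alphas p k)⁻¹ = B := by
    rw [tsum_eq_single 0]
    · simp [posTerm, qPoch, hB, div_eq_mul_inv, mul_comm]
    · intro d hd
      obtain ⟨d, rfl⟩ := Nat.exists_eq_succ_of_ne_zero hd
      rw [posTerm, Finset.prod_eq_zero (Finset.mem_univ k), mul_zero, mul_zero]
      rw [inv_mul_cancel₀ hα]
      exact qPoch_one_succ q d
  have hterm : ∀ n, negTerm q p Q n (alphas p k) = A * wTerm q p k (1 / Q) (n + 1) := fun n => by
    have e : A = ∏ l, (qPoch q (alphas p k * (q / alphas p l)) (n + 1)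
        * qPochInf q (alphas p k * (q / alphas p l) * q ^ (n + 1))) :=
      Finset.prod_congr rfl fun l _ => (qPoch_mul_qPochInf hq1 _ _).symm
    have h0 : ∏ l, qPoch q (alphas p k * (q / alphas p l)) (n + 1) ≠ 0 :=
      Finset.prod_ne_zero_iff.2 fun l _ => hne l _
    rw [negTerm, wTerm_eq hp0 hp, e, Finset.prod_mul_distrib, mul_one_div]
    generalize ∏ l, qPoch q (alphas p k * (q / alphas p l)) (n + 1) = D at h0
    field_simp
  have h0 : wTerm q p k (1 / Q) 0 = 1 := by
    rw [wTerm_eq hp0 hp]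
    simp [qPoch]
  have hA0 : A ≠ 0 := Finset.prod_ne_zero_iff.2 fun l _ => qPochInf_ne_zero hq1
    (mul_pow_ne_one_of_norm_lt (norm_q_mul_alphas_div_lt_one hp0 hp1 hp k l) hq1)
  have hs : Summable fun n => wTerm q p k (1 / Q) (n + 1) := by
    have := summable_negTerm hq1 hp0 hp1 hp hQ' (alphas p k)
    simp only [hterm] at this
    exact (summable_mul_left_iff hA0).1 this
  rw [((summable_nat_add_iff 1).1 hs).tsum_eq_zero_add, h0, bilateral, hpos, inv_inv, ← hA]
  simp only [hterm]
  rw [tsum_mul_left, inv_mul_eq_div, ← hB]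
  ring

/-- The theta functions of degree four that interpolate at the points `1 / α_j`. -/
noncomputable def thetaLagrange (q p Q : ℂ) (k : Fin 4) (P : ℂ) : ℂ :=
  thetaProd q (P * (alphas p k * Q)) / thetaProd q Q
    * ∏ l ∈ Finset.univ.erase k, thetaProd q (P * alphas p l) / thetaProd q (alphas p l / alphas p k)

/-- The interpolation formula for the theta function `bilateral` of degree four. -/
lemma bilateral_eq_sum (hq0 : q ≠ 0) (hq1 : ‖q‖ < 1) (hp : p ^ 5 = q) (hQ : Q ∈ regularSet p)
    (hQ1 : ‖Q‖ < 1) (hqQ : ‖q‖ < ‖Q‖) {P : ℂ} (hP : P ≠ 0) :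
    bilateral q p Q P
      = ∑ k, bilateral q p Q (alphas p k)⁻¹ * thetaLagrange q p Q k P := by
  have hp0 := ne_zero_of_pow_eq hq0 hp
  have hp1 := norm_lt_one_of_pow_eq hq1 hp
  have hα := alphas_ne_zero hp0
  have hQ0 := hQ.1
  have hTQ : thetaProd q Q ≠ 0 := thetaProd_ne_zero hq0 hq1 hQ0 (ne_q_zpow_of_mem_regularSet hp hQ)
  have hQ' : ‖q ^ 2 / Q‖ < 1 := by
    rw [norm_div, div_lt_one (norm_pos_iff.2 hQ0), norm_pow]
    nlinarith [norm_nonneg q]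
  have hTα : ∀ k l, k ≠ l → thetaProd q (alphas p k / alphas p l) ≠ 0 := fun k l hkl =>
    thetaProd_ne_zero hq0 hq1 (div_ne_zero (hα k) (hα l)) (alphas_div_alphas_ne_q_zpow hp0 hp1 hp hkl)
  have hTd : ∀ c ≠ 0, DifferentiableOn ℂ (fun P => thetaProd q (P * c)) {0}ᶜ := fun c hc =>
    (differentiableOn_thetaProd hq1).comp (by fun_prop) fun x hx => mul_ne_zero hx hc
  have hLd : ∀ k, DifferentiableOn ℂ (thetaLagrange q p Q k) {0}ᶜ := fun k => by
    unfold thetaLagrange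
    refine DifferentiableOn.mul ((hTd _ (mul_ne_zero (hα k) hQ0)).div_const _) ?_
    exact DifferentiableOn.fun_finsetProd fun l _ => (hTd _ (hα l)).div_const _
  have hLq : ∀ k, ∀ x ≠ 0, thetaLagrange q p Q k (q * x)
      = (q ^ 2 * Q)⁻¹ * (x ^ 4)⁻¹ * thetaLagrange q p Q k x := by
    intro k x hx
    have e : ∀ c ≠ 0, thetaProd q (q * x * c) = -(c⁻¹ * x⁻¹) * thetaProd q (x * c) := fun c hc => by
      rw [mul_assoc, thetaProd_mul_q hq0 hq1 (mul_ne_zero hx hc)]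
      field_simp
    have e3 : ∏ l ∈ Finset.univ.erase k, thetaProd q (q * x * alphas p l)
          / thetaProd q (alphas p l / alphas p k)
        = -(∏ l ∈ Finset.univ.erase k, (alphas p l)⁻¹) * (x ^ 3)⁻¹
          * ∏ l ∈ Finset.univ.erase k, thetaProd q (x * alphas p l)
          / thetaProd q (alphas p l / alphas p k) := by
      have : ∏ l ∈ Finset.univ.erase k, (-x⁻¹ : ℂ) = -(x ^ 3)⁻¹ := by
        rw [Finset.prod_const, Finset.card_erase_of_mem (Finset.mem_univ _)]
        simp
        ring
      have e4 : ∀ l, thetaProd q (q * x * alphas p l) / thetaProd q (alphas p l / alphas p k)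
          = (alphas p l)⁻¹ * -x⁻¹ * (thetaProd q (x * alphas p l)
            / thetaProd q (alphas p l / alphas p k)) := fun l => by
        rw [e _ (hα l)]
        ring
      simp only [e4]
      rw [Finset.prod_mul_distrib, Finset.prod_mul_distrib, this]
      ring
    have e5 : (q ^ 2)⁻¹ = (alphas p k)⁻¹ * ∏ l ∈ Finset.univ.erase k, (alphas p l)⁻¹ := by
      rw [← prod_alphas hp, ← Finset.prod_inv_distrib,
        ← Finset.mul_prod_erase _ _ (Finset.mem_univ k)]
    rw [thetaLagrange, thetaLagrange, e3, e _ (mul_ne_zero (hα k) hQ0), mul_inv (q ^ 2), e5]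
    simp only [mul_inv]
    ring
  have hLδ : ∀ k j, thetaLagrange q p Q k (alphas p j)⁻¹ = if k = j then 1 else 0 := by
    intro k j
    have hinv : ∀ l, (alphas p j)⁻¹ * alphas p l = alphas p l / alphas p j := fun l => by
      rw [div_eq_mul_inv, mul_comm]
    split_ifs with h
    · subst h
      rw [thetaLagrange, inv_mul_cancel_left₀ (hα k), div_self hTQ, one_mul]
      refine Finset.prod_eq_one fun l hl => ?_
      rw [hinv, div_self (hTα l k (Finset.ne_of_mem_erase hl))]
    · rw [thetaLagrange, Finset.prod_eq_zero (Finset.mem_erase.2 ⟨Ne.symm h, Finset.mem_univ j⟩),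
        mul_zero]
      rw [inv_mul_cancel₀ (hα j), thetaProd_one hq1, zero_div]
  -- the difference of the two sides vanishes at the four points `1 / α_j`, hence is divisible by
  -- four theta functions; the quotient `g` satisfies `g (q P) = Q⁻¹ g P`, so it is a constant, which
  -- is zero as `Q ≠ 1`
  set f : ℂ → ℂ := fun P => bilateral q p Q P
    - ∑ k, bilateral q p Q (alphas p k)⁻¹ * thetaLagrange q p Q k P with hf
  have hfd : DifferentiableOn ℂ f {0}ᶜ :=
    (differentiableOn_bilateral hq1 hp0 hp1 hp hQ1 hQ').sub
      (DifferentiableOn.fun_sum fun k _ => (hLd k).const_mul _)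
  have hc : (q ^ 2 * Q)⁻¹ ≠ 0 := inv_ne_zero (mul_ne_zero (pow_ne_zero _ hq0) hQ0)
  obtain ⟨g, hg, hfg, hgq⟩ := exists_eq_prod_thetaProd_mul hq0 hq1 hα Finset.univ
    (fun i _ j _ hij => alphas_div_alphas_ne_q_zpow hp0 hp1 hp hij) hfd hc (fun x hx => by
      simp only [hf, hLq _ x hx, bilateral_mul_q hq0 hq1 hp hQ0 hQ1 hQ' hx]
      rw [mul_sub, Finset.mul_sum]
      simp only [Finset.card_univ, Fintype.card_fin]
      congr 1
      exact Finset.sum_congr rfl fun k _ => by ring) fun j _ => by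
      simp [hf, hLδ]
  have hmult : (q ^ 2 * Q)⁻¹ * ∏ i, -alphas p i = Q⁻¹ := by
    have : ∏ i, -alphas p i = q ^ 2 := by
      rw [← prod_alphas hp]
      simp only [Fin.prod_univ_four]
      ring
    rw [this]
    field_simp
  rw [hmult] at hgq
  have hQ0' := norm_pos_iff.2 hQ0
  obtain ⟨c, hc⟩ := exists_eq_const_of_scaling hq0 hq1 hg
    (by rw [norm_inv]; exact (one_le_inv₀ hQ0').2 hQ1.le)
    (by rw [inv_mul_eq_div, norm_div, div_lt_one hQ0']; exact hqQ) hgq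
  have hc0 : c = 0 := by
    have h1 := hgq 1 one_ne_zero
    rw [hc _ (by simpa using hq0), hc 1 one_ne_zero] at h1
    by_contra h
    have h2 : Q = 1 := by
      field_simp at h1
      exact h1
    rw [h2, norm_one] at hQ1
    exact lt_irrefl _ hQ1
  have := hfg P hP
  rw [hc P hP, hc0, mul_zero] at this
  exact sub_eq_zero.1 this

end Connection

/-! ### Meromorphic continuation -/

section Continuation

variable {q p : ℂ}

/-- The tail of a Lambert series is holomorphic. -/
lemma differentiableOn_lambert_tail {a : ℕ → ℂ} (ha : Summable fun m => ‖a m‖) (hq1 : ‖q‖ < 1) {r : ℝ}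
    {N : ℕ} (hN : ‖q‖ ^ N * r ≤ 1 / 2) :
    (∀ Q ∈ Metric.ball (0 : ℂ) r, Summable fun m => a (m + N) / (1 - q ^ (m + N) * Q)) ∧
    DifferentiableOn ℂ (fun Q => ∑' m, a (m + N) / (1 - q ^ (m + N) * Q)) (Metric.ball 0 r) := by
  have hb : ∀ m, ∀ Q ∈ Metric.ball (0 : ℂ) r, ‖q ^ (m + N) * Q‖ ≤ 1 / 2 := fun m Q hQ => by
    have hQ : ‖Q‖ ≤ r := (mem_ball_zero_iff.1 hQ).le
    rw [norm_mul, norm_pow, pow_add]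
    calc ‖q‖ ^ m * ‖q‖ ^ N * ‖Q‖ ≤ 1 * ‖q‖ ^ N * r := by
          gcongr
          exact pow_le_one₀ (norm_nonneg _) hq1.le
      _ ≤ 1 / 2 := by rwa [one_mul]
  have hd : ∀ m, ∀ Q ∈ Metric.ball (0 : ℂ) r, 1 / 2 ≤ ‖1 - q ^ (m + N) * Q‖ := fun m Q hQ => by
    have h1 := hb m Q hQ
    have h2 := norm_sub_norm_le (1 : ℂ) (q ^ (m + N) * Q)
    rw [norm_one] at h2
    linarith
  have hne : ∀ m, ∀ Q ∈ Metric.ball (0 : ℂ) r, 1 - q ^ (m + N) * Q ≠ 0 := fun m Q hQ h => by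
    have := hd m Q hQ
    rw [h, norm_zero] at this
    norm_num at this
  have hs : Summable fun m => 2 * ‖a (m + N)‖ := ((summable_nat_add_iff N).2 ha).mul_left 2
  have hle : ∀ m, ∀ Q ∈ Metric.ball (0 : ℂ) r,
      ‖a (m + N) / (1 - q ^ (m + N) * Q)‖ ≤ 2 * ‖a (m + N)‖ := fun m Q hQ => by
    rw [norm_div, div_le_iff₀ (norm_pos_iff.2 (hne m Q hQ))]
    have := mul_le_mul_of_nonneg_left (hd m Q hQ) (norm_nonneg (a (m + N)))
    linarith
  refine ⟨fun Q hQ => .of_norm_bounded hs fun m => hle m Q hQ, ?_⟩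
  refine Complex.differentiableOn_tsum_of_summable_norm hs (fun m => ?_) Metric.isOpen_ball
    fun m Q hQ => hle m Q hQ
  exact (differentiableOn_const _).div (by fun_prop) fun Q hQ => hne m Q hQ

/-- If `H(z) = ∑ a_m z^m` is holomorphic on a disc of radius larger than one, then the power series
`∑_d H(q^d) Q^d` continues to the meromorphic function `∑_m a_m / (1 - q^m Q)`. -/
lemma exists_lambert_continuation (hq0 : q ≠ 0) (hq1 : ‖q‖ < 1) {H : ℂ → ℂ} {R : ℝ} (hR : 1 < R)
    (hH : DifferentiableOn ℂ H (Metric.ball 0 R)) :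
    ∃ Φ : ℂ → ℂ, (∀ Q, (∀ m : ℕ, q ^ m * Q ≠ 1) → AnalyticAt ℂ Φ Q) ∧ (∀ Q, MeromorphicAt Φ Q) ∧
      ∀ Q, ‖Q‖ < 1 → HasSum (fun d : ℕ => H (q ^ d) * Q ^ d) (Φ Q) := by
  set a : ℕ → ℂ := fun m => (m.factorial : ℂ)⁻¹ * iteratedDeriv m H 0 with ha
  have hsum : ∀ z ∈ Metric.ball (0 : ℂ) R, HasSum (fun m => a m * z ^ m) (H z) := fun z hz => by
    have := Complex.hasSum_taylorSeries_on_ball hH hz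
    simp only [sub_zero, smul_eq_mul] at this
    refine this.congr_fun fun m => ?_
    simp only [ha]
    ring
  have has : Summable fun m => ‖a m‖ := by
    have := (hsum 1 (by simpa using hR)).summable.norm
    simpa using this
  have hsplit : ∀ Q₀ : ℂ, ∃ N : ℕ, ∃ T : ℂ → ℂ, AnalyticAt ℂ T Q₀ ∧
      ∀ᶠ Q in 𝓝 Q₀, ∑' m, a m / (1 - q ^ m * Q)
        = ∑ m ∈ Finset.range N, a m / (1 - q ^ m * Q) + T Q := by
    intro Q₀
    set r := ‖Q₀‖ + 1 with hr
    have hr0 : 0 < r := by positivity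
    obtain ⟨N, hN⟩ := exists_pow_lt_of_lt_one (show 0 < 1 / 2 / r by positivity) hq1
    rw [lt_div_iff₀ hr0] at hN
    obtain ⟨h1, h2⟩ := differentiableOn_lambert_tail has hq1 hN.le
    have hmem : Metric.ball (0 : ℂ) r ∈ 𝓝 Q₀ := Metric.isOpen_ball.mem_nhds (by simp [hr])
    refine ⟨N, _, h2.analyticAt hmem, ?_⟩
    filter_upwards [hmem] with Q hQ
    exact (((summable_nat_add_iff (f := fun m => a m / (1 - q ^ m * Q)) N).1
      (h1 Q hQ)).sum_add_tsum_nat_add N).symm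
  refine ⟨fun Q => ∑' m, a m / (1 - q ^ m * Q), fun Q hQ => ?_, fun Q => ?_, fun Q hQ => ?_⟩
  · obtain ⟨N, T, hT, hev⟩ := hsplit Q
    refine AnalyticAt.congr ?_ (EventuallyEq.symm hev)
    refine AnalyticAt.add (Finset.analyticAt_fun_sum _ fun m _ => ?_) hT
    exact analyticAt_const.div (by fun_prop) (sub_ne_zero.2 (hQ m).symm)
  · obtain ⟨N, T, hT, hev⟩ := hsplit Q
    refine MeromorphicAt.congr ?_ ((EventuallyEq.symm hev).filter_mono nhdsWithin_le_nhds)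
    refine MeromorphicAt.add (MeromorphicAt.fun_sum fun m _ => ?_) hT.meromorphicAt
    have hden : AnalyticAt ℂ (fun Q : ℂ => 1 - q ^ m * Q) Q := by fun_prop
    exact (MeromorphicAt.const _ _).div hden.meromorphicAt
  · have hgeo : Summable fun d : ℕ => ‖Q ^ d‖ := by
      simp only [norm_pow]
      exact summable_geometric_of_lt_one (norm_nonneg _) hQ
    -- both sides are iterated sums of the double series of the `a_m q^{dm} Q^d`
    have hdouble : Summable fun x : ℕ × ℕ => a x.1 * (q ^ x.2) ^ x.1 * Q ^ x.2 := by
      refine (Summable.mul_norm has hgeo).of_norm_bounded fun x => ?_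
      rw [norm_mul, norm_mul, norm_mul (a x.1)]
      gcongr
      rw [norm_pow, norm_pow]
      exact mul_le_of_le_one_right (norm_nonneg _)
        (pow_le_one₀ (by positivity) (pow_le_one₀ (norm_nonneg _) hq1.le))
    have h1 : ∀ m, HasSum (fun d => a m * (q ^ d) ^ m * Q ^ d) (a m / (1 - q ^ m * Q)) := fun m => by
      have hlt : ‖q ^ m * Q‖ < 1 := by
        rw [norm_mul, norm_pow]
        exact (mul_le_of_le_one_left (norm_nonneg _)
          (pow_le_one₀ (norm_nonneg _) hq1.le)).trans_lt hQ
      have := (hasSum_geometric_of_norm_lt_one hlt).mul_left (a m)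
      rw [← div_eq_mul_inv] at this
      refine this.congr_fun fun d => ?_
      ring
    have hT := hdouble.hasSum.prod_fiberwise h1
    have h2 : ∀ d, HasSum (fun m => a m * (q ^ d) ^ m * Q ^ d) (H (q ^ d) * Q ^ d) := fun d => by
      refine (hsum (q ^ d) ?_).mul_right _
      rw [mem_ball_zero_iff, norm_pow]
      exact (pow_le_one₀ (norm_nonneg _) hq1.le).trans_lt hR
    have hswap : HasSum (fun x : ℕ × ℕ => a x.2 * (q ^ x.1) ^ x.2 * Q ^ x.1)
        (∑' x : ℕ × ℕ, a x.1 * (q ^ x.2) ^ x.1 * Q ^ x.2) :=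
      (Equiv.prodComm ℕ ℕ).hasSum_iff.2 hdouble.hasSum
    have hT' := hswap.prod_fiberwise h2
    change HasSum _ (∑' m, a m / (1 - q ^ m * Q))
    rw [hT.tsum_eq]
    exact hT'

/-! ### Continuation of the series at `Q = 0` -/

lemma expands_qPoch (x : ℂ) (d : ℕ) :
    Expands (fun P => qPoch q (P * x) d) (qPoch (C q) (classP * C x) d) := by
  unfold qPoch
  refine Expands.prod _ fun j _ => ?_
  have := (expands_const 1).sub ((expands_id.mul (expands_const x)).mul (expands_const (q ^ j)))
  simpa only [map_pow, map_one] using this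

lemma expands_serCoeff (hq1 : ‖q‖ < 1) (d : ℕ) :
    Expands (fun P => (∏ i, qPoch q (P * alphas p i) d) / qPoch q (P * q) d ^ 4)
      (serCoeff q p d) := by
  have h1 := Expands.prod Finset.univ fun i (_ : i ∈ Finset.univ) =>
    expands_qPoch (q := q) (alphas p i) d
  have h2 := (expands_qPoch (q := q) q d).pow 4
  refine h1.div h2 ?_
  rw [← h2.apply_one, one_mul]
  exact pow_ne_zero _ (qPoch_ne_zero (mul_pow_ne_one_of_norm_lt hq1 hq1) d)

/-- The function `(z q; q)_∞^4 / ∏ (z α_l; q)_∞`, whose values at `P q^d` are proportional to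
`∏ (P α_l; q)_d / (P q; q)_d^4`. -/
noncomputable def symbolZero (q p z : ℂ) : ℂ :=
  qPochInf q (z * q) ^ 4 / ∏ l, qPochInf q (z * alphas p l)

lemma qPochInf_mul_ne_zero (hq1 : ‖q‖ < 1) (hp0 : p ≠ 0) {z a : ℂ} (hz : ‖z‖ < ‖p‖⁻¹)
    (ha : ‖a‖ ≤ ‖p‖) : qPochInf q (z * a) ≠ 0 := by
  refine qPochInf_ne_zero hq1 (mul_pow_ne_one_of_norm_lt ?_ hq1)
  have hp := norm_pos_iff.2 hp0
  rw [norm_mul]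
  calc ‖z‖ * ‖a‖ ≤ ‖z‖ * ‖p‖ := by gcongr
    _ < ‖p‖⁻¹ * ‖p‖ := by gcongr
    _ = 1 := inv_mul_cancel₀ hp.ne'

lemma norm_pow_succ_le (hp1 : ‖p‖ < 1) (n : ℕ) : ‖p ^ (n + 1)‖ ≤ ‖p‖ := by
  rw [norm_pow]
  exact pow_le_of_le_one (norm_nonneg _) hp1.le (Nat.succ_ne_zero n)

lemma analyticAt_symbolZero (hq1 : ‖q‖ < 1) (hp0 : p ≠ 0) (hp1 : ‖p‖ < 1) {z : ℂ}
    (hz : ‖z‖ < ‖p‖⁻¹) : AnalyticAt ℂ (symbolZero q p) z := by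
  have h : ∀ a, AnalyticAt ℂ (fun z => qPochInf q (z * a)) z := fun a =>
    (((differentiable_qPochInf hq1).comp (by fun_prop) :
      Differentiable ℂ fun z => qPochInf q (z * a))).analyticAt z
  refine ((h q).pow 4).div (Finset.analyticAt_fun_prod _ fun l _ => h _) ?_
  exact Finset.prod_ne_zero_iff.2 fun l _ => qPochInf_mul_ne_zero hq1 hp0 hz (norm_pow_succ_le hp1 _)

lemma ratioF_mul_symbolZero (hq1 : ‖q‖ < 1) (hp : p ^ 5 = q) (hp0 : p ≠ 0) {P : ℂ}
    (hP : ‖P‖ < ‖p‖⁻¹) (d : ℕ) : ratioF q p P * symbolZero q p (P * q ^ d)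
      = (∏ i, qPoch q (P * alphas p i) d) / qPoch q (P * q) d ^ 4 := by
  have hp1 := norm_lt_one_of_pow_eq hq1 hp
  have hqp : ‖q‖ ≤ ‖p‖ := hp ▸ norm_pow_succ_le hp1 4
  have hPd : ‖P * q ^ d‖ < ‖p‖⁻¹ := (norm_mul_pow_le le_rfl hq1 d).trans_lt hP
  have e1 : ∀ a, qPochInf q (P * a) = qPoch q (P * a) d * qPochInf q (P * q ^ d * a) := fun a => by
    rw [← qPoch_mul_qPochInf hq1 (P * a) d, mul_right_comm P]
  have h1 : qPochInf q (P * q ^ d * q) ≠ 0 := qPochInf_mul_ne_zero hq1 hp0 hPd hqp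
  have h2 : qPoch q (P * q) d ≠ 0 := fun h =>
    qPochInf_mul_ne_zero hq1 hp0 hP hqp (by rw [e1, h, zero_mul])
  have h3 : ∏ l, qPochInf q (P * q ^ d * alphas p l) ≠ 0 :=
    Finset.prod_ne_zero_iff.2 fun l _ => qPochInf_mul_ne_zero hq1 hp0 hPd (norm_pow_succ_le hp1 _)
  rw [ratioF, symbolZero, e1 q]
  simp only [e1 (alphas p _), Finset.prod_mul_distrib]
  generalize ∏ l, qPochInf q (P * q ^ d * alphas p l) = A at h3
  generalize ∏ l, qPoch q (P * alphas p l) d = B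
  generalize qPochInf q (P * q ^ d * q) = D at h1
  field_simp

/-- The continuation of the series defining `X_b`: as `ratioF(P) symbolZero(P q^d)` is the quotient of
finite Pochhammer symbols, the coefficients of the latter are the values at `z = q^d` of a fixed
holomorphic function of `z`. -/
lemma exists_continuation_zero (hq0 : q ≠ 0) (hq1 : ‖q‖ < 1) (hp : p ^ 5 = q) (b : Fin 4) :
    ∃ Φ : ℂ → ℂ, (∀ Q, (∀ m : ℕ, q ^ m * Q ≠ 1) → AnalyticAt ℂ Φ Q) ∧ (∀ Q, MeromorphicAt Φ Q) ∧
      ∀ Q, ‖Q‖ < 1 → HasSum (fun d : ℕ => coeff (b : ℕ) (serCoeff q p d) * Q ^ d) (Φ Q) := by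
  have hp0 := ne_zero_of_pow_eq hq0 hp
  have hp1 := norm_lt_one_of_pow_eq hq1 hp
  have hp0' := norm_pos_iff.2 hp0
  have hR : 1 < ‖p‖⁻¹ := (one_lt_inv₀ hp0').2 hp1
  set φ : ℂ⟦X⟧ := C (ratioF q p 1) * jet (bbF q p)
  set H : ℂ → ℂ := fun z => coeff (b : ℕ) (φ * dilationJet (symbolZero q p) z) with hH
  have hHd : DifferentiableOn ℂ H (Metric.ball 0 ‖p‖⁻¹) := fun z hz => by
    have hz := analyticAt_symbolZero hq1 hp0 hp1 (mem_ball_zero_iff.1 hz)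
    simp only [hH, coeff_mul]
    refine (Finset.analyticAt_fun_sum _ fun ij _ => ?_).differentiableAt.differentiableWithinAt
    exact analyticAt_const.mul (analyticAt_coeff_dilationJet hz _)
  obtain ⟨Φ, h1, h2, h3⟩ := exists_lambert_continuation hq0 hq1 hR hHd
  refine ⟨Φ, h1, h2, fun Q hQ => (h3 Q hQ).congr_fun fun d => ?_⟩
  have hd : ‖q ^ d‖ < ‖p‖⁻¹ := by
    rw [norm_pow]
    exact (pow_le_one₀ (norm_nonneg _) hq1.le).trans_lt hR
  have e := (expands_ratioF hq1 hp).mul (expands_dilation (analyticAt_symbolZero hq1 hp0 hp1 hd))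
  have hev : ∀ᶠ P : ℂ in 𝓝 1, ‖P‖ < ‖p‖⁻¹ :=
    continuous_norm.continuousAt.eventually_lt_const (by simpa using hR)
  have e' := e.congr (hev.mono fun P hP => ratioF_mul_symbolZero hq1 hp hp0 hP d)
  rw [(expands_serCoeff hq1 d).unique e' b]

/-! ### Continuation of the series at `Q = ∞` -/

/-- The continuation of the series `₄φ₃` at infinity, as functions of `u = q² w`. -/
lemma exists_continuation_infty (hq0 : q ≠ 0) (hq1 : ‖q‖ < 1) (hp : p ^ 5 = q) (k : Fin 4) :
    ∃ Φ : ℂ → ℂ, (∀ u, (∀ m : ℕ, q ^ m * u ≠ 1) → AnalyticAt ℂ Φ u) ∧ (∀ u, MeromorphicAt Φ u) ∧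
      ∀ w, ‖q ^ 2 * w‖ < 1 → HasSum (fun d : ℕ => wTerm q p k w d) (Φ (q ^ 2 * w)) := by
  have hp0 := ne_zero_of_pow_eq hq0 hp
  have hp1 := norm_lt_one_of_pow_eq hq1 hp
  have hp0' := norm_pos_iff.2 hp0
  have hR : 1 < ‖p‖⁻¹ := (one_lt_inv₀ hp0').2 hp1
  set β : Fin 4 → ℂ := fun l => alphas p k * (q / alphas p l) with hβ
  have hβ1 : ∀ l, ‖β l‖ < 1 := fun l => norm_q_mul_alphas_div_lt_one hp0 hp1 hp k l
  set H : ℂ → ℂ := fun z => qPochInf q (alphas p k) ^ 4 / (∏ l, qPochInf q (β l))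
    * ((∏ l, qPochInf q (z * β l)) / qPochInf q (z * alphas p k) ^ 4) with hH
  have hα : ∀ z : ℂ, ‖z‖ < ‖p‖⁻¹ → qPochInf q (z * alphas p k) ≠ 0 := fun z hz =>
    qPochInf_mul_ne_zero hq1 hp0 hz (norm_pow_succ_le hp1 _)
  have hHd : DifferentiableOn ℂ H (Metric.ball 0 ‖p‖⁻¹) := by
    have h : ∀ a, DifferentiableOn ℂ (fun z => qPochInf q (z * a)) (Metric.ball 0 ‖p‖⁻¹) := fun a =>
      (((differentiable_qPochInf hq1).comp (by fun_prop) :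
        Differentiable ℂ fun z => qPochInf q (z * a))).differentiableOn
    refine DifferentiableOn.const_mul (DifferentiableOn.div ?_ ((h _).fun_pow 4) fun z hz =>
      pow_ne_zero _ (hα z (mem_ball_zero_iff.1 hz))) _
    exact DifferentiableOn.fun_finsetProd fun l _ => h _
  obtain ⟨Φ, h1, h2, h3⟩ := exists_lambert_continuation hq0 hq1 hR hHd
  refine ⟨Φ, h1, h2, fun w hw => (h3 _ hw).congr_fun fun d => ?_⟩
  have e : ∀ a, qPochInf q a = qPoch q a d * qPochInf q (q ^ d * a) := fun a => by
    rw [← qPoch_mul_qPochInf hq1 a d, mul_comm a]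
  have hd : ‖q ^ d‖ < ‖p‖⁻¹ := by
    rw [norm_pow]
    exact (pow_le_one₀ (norm_nonneg _) hq1.le).trans_lt hR
  have n1 := hα _ hd
  have n2 : ∏ l, qPochInf q (q ^ d * β l) ≠ 0 := Finset.prod_ne_zero_iff.2 fun l _ => fun h =>
    qPochInf_ne_zero hq1 (mul_pow_ne_one_of_norm_lt (hβ1 l) hq1) (by rw [e, h, mul_zero])
  rw [wTerm_eq hp0 hp]
  simp only [hH]
  rw [e (alphas p k)]
  simp only [e (β _), Finset.prod_mul_distrib]
  generalize ∏ l, qPochInf q (q ^ d * β l) = A at n2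
  change _ / (∏ l, qPoch q (β l) d) * _ = _
  generalize ∏ l, qPoch q (β l) d = B
  field_simp

end Continuation

/-! ### The `q`-difference equation -/

section Equation

variable {q p : ℂ}

/-- If `σ_q` multiplies the `d`-th term of a series by `lam d`, then `1 - a σ_q` multiplies it by
`1 - a lam d`. The terms are images under a linear functional `L` of elements of an algebra, in order
to cover the coefficients of power series in `1 - P`. -/
lemma hasSum_oneSub {A : Type*} [CommRing A] [Algebra ℂ A] (L : A →ₗ[ℂ] ℂ) {v lam : ℕ → A}
    {F : ℂ → ℂ} {Q : ℂ} {N : ℕ} (a : ℂ)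
    (h : ∀ n ≤ N + 1, HasSum (fun d => L (v d * lam d ^ n)) (F (q ^ n * Q))) :
    ∀ n ≤ N, HasSum (fun d => L (v d * (1 - algebraMap ℂ A a * lam d) * lam d ^ n))
      (oneSub q a F (q ^ n * Q)) := by
  intro n hn
  have h1 := h n (by omega)
  have h2 := (h (n + 1) (by omega)).mul_left a
  have e : q ^ (n + 1) * Q = q * (q ^ n * Q) := by ring
  rw [e] at h2
  refine (h1.sub h2).congr_fun fun d => ?_
  rw [← smul_eq_mul (a := a), ← map_smul, ← map_sub, Algebra.smul_def]
  congr 1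
  ring

/-- A function given by a series of formal eigenvectors: if `σ_q` multiplies the `d`-th term by
`lam d`, then `quinticOp` multiplies it by `(1 - lam d)^4 - Q ∏ (1 - p^j lam d)`. -/
lemma hasSum_quinticOp {A : Type*} [CommRing A] [Algebra ℂ A] (L : A →ₗ[ℂ] ℂ) {v lam : ℕ → A}
    {F : ℂ → ℂ} {Q : ℂ} (h : ∀ n ≤ 4, HasSum (fun d => L (v d * lam d ^ n)) (F (q ^ n * Q))) :
    ∃ s t, HasSum (fun d => L (v d * (1 - lam d) ^ 4)) s ∧
      HasSum (fun d => L (v d * ∏ l, (1 - algebraMap ℂ A (alphas p l) * lam d))) t ∧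
      quinticOp q p F Q = s - Q * t := by
  have a1 := hasSum_oneSub L 1 h
  have a2 := hasSum_oneSub L 1 a1
  have a3 := hasSum_oneSub L 1 a2
  have a4 := hasSum_oneSub L 1 a3 0 le_rfl
  have b1 := hasSum_oneSub L (p ^ 4) h
  have b2 := hasSum_oneSub L (p ^ 3) b1
  have b3 := hasSum_oneSub L (p ^ 2) b2
  have b4 := hasSum_oneSub L p b3 0 le_rfl
  refine ⟨_, _, a4.congr_fun fun d => ?_, b4.congr_fun fun d => ?_, ?_⟩
  · rw [map_one]
    ring_nf
  · simp only [Fin.prod_univ_four, alphas]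
    simp only [Fin.val_zero, Fin.val_one, Fin.val_two, show ((3 : Fin 4) : ℕ) = 3 from rfl]
    ring_nf
  · simp [quinticOp]

/-- The telescoping argument for a series in `Q`. -/
lemma sub_eq_zero_of_telescope_left {x y : ℕ → ℂ} {s t Q : ℂ} (hs : HasSum x s) (ht : HasSum y t)
    (h0 : x 0 = 0) (h : ∀ d, x (d + 1) = Q * y d) : s - Q * t = 0 := by
  have h1 := hs.summable.tsum_eq_zero_add
  rw [hs.tsum_eq, h0, zero_add] at h1
  simp only [h] at h1
  rw [tsum_mul_left, ht.tsum_eq] at h1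
  rw [h1, sub_self]

/-- The telescoping argument for a series in `1 / Q`. -/
lemma sub_eq_zero_of_telescope_right {x y : ℕ → ℂ} {s t Q : ℂ} (hs : HasSum x s) (ht : HasSum y t)
    (h0 : y 0 = 0) (h : ∀ d, x d = Q * y (d + 1)) : s - Q * t = 0 := by
  have h1 := ht.summable.tsum_eq_zero_add
  rw [ht.tsum_eq, h0, zero_add] at h1
  have h2 := hs.tsum_eq
  simp only [h] at h2
  rw [tsum_mul_left, ← h1] at h2
  rw [h2, sub_self]

/-! ### The logarithm `ℓ_q` and the powers `P^ℓ` -/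

lemma theta_ne_zero (hq0 : q ≠ 0) (hq1 : ‖q‖ < 1) {Q : ℂ} (hQ0 : Q ≠ 0) (hQ : ∀ n : ℤ, Q ≠ -q ^ n) :
    theta q Q ≠ 0 := by
  obtain ⟨c, hc, h⟩ := exists_theta_neg_eq hq0 hq1
  have := h (-Q) (neg_ne_zero.2 hQ0)
  rw [neg_neg] at this
  rw [this]
  exact mul_ne_zero hc (thetaProd_ne_zero hq0 hq1 (neg_ne_zero.2 hQ0) fun n hn =>
    hQ n (by rw [← hn, neg_neg]))

lemma analyticAt_theta (hq0 : q ≠ 0) (hq1 : ‖q‖ < 1) {Q : ℂ} (hQ : Q ≠ 0) :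
    AnalyticAt ℂ (theta q) Q :=
  DifferentiableOn.analyticAt (s := {0}ᶜ)
    (fun _ hx => (differentiableAt_theta hq0 hq1 hx).differentiableWithinAt)
    (isOpen_compl_singleton.mem_nhds hQ)

lemma analyticAt_qLog (hq0 : q ≠ 0) (hq1 : ‖q‖ < 1) {Q : ℂ} (hQ0 : Q ≠ 0)
    (hQ : ∀ n : ℤ, Q ≠ -q ^ n) : AnalyticAt ℂ (qLog q) Q := by
  have h := analyticAt_theta hq0 hq1 hQ0
  exact (analyticAt_id.neg.mul h.deriv).div h (theta_ne_zero hq0 hq1 hQ0 hQ)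

lemma qLog_mul_q (hq0 : q ≠ 0) (hq1 : ‖q‖ < 1) {Q : ℂ} (hQ0 : Q ≠ 0) (hQ : ∀ n : ℤ, Q ≠ -q ^ n) :
    qLog q (q * Q) = qLog q Q + 1 := by
  have hθ := theta_ne_zero hq0 hq1 hQ0 hQ
  have hd := (differentiableAt_theta hq0 hq1 hQ0).hasDerivAt
  have hd' := (differentiableAt_theta hq0 hq1 (mul_ne_zero hq0 hQ0)).hasDerivAt
  have e1 : HasDerivAt (fun x => theta q (q * x)) (deriv (theta q) (q * Q) * q) Q := by
    simpa [Function.comp_def] using hd'.comp Q ((hasDerivAt_id Q).const_mul q)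
  have e2 : HasDerivAt (fun x => theta q (q * x))
      ((deriv (theta q) Q * Q - theta q Q * 1) / Q ^ 2) Q := by
    refine (hd.div (hasDerivAt_id Q) hQ0).congr_of_eventuallyEq ?_
    filter_upwards [isOpen_ne.mem_nhds hQ0] with y hy
    simp [theta_mul_q hq0 hy]
  have e := e1.unique e2
  have e3 : deriv (theta q) (q * Q) = (deriv (theta q) Q * Q - theta q Q * 1) / Q ^ 2 / q := by
    rw [← e, mul_div_cancel_right₀ _ hq0]
  rw [qLog, qLog, e3, theta_mul_q hq0 hQ0]
  field_simp
  ring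

lemma binom_zero (l : ℂ) : binom l 0 = 1 := by
  simp [binom]

lemma binom_add_one (l : ℂ) (k : ℕ) : binom (l + 1) (k + 1) = binom l (k + 1) + binom l k := by
  have h1 : ∏ r ∈ Finset.range (k + 1), (l + 1 - (r : ℂ)) = (l + 1) * ∏ r ∈ Finset.range k, (l - (r : ℂ)) := by
    rw [Finset.prod_range_succ', mul_comm]
    congr 1
    · simp
    · refine Finset.prod_congr rfl fun r _ => ?_
      push_cast
      ring
  have hk : (k.factorial : ℂ) ≠ 0 := by exact_mod_cast k.factorial_ne_zero
  have hk' : (k : ℂ) + 1 ≠ 0 := by exact_mod_cast k.succ_ne_zero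
  rw [binom, binom, binom, h1, Finset.prod_range_succ, Nat.factorial_succ]
  push_cast
  field_simp
  ring

/-- The rule `P^{l+1} = P^l P`. -/
lemma powP_add_one (l : ℂ) : powP (l + 1) = powP l * classP := by
  ext k
  rw [classP, mul_sub, mul_one, map_sub]
  cases k with
  | zero => simp [powP, binom_zero]
  | succ k =>
    rw [coeff_succ_mul_X, powP, coeff_mk, powP, coeff_mk, coeff_mk, binom_add_one]
    ring

lemma twist_eq_coeff (l : ℂ) (v : Fin 4 → ℂ) (m : Fin 4) :
    twist l v m = coeff (m : ℕ) (powP l * jet v) := by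
  have h0 : coeff 0 (jet v) = v 0 := coeff_jet v 0
  have h1 : coeff 1 (jet v) = v 1 := coeff_jet v 1
  have h2 : coeff 2 (jet v) = v 2 := coeff_jet v 2
  have h3 : coeff 3 (jet v) = v 3 := coeff_jet v 3
  fin_cases m
  · simp only [Fin.zero_eta, coeff_mul_zero, h0]
    simp [twist, Fin.sum_univ_four, powP]
  · simp only [Fin.mk_one, coeff_mul_one, h0, h1]
    simp [twist, Fin.sum_univ_four, powP]
  · simp only [Fin.reduceFinMk, coeff_mul_two, h0, h1, h2]
    simp [twist, Fin.sum_univ_four, powP]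
  · simp only [Fin.reduceFinMk, coeff_mul_three, h0, h1, h2, h3]
    simp [twist, Fin.sum_univ_four, powP]

lemma coeff_mul_congr {U φ ψ : ℂ⟦X⟧} (h : ∀ j : Fin 4, coeff (j : ℕ) φ = coeff (j : ℕ) ψ)
    (m : Fin 4) : coeff (m : ℕ) (U * φ) = coeff (m : ℕ) (U * ψ) := by
  rw [coeff_mul, coeff_mul]
  refine Finset.sum_congr rfl fun ij hij => ?_
  have := Finset.HasAntidiagonal.mem_antidiagonal.1 hij
  have hlt : ij.2 < 4 := by omega
  rw [h ⟨ij.2, hlt⟩]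

lemma hasSum_coeff_mul (U : ℂ⟦X⟧) {s : ℕ → ℂ⟦X⟧} {v : Fin 4 → ℂ}
    (h : ∀ b : Fin 4, HasSum (fun d => coeff (b : ℕ) (s d)) (v b)) (m : Fin 4) :
    HasSum (fun d => coeff (m : ℕ) (U * s d)) (coeff (m : ℕ) (U * jet v)) := by
  simp only [coeff_mul]
  refine hasSum_sum fun ij hij => ?_
  have := Finset.HasAntidiagonal.mem_antidiagonal.1 hij
  have hlt : ij.2 < 4 := by omega
  have hj : coeff ij.2 (jet v) = v ⟨ij.2, hlt⟩ := coeff_jet v ⟨ij.2, hlt⟩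
  rw [hj]
  exact (h ⟨ij.2, hlt⟩).mul_left _

/-! ### The solutions at `Q = 0` near `Q = 0` -/

lemma constantCoeff_one_sub_classP_mul (hq1 : ‖q‖ < 1) (d : ℕ) :
    constantCoeff (1 - classP * C q * C q ^ d) ≠ 0 := by
  have := mul_pow_ne_one_of_norm_lt hq1 hq1 d
  simp only [classP, map_sub, map_one, map_mul, map_pow, constantCoeff_X, constantCoeff_C, sub_zero,
    one_mul]
  exact sub_ne_zero.2 this.symm

lemma serCoeff_zero : serCoeff q p 0 = 1 := by
  simp [serCoeff, qPoch]

lemma serCoeff_succ (hq1 : ‖q‖ < 1) (d : ℕ) :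
    serCoeff q p (d + 1) * (1 - classP * C (q ^ (d + 1))) ^ 4
      = serCoeff q p d * ∏ l, (1 - C (alphas p l) * (classP * C (q ^ d))) := by
  have h := PowerSeries.mul_inv_cancel ((1 - classP * C q * C q ^ d) ^ 4) (by
    rw [map_pow]
    exact pow_ne_zero _ (constantCoeff_one_sub_classP_mul hq1 d))
  have e : classP * C (q ^ (d + 1)) = classP * C q * C q ^ d := by
    rw [pow_succ', map_mul, map_pow, mul_assoc]
  have e2 : ∀ l, 1 - C (alphas p l) * (classP * C (q ^ d)) = 1 - classP * C (alphas p l) * C q ^ d :=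
    fun l => by
      rw [map_pow]
      ring
  rw [serCoeff, serCoeff, e]
  simp only [e2, qPoch_succ, Finset.prod_mul_distrib]
  rw [mul_pow, PowerSeries.mul_inv_rev]
  change (_ * ∏ i : Fin 4, (1 - classP * C (alphas p i) * C q ^ d)) * _ * _ = _
  linear_combination (∏ i : Fin 4, qPoch (C q) (classP * C (p ^ ((i : ℕ) + 1))) d)
    * (∏ i : Fin 4, (1 - classP * C (alphas p i) * C q ^ d))
    * ((qPoch (C q) (classP * C q) d) ^ 4)⁻¹ * h

lemma powP_qLog_pow_mul (hq0 : q ≠ 0) (hq1 : ‖q‖ < 1) (hp : p ^ 5 = q) {Q : ℂ}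
    (hQ : Q ∈ regularSet p) (n : ℕ) :
    powP (qLog q (q ^ n * Q)) = powP (qLog q Q) * classP ^ n := by
  have hp0 := ne_zero_of_pow_eq hq0 hp
  induction n with
  | zero => simp
  | succ n ih =>
    have hm := q_pow_mul_mem_regularSet hp0 hp hQ n
    rw [pow_succ', mul_assoc, qLog_mul_q hq0 hq1 hm.1 (ne_neg_q_zpow_of_mem_regularSet hp hm),
      powP_add_one, ih, pow_succ, mul_assoc]

/-- The functions `S_m(Q) = ∑_{a+b=m} (-1)^a binom(ℓ_q(Q), a) X_b(Q)` satisfy the equation for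
`|Q| < 1`. -/
lemma quinticOp_twist_eq_zero (hq0 : q ≠ 0) (hq1 : ‖q‖ < 1) (hp : p ^ 5 = q) {X : Fin 4 → ℂ → ℂ}
    (hX : ∀ b : Fin 4, ∀ Q : ℂ, ‖Q‖ < 1 →
      HasSum (fun d : ℕ => coeff (b : ℕ) (serCoeff q p d) * Q ^ d) (X b Q)) (m : Fin 4) {Q : ℂ}
    (hQ : Q ∈ regularSet p) (hQ1 : ‖Q‖ < 1) :
    quinticOp q p (fun Q => twist (qLog q Q) (fun b => X b Q) m) Q = 0 := by
  have h : ∀ n ≤ 4, HasSum (fun d => (coeff (R := ℂ) (m : ℕ)) ((powP (qLog q Q) * serCoeff q p d * C (Q ^ d))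
      * (classP * C (q ^ d)) ^ n)) (twist (qLog q (q ^ n * Q)) (fun b => X b (q ^ n * Q)) m) := by
    intro n _
    have hn : ‖q ^ n * Q‖ < 1 := by
      rw [norm_mul, norm_pow]
      exact (mul_le_of_le_one_left (norm_nonneg _)
        (pow_le_one₀ (norm_nonneg _) hq1.le)).trans_lt hQ1
    have := hasSum_coeff_mul (powP (qLog q (q ^ n * Q)))
      (s := fun d => serCoeff q p d * C ((q ^ n * Q) ^ d)) (v := fun b => X b (q ^ n * Q))
      (fun b => by simpa only [coeff_mul_C] using hX b _ hn) m
    rw [twist_eq_coeff]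
    refine this.congr_fun fun d => ?_
    rw [powP_qLog_pow_mul hq0 hq1 hp hQ]
    congr 1
    simp only [map_mul, map_pow, mul_pow]
    ring
  obtain ⟨s, t, hs, ht, e⟩ := hasSum_quinticOp (p := p) (coeff (R := ℂ) (m : ℕ))
    (F := fun Q => twist (qLog q Q) (fun b => X b Q) m)
    (v := fun d => powP (qLog q Q) * serCoeff q p d * C (Q ^ d))
    (lam := fun d => classP * C (q ^ d)) h
  rw [e]
  refine sub_eq_zero_of_telescope_left hs ht ?_ fun d => ?_
  · have : powP (qLog q Q) * serCoeff q p 0 * C (Q ^ 0) * (1 - classP * C (q ^ 0)) ^ 4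
        = powP (qLog q Q) * PowerSeries.X ^ 4 := by
      simp [serCoeff_zero, classP]
    simp only [this, coeff_mul_X_pow']
    rw [if_neg (by omega)]
  · have hs := serCoeff_succ (p := p) hq1 d
    have : powP (qLog q Q) * serCoeff q p (d + 1) * C (Q ^ (d + 1))
          * (1 - classP * C (q ^ (d + 1))) ^ 4
        = C Q * (powP (qLog q Q) * serCoeff q p d * C (Q ^ d)
          * ∏ l, (1 - algebraMap ℂ ℂ⟦X⟧ (alphas p l) * (classP * C (q ^ d)))) := by
      rw [pow_succ' Q, map_mul]
      change _ = C Q * (_ * ∏ l, (1 - C (alphas p l) * (classP * C (q ^ d))))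
      linear_combination (powP (qLog q Q) * C Q * C (Q ^ d)) * hs
    rw [this, coeff_C_mul]

/-! ### The solutions at `Q = ∞` near `Q = ∞` -/

lemma qChar_inv_mul_q (hq0 : q ≠ 0) {l Q : ℂ} (hl : l ≠ 0) (hQ : Q ≠ 0) :
    qChar q l (1 / (q * Q)) = l⁻¹ * qChar q l (1 / Q) := by
  have h : ∀ a : ℂ, a ≠ 0 → theta q (a * (1 / (q * Q))) = a / (q * Q) * theta q (a * (1 / Q)) :=
    fun a ha => by
      have := theta_mul_q hq0 (q := q) (Q := a * (1 / (q * Q))) (by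
        exact mul_ne_zero ha (one_div_ne_zero (mul_ne_zero hq0 hQ)))
      have e : q * (a * (1 / (q * Q))) = a * (1 / Q) := by field_simp
      rw [e] at this
      rw [this]
      field_simp
  have h1 := h 1 one_ne_zero
  rw [one_mul, one_mul] at h1
  rw [qChar, qChar, h1, h l hl]
  rw [mul_div_mul_comm]
  congr 1
  field_simp

lemma qChar_inv_pow_mul (hq0 : q ≠ 0) {l Q : ℂ} (hl : l ≠ 0) (hQ : Q ≠ 0) (n : ℕ) :
    qChar q l (1 / (q ^ n * Q)) = (l⁻¹) ^ n * qChar q l (1 / Q) := by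
  induction n with
  | zero => simp
  | succ n ih =>
    rw [pow_succ', mul_assoc, qChar_inv_mul_q hq0 hl (mul_ne_zero (pow_ne_zero _ hq0) hQ), ih,
      pow_succ']
    ring

lemma wTerm_succ (hq0 : q ≠ 0) (hq1 : ‖q‖ < 1) (hp : p ^ 5 = q) (k : Fin 4) (w : ℂ) (d : ℕ) :
    wTerm q p k w (d + 1) * ∏ l, (1 - alphas p k * (q / alphas p l) * q ^ d)
      = wTerm q p k w d * (1 - alphas p k * q ^ d) ^ 4 * (q ^ 2 * w) := by
  have hp0 := ne_zero_of_pow_eq hq0 hp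
  have hp1 := norm_lt_one_of_pow_eq hq1 hp
  have h : ∏ l, (1 - alphas p k * (q / alphas p l) * q ^ d) ≠ 0 :=
    Finset.prod_ne_zero_iff.2 fun l _ => sub_ne_zero.2
      (mul_pow_ne_one_of_norm_lt (norm_q_mul_alphas_div_lt_one hp0 hp1 hp k l) hq1 d).symm
  rw [wTerm_eq hp0 hp, wTerm_eq hp0 hp]
  simp only [qPoch_succ, Finset.prod_mul_distrib]
  generalize ∏ l, (1 - alphas p k * (q / alphas p l) * q ^ d) = D at h
  generalize ∏ l, qPoch q (alphas p k * (q / alphas p l)) d = E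
  field_simp
  ring

/-- The functions `W_k(1/Q)` satisfy the equation for large `|Q|`. -/
lemma quinticOp_infty_eq_zero (hq0 : q ≠ 0) (hq1 : ‖q‖ < 1) (hp : p ^ 5 = q) {W : ℂ → ℂ} {k : Fin 4}
    (hW : ∀ w : ℂ, w ≠ 0 → ‖q ^ 2 * w‖ < 1 →
      HasSum (fun d : ℕ => qChar q (alphas p k) w * wTerm q p k w d) (W w)) {Q : ℂ}
    (hQ0 : Q ≠ 0) (hQ : ‖q ^ 2 * (1 / (q ^ 4 * Q))‖ < 1) :
    quinticOp q p (fun Q => W (1 / Q)) Q = 0 := by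
  have hp0 := ne_zero_of_pow_eq hq0 hp
  have hα := alphas_ne_zero hp0 k
  set α := alphas p k with hαdef
  set χ := qChar q α (1 / Q) with hχ
  have h : ∀ n ≤ 4, HasSum (fun d => (LinearMap.id : ℂ →ₗ[ℂ] ℂ) (χ * wTerm q p k (1 / Q) d
      * (α⁻¹ * (q ^ d)⁻¹) ^ n)) (W (1 / (q ^ n * Q))) := by
    intro n hn
    have hn1 : ‖q ^ 2 * (1 / (q ^ n * Q))‖ < 1 := by
      refine lt_of_le_of_lt ?_ hQ
      obtain ⟨m, hm⟩ := Nat.exists_eq_add_of_le hn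
      have : q ^ 2 * (1 / (q ^ n * Q)) = q ^ m * (q ^ 2 * (1 / (q ^ 4 * Q))) := by
        rw [hm, pow_add]
        field_simp
      rw [this, norm_mul, norm_pow]
      exact mul_le_of_le_one_left (norm_nonneg _) (pow_le_one₀ (norm_nonneg _) hq1.le)
    refine (hW _ (one_div_ne_zero (mul_ne_zero (pow_ne_zero _ hq0) hQ0)) hn1).congr_fun fun d => ?_
    rw [qChar_inv_pow_mul hq0 hα hQ0, LinearMap.id_apply, wTerm_eq hp0 hp, wTerm_eq hp0 hp]
    have e : q ^ 2 * (1 / (q ^ n * Q)) = q ^ 2 * (1 / Q) * (q ^ n)⁻¹ := by field_simp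
    have e' : ((q ^ n)⁻¹) ^ d = ((q ^ d)⁻¹) ^ n := by rw [inv_pow, inv_pow, pow_right_comm]
    rw [e, mul_pow _ ((q ^ n)⁻¹), mul_pow α⁻¹, e']
    ring
  obtain ⟨s, t, hs, ht, e⟩ := hasSum_quinticOp (p := p) LinearMap.id (F := fun Q => W (1 / Q))
    (v := fun d => χ * wTerm q p k (1 / Q) d) (lam := fun d => α⁻¹ * (q ^ d)⁻¹) h
  rw [e]
  refine sub_eq_zero_of_telescope_right hs ht ?_ fun d => ?_
  · rw [LinearMap.id_apply, Finset.prod_eq_zero (Finset.mem_univ k), mul_zero]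
    simp [← hαdef, hα]
  · have hfac : ∏ l, (1 - alphas p l * (α⁻¹ * (q ^ (d + 1))⁻¹))
        = q ^ 2 * (α⁻¹ * (q ^ (d + 1))⁻¹) ^ 4 * ∏ l, (1 - α * (q / alphas p l) * q ^ d) := by
      have : ∀ l, 1 - alphas p l * (α⁻¹ * (q ^ (d + 1))⁻¹)
          = -(alphas p l * (α⁻¹ * (q ^ (d + 1))⁻¹)) * (1 - α * (q / alphas p l) * q ^ d) := fun l => by
        have := alphas_ne_zero hp0 l
        field_simp
        ring
      simp only [this, Finset.prod_mul_distrib]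
      rw [← prod_alphas hp]
      congr 1
      simp only [Fin.prod_univ_four]
      ring
    have hs := wTerm_succ hq0 hq1 hp k (1 / Q) d
    simp only [LinearMap.id_apply, Algebra.algebraMap_self, RingHom.id_apply]
    rw [hfac]
    rw [← hαdef] at hs
    calc _ = χ * (q ^ 2) * (α⁻¹ * (q ^ (d + 1))⁻¹) ^ 4 * Q * (wTerm q p k (1 / Q) d
          * (1 - α * q ^ d) ^ 4 * (q ^ 2 * (1 / Q))) := by
          field_simp
          ring
      _ = _ := by
          rw [← hs]
          ring

end Equation

/-! ### The expansion of the connection identity -/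

section Series

/-- The iterated derivatives of a locally uniformly convergent series of holomorphic functions are
the sums of the iterated derivatives. -/
lemma tendsto_iteratedDeriv_sum {F : ℕ → ℂ → ℂ} {u : ℕ → ℝ} {U : Set ℂ} (hU : IsOpen U)
    (hu : Summable u) (hF : ∀ d, DifferentiableOn ℂ (F d) U) (hb : ∀ d, ∀ z ∈ U, ‖F d z‖ ≤ u d)
    (j : ℕ) {z : ℂ} (hz : z ∈ U) :
    Tendsto (fun s : Finset ℕ => ∑ d ∈ s, iteratedDeriv j (F d) z) atTop
      (𝓝 (iteratedDeriv j (fun z => ∑' d, F d z) z)) := by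
  have hs : ∀ s : Finset ℕ, DifferentiableOn ℂ (fun z => ∑ d ∈ s, F d z) U := fun s =>
    DifferentiableOn.fun_sum fun d _ => hF d
  have h : TendstoLocallyUniformlyOn (fun (s : Finset ℕ) => iteratedDeriv j fun z => ∑ d ∈ s, F d z)
      (iteratedDeriv j fun z => ∑' d, F d z) atTop U := by
    induction j with
    | zero =>
      simp only [iteratedDeriv_zero]
      exact (tendstoUniformlyOn_tsum hu hb).tendstoLocallyUniformlyOn
    | succ j ih =>
      simp only [iteratedDeriv_succ]
      refine ih.deriv (Eventually.of_forall fun s => ?_) hU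
      intro x hx
      rw [iteratedDeriv_eq_iterate]
      exact (((hs s).analyticAt (hU.mem_nhds hx)).iterated_deriv j).differentiableAt
        |>.differentiableWithinAt
  refine (h.tendsto_at hz).congr fun s => ?_
  exact iteratedDeriv_fun_sum fun d _ => ((hF d).analyticAt (hU.mem_nhds hz)).contDiffAt

/-- Expansions at `P = 1` may be summed term by term. -/
lemma Expands.tsum {F : ℕ → ℂ → ℂ} {u : ℕ → ℝ} {U : Set ℂ} (hU : IsOpen U) (h1 : (1 : ℂ) ∈ U)
    (hu : Summable u) (hF : ∀ d, DifferentiableOn ℂ (F d) U) (hb : ∀ d, ∀ z ∈ U, ‖F d z‖ ≤ u d)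
    {φ : ℕ → ℂ⟦X⟧} {ψ : ℂ⟦X⟧} (hφ : ∀ d, Expands (F d) (φ d))
    (hψ : ∀ j : Fin 4, HasSum (fun d => coeff (j : ℕ) (φ d)) (coeff (j : ℕ) ψ)) :
    Expands (fun P => ∑' d, F d P) ψ := by
  have hsum := (Complex.differentiableOn_tsum_of_summable_norm hu hF hU hb).analyticAt
    (hU.mem_nhds h1)
  have e := expands_dilation hsum
  simp only [mul_one] at e
  refine e.congr_coeff fun j => ?_
  have e2 : ∀ d, coeff (j : ℕ) (φ d) = coeff (j : ℕ) (dilationJet (F d) 1) := fun d => by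
    have := expands_dilation ((hF d).analyticAt (hU.mem_nhds h1))
    simp only [mul_one] at this
    exact (hφ d).unique this j
  have h2 := hψ j
  simp only [e2] at h2
  refine tendsto_nhds_unique ?_ h2
  simp only [dilationJet, coeff_mk]
  have := ((tendsto_iteratedDeriv_sum hU hu hF hb (j : ℕ) h1).div_const
    (((j : ℕ).factorial : ℕ) : ℂ)).const_mul ((-1 : ℂ) ^ (j : ℕ))
  refine this.congr fun s => ?_
  rw [Finset.sum_div, Finset.mul_sum]

end Series

section Expansion

variable {q p Q : ℂ}

lemma expands_posTerm (hq1 : ‖q‖ < 1) {β : ℂ⟦X⟧}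
    (hβ : Expands (fun P => qPochInf q (P * q) ^ 4) β) (d : ℕ) :
    Expands (posTerm q p Q d) (β * (serCoeff q p d * C (Q ^ d))) := by
  have h := hβ.mul ((expands_serCoeff (p := p) hq1 d).mul (expands_const (Q ^ d)))
  refine h.congr ?_
  have hne : ∀ᶠ P in 𝓝 (1 : ℂ), qPoch q (P * q) d ≠ 0 := by
    have hc : ContinuousAt (fun P => qPoch q (P * q) d) 1 :=
      ((differentiable_qPoch d).continuous.comp (by fun_prop : Continuous fun P : ℂ => P * q)).continuousAt
    refine hc.eventually_ne ?_
    rw [one_mul]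
    exact qPoch_ne_zero (mul_pow_ne_one_of_norm_lt hq1 hq1) d
  filter_upwards [hne] with P hP
  have e : P * q * q ^ d = P * q ^ (d + 1) := by ring
  rw [posTerm, ← qPoch_mul_qPochInf hq1 (P * q) d, e]
  field_simp

/-- The coefficients of `(1 - P)^b` for `b < 4` see only the half `d ≥ 0` of the bilateral
series, as the other terms carry the factor `(1 / P; q)_n^4`. -/
lemma expands_negTerm (hq1 : ‖q‖ < 1) (n : ℕ) : Expands (fun P => negTerm q p Q n P⁻¹) 0 := by
  have h1 := differentiable_qPochInf hq1
  have h2 := differentiable_qPoch (q := q) n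
  have hinv : ContinuousAt (fun P : ℂ => P⁻¹) 1 := continuousAt_inv₀ one_ne_zero
  have e : ∀ w, qPoch q w (n + 1) = (1 - w) * qPoch q (w * q) n := fun w => by
    rw [qPoch, Finset.prod_range_succ', mul_comm, qPoch]
    congr 1
    · simp
    · refine Finset.prod_congr rfl fun j _ => ?_
      ring
  refine expands_of_eq (c₀ := 0) (c₁ := 0) (c₂ := 0) (c₃ := 0)
    (R := fun P => (P⁻¹) ^ 4 * ((q ^ 2 / Q) ^ (n + 1)
    * (qPoch q (P⁻¹ * q) n ^ 4 * ∏ l, qPochInf q (P⁻¹ * (q / alphas p l) * q ^ (n + 1))))) ?_ ?_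
    (by simp) (by simp) (by simp) (by simp)
  · have h3 : ∀ c : ℂ, ContinuousAt (fun P : ℂ => qPochInf q (P⁻¹ * c)) 1 := fun c =>
      h1.continuous.continuousAt.comp (hinv.mul continuousAt_const)
    have h4 : ContinuousAt (fun P : ℂ => qPoch q (P⁻¹ * q) n) 1 :=
      h2.continuous.continuousAt.comp (f := fun P : ℂ => P⁻¹ * q) (hinv.mul continuousAt_const)
    have h5 : ContinuousAt (fun P : ℂ => ∏ l, qPochInf q (P⁻¹ * (q / alphas p l) * q ^ (n + 1))) 1 :=
      tendsto_finsetProd _ fun l _ => by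
        simpa only [mul_assoc] using (h3 ((q / alphas p l) * q ^ (n + 1))).tendsto
    exact (hinv.pow 4).mul (continuousAt_const.mul ((h4.pow 4).mul h5))
  · filter_upwards [isOpen_ne.mem_nhds (one_ne_zero (α := ℂ))] with P hP
    have e1 : 1 - P⁻¹ = -((1 - P) * P⁻¹) := by
      have : P ≠ 0 := hP
      field_simp
      ring
    rw [negTerm, e, e1]
    ring

/-- The sum over `d ≥ 0` in the connection identity expands to the functions `X_b`. -/
lemma expands_posSum (hq1 : ‖q‖ < 1) (hp1 : ‖p‖ < 1) (hQ1 : ‖Q‖ < 1) {v : Fin 4 → ℂ}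
    (hv : ∀ b : Fin 4, HasSum (fun d : ℕ => coeff (b : ℕ) (serCoeff q p d) * Q ^ d) (v b)) :
    Expands (fun P => (∑' d, posTerm q p Q d P) / qPochInf q (P * q) ^ 4) (jet v) := by
  have hβ := (expands_qPochInf hq1 (mul_pow_ne_one_of_norm_lt hq1 hq1)).pow 4
  set β := (C (qPochInf q q) * PowerSeries.mk fun k => fSum q k q) ^ 4
  have h0 : coeff 0 β ≠ 0 := by
    rw [← hβ.apply_one, one_mul]
    exact pow_ne_zero _ (qPochInf_ne_zero hq1 (mul_pow_ne_one_of_norm_lt hq1 hq1))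
  have h := Expands.tsum Metric.isOpen_ball (Metric.mem_ball_self one_pos)
    ((summable_geometric_of_lt_one (norm_nonneg _) hQ1).mul_right _)
    (fun d => (differentiable_posTerm (Q := Q) (p := p) hq1 d).differentiableOn)
    (fun d z hz => norm_posTerm_le hq1 hp1 (r := 2) (by
      have := norm_sub_norm_le z 1
      have h2 := mem_ball_iff_norm.1 hz
      rw [norm_one] at this
      linarith) d)
    (fun d => expands_posTerm hq1 hβ d) (ψ := β * jet v) fun j => hasSum_coeff_mul β (fun b => by
      simpa only [coeff_mul_C] using hv b) j
  refine (h.div hβ h0).congr_coeff fun j => ?_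
  rw [mul_right_comm, PowerSeries.mul_inv_cancel _ (by simpa using h0), one_mul]

lemma expands_negSum (hq1 : ‖q‖ < 1) (hp0 : p ≠ 0) (hp1 : ‖p‖ < 1) (hp : p ^ 5 = q)
    (hQ : ‖q ^ 2 / Q‖ < 1) : Expands (fun P => ∑' n, negTerm q p Q n P⁻¹) 0 := by
  have hmem : ∀ z ∈ Metric.ball (1 : ℂ) (1 / 2), 1 / 2 ≤ ‖z‖ := fun z hz => by
    have h1 := norm_sub_norm_le 1 z
    have h2 := mem_ball_iff_norm'.1 hz
    rw [norm_one] at h1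
    linarith
  refine Expands.tsum (u := fun n => ‖q ^ 2 / Q‖ ^ (n + 1) * (Real.exp (2 * (1 - ‖q‖)⁻¹) ^ 4
      * Real.exp (2 * (1 - ‖q‖)⁻¹) ^ 4)) Metric.isOpen_ball
    (Metric.mem_ball_self (one_half_pos (α := ℝ)))
    (((summable_nat_add_iff 1).2 (summable_geometric_of_lt_one (norm_nonneg _) hQ)).mul_right _)
    (fun n => ?_) (fun n z hz => norm_negTerm_le hq1 hp0 hp1 hp ?_ n) (expands_negTerm hq1) ?_
  · refine (differentiable_negTerm hq1 n).comp_differentiableOn (differentiableOn_inv.mono fun z hz h => ?_)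
    have := hmem z hz
    rw [h, norm_zero] at this
    norm_num at this
  · rw [norm_inv]
    exact inv_le_of_inv_le₀ (by norm_num) (by simpa using hmem z hz)
  · intro j
    simp

end Expansion

/-! ### The connection formula on an annulus -/

section Identity

variable {q p Q : ℂ}

/-- Near `P = 1` the interpolating theta functions are, up to constants, the products of `ratioF`,
`ratioG` and the factors that define `bilateral`. -/
lemma thetaLagrange_eq (k : Fin 4) {P : ℂ} (hB : qPochInf q (P * q) ≠ 0)
    (hT : thetaProd q (P * alphas p k) ≠ 0) :
    thetaLagrange q p Q k P
      = (thetaProd q Q * ∏ l ∈ Finset.univ.erase k, thetaProd q (alphas p l / alphas p k))⁻¹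
        * (((∏ l, qPochInf q (P⁻¹ * (q / alphas p l))) * qPochInf q (P * q) ^ 4)
          * (ratioF q p P * ratioG q p k Q P)) := by
  have h1 : ∏ l, thetaProd q (P * alphas p l)
      = (∏ l, qPochInf q (P * alphas p l)) * ∏ l, qPochInf q (P⁻¹ * (q / alphas p l)) := by
    rw [← Finset.prod_mul_distrib]
    refine Finset.prod_congr rfl fun l _ => ?_
    have e : q / (P * alphas p l) = P⁻¹ * (q / alphas p l) := by
      rw [div_eq_mul_inv, mul_inv, div_eq_mul_inv]
      ring
    rw [thetaProd, e]
  rw [← Finset.mul_prod_erase _ _ (Finset.mem_univ k)] at h1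
  rw [thetaLagrange, ratioF, ratioG_eq_thetaProd_div, Finset.prod_div_distrib]
  have h2 : (∏ l, qPochInf q (P⁻¹ * (q / alphas p l))) * qPochInf q (P * q) ^ 4
      * ((∏ i, qPochInf q (P * alphas p i)) / qPochInf q (P * q) ^ 4
        * (thetaProd q (P * (alphas p k * Q)) / thetaProd q (P * alphas p k)))
      = thetaProd q (P * (alphas p k * Q))
        * ∏ l ∈ Finset.univ.erase k, thetaProd q (P * alphas p l) := by
    generalize ∏ i, qPochInf q (P * alphas p i) = a at h1 ⊢
    generalize ∏ l, qPochInf q (P⁻¹ * (q / alphas p l)) = b at h1 ⊢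
    generalize ∏ l ∈ Finset.univ.erase k, thetaProd q (P * alphas p l) = c at h1 ⊢
    field_simp
    rw [mul_comm b a, ← h1]
    ring
  rw [h2, mul_inv, div_eq_mul_inv, div_eq_mul_inv]
  ring

lemma coeff_jet_mul_jet (k b : Fin 4) :
    coeff (b : ℕ) (jet (bbF q p) * jet (bbG q p k Q)) = expCoeff q p k Q b := by
  have f0 : coeff 0 (jet (bbF q p)) = 1 := coeff_jet (bbF q p) 0
  have f1 : coeff 1 (jet (bbF q p)) = bbF q p 1 := coeff_jet _ 1
  have f2 : coeff 2 (jet (bbF q p)) = bbF q p 2 := coeff_jet _ 2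
  have f3 : coeff 3 (jet (bbF q p)) = bbF q p 3 := coeff_jet _ 3
  have g0 : coeff 0 (jet (bbG q p k Q)) = 1 := coeff_jet (bbG q p k Q) 0
  have g1 : coeff 1 (jet (bbG q p k Q)) = bbG q p k Q 1 := coeff_jet _ 1
  have g2 : coeff 2 (jet (bbG q p k Q)) = bbG q p k Q 2 := coeff_jet _ 2
  have g3 : coeff 3 (jet (bbG q p k Q)) = bbG q p k Q 3 := coeff_jet _ 3
  fin_cases b
  · simp only [Fin.zero_eta, coeff_mul_zero, f0, g0, expCoeff]
    simp
  · simp only [Fin.mk_one, coeff_mul_one, f0, g0, f1, g1, expCoeff]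
    simp
  · simp only [Fin.reduceFinMk, coeff_mul_two, f0, g0, f1, g1, f2, g2, expCoeff]
    simp
    ring
  · simp only [Fin.reduceFinMk, coeff_mul_three, f0, g0, f1, g1, f2, g2, f3, g3, expCoeff]
    simp
    ring

/-- The constants in the connection identity. -/
lemma bilateral_const_eq_baseCoeff (hq0 : q ≠ 0) (hq1 : ‖q‖ < 1) (hp : p ^ 5 = q) (k : Fin 4)
    (hQ : Q ∈ regularSet p) (hQ' : ‖q ^ 2 / Q‖ < 1) :
    bilateral q p Q (alphas p k)⁻¹
        * (thetaProd q Q * ∏ l ∈ Finset.univ.erase k, thetaProd q (alphas p l / alphas p k))⁻¹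
        * ratioF q p 1 * (thetaProd q (alphas p k * Q) / thetaProd q (alphas p k))
      = baseCoeff q p k Q * (qChar q (alphas p k) (1 / Q) * ∑' d, wTerm q p k (1 / Q) d) := by
  have hp0 := ne_zero_of_pow_eq hq0 hp
  have hp1 := norm_lt_one_of_pow_eq hq1 hp
  have hα := alphas_ne_zero hp0
  have hinv := inv_mem_regularSet hQ
  have hχ : qChar q (alphas p k) (1 / Q) ≠ 0 := by
    rw [one_div]
    have h := alphas_mul_mem_regularSet hp0 hinv k
    exact div_ne_zero (theta_ne_zero hq0 hq1 hinv.1 (ne_neg_q_zpow_of_mem_regularSet hp hinv))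
      (theta_ne_zero hq0 hq1 h.1 (ne_neg_q_zpow_of_mem_regularSet hp h))
  have n1 : ∀ {a : ℂ}, ‖a‖ < 1 → qPochInf q a ≠ 0 := fun h =>
    qPochInf_ne_zero hq1 (mul_pow_ne_one_of_norm_lt h hq1)
  have n2 := n1 (norm_alphas_lt_one hp1 k)
  have n3 := n1 (norm_q_div_alphas_lt_one hp0 hp1 hp k)
  have n4 := n1 hq1
  have n5 : ∀ l, qPochInf q (alphas p k * (q / alphas p l)) ≠ 0 := fun l =>
    n1 (norm_q_mul_alphas_div_lt_one hp0 hp1 hp k l)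
  have n6 : ∏ l ∈ Finset.univ.erase k, qPochInf q (alphas p k * (q / alphas p l)) ≠ 0 :=
    Finset.prod_ne_zero_iff.2 fun l _ => n5 l
  have e1 : ∏ l, qPochInf q (alphas p k * (q / alphas p l)) = qPochInf q q
      * ∏ l ∈ Finset.univ.erase k, qPochInf q (alphas p k * (q / alphas p l)) := by
    rw [← Finset.mul_prod_erase _ _ (Finset.mem_univ k), mul_div_cancel₀ _ (hα k)]
  have e2 : ∏ l ∈ Finset.univ.erase k, thetaProd q (alphas p l / alphas p k)
      = (∏ l ∈ Finset.univ.erase k, qPochInf q (alphas p l / alphas p k))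
        * ∏ l ∈ Finset.univ.erase k, qPochInf q (alphas p k * (q / alphas p l)) := by
    rw [← Finset.prod_mul_distrib]
    refine Finset.prod_congr rfl fun l _ => ?_
    have e : q / (alphas p l / alphas p k) = alphas p k * (q / alphas p l) := by
      have := hα l
      have := hα k
      field_simp
    rw [thetaProd, e]
  have e3 : ∏ l, qPochInf q (1 * alphas p l) = qPochInf q (alphas p k)
      * ∏ l ∈ Finset.univ.erase k, qPochInf q (alphas p l) := by
    simp only [one_mul]
    exact (Finset.mul_prod_erase _ (fun l => qPochInf q (alphas p l)) (Finset.mem_univ k)).symm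
  rw [bilateral_inv_alphas hq0 hq1 hp hQ' k, e1, e2, ratioF, e3, baseCoeff, one_mul]
  simp only [thetaProd]
  generalize ∑' d, wTerm q p k (1 / Q) d = S
  generalize ∏ l ∈ Finset.univ.erase k, qPochInf q (alphas p k * (q / alphas p l)) = a at n6
  generalize ∏ l ∈ Finset.univ.erase k, qPochInf q (alphas p l / alphas p k) = b
  generalize ∏ l ∈ Finset.univ.erase k, qPochInf q (alphas p l) = c
  generalize qChar q (alphas p k) (1 / Q) = χ at hχ
  generalize qPochInf q (q / alphas p k) = x1 at n3
  generalize qPochInf q (alphas p k) = x2 at n2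
  generalize qPochInf q q = x3 at n4
  field_simp

/-- The connection formula for `|q| < |Q| < 1`, by comparison of the coefficients of the two expansions
of the bilateral series. -/
lemma connection_formula_annulus (hq0 : q ≠ 0) (hq1 : ‖q‖ < 1) (hp : p ^ 5 = q)
    (hQ : Q ∈ regularSet p) (hQ1 : ‖Q‖ < 1) (hqQ : ‖q‖ < ‖Q‖) {v : Fin 4 → ℂ}
    (hv : ∀ b : Fin 4, HasSum (fun d : ℕ => coeff (b : ℕ) (serCoeff q p d) * Q ^ d) (v b))
    (b : Fin 4) :
    v b = ∑ k, baseCoeff q p k Q * expCoeff q p k Q b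
      * (qChar q (alphas p k) (1 / Q) * ∑' d, wTerm q p k (1 / Q) d) := by
  have hp0 := ne_zero_of_pow_eq hq0 hp
  have hp1 := norm_lt_one_of_pow_eq hq1 hp
  have hα := alphas_ne_zero hp0
  have hQ' : ‖q ^ 2 / Q‖ < 1 := by
    rw [norm_div, div_lt_one (norm_pos_iff.2 hQ.1), norm_pow]
    nlinarith [norm_nonneg q]
  have n1 : ∀ {a : ℂ}, ‖a‖ < 1 → qPochInf q a ≠ 0 := fun h =>
    qPochInf_ne_zero hq1 (mul_pow_ne_one_of_norm_lt h hq1)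
  have hqd := differentiable_qPochInf hq1
  have hinv : AnalyticAt ℂ (fun P : ℂ => P⁻¹) 1 := analyticAt_inv one_ne_zero
  set A : ℂ → ℂ := fun P => ∏ l, qPochInf q (P⁻¹ * (q / alphas p l)) with hA
  have hAa : AnalyticAt ℂ A 1 := Finset.analyticAt_fun_prod _ fun l _ =>
    (hqd.analyticAt _).fun_comp (hinv.mul analyticAt_const)
  have hA1 : A 1 ≠ 0 := Finset.prod_ne_zero_iff.2 fun l _ => by
    rw [inv_one, one_mul]
    exact n1 (norm_q_div_alphas_lt_one hp0 hp1 hp l)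
  have hAe := expands_dilation hAa
  simp only [mul_one] at hAe
  -- the expansion of the bilateral series
  have hL : Expands (fun P => (∑' d, posTerm q p Q d P) / qPochInf q (P * q) ^ 4
      + (∑' n, negTerm q p Q n P⁻¹) / A P) (jet v) := by
    have := (expands_posSum hq1 hp1 hQ1 hv).add
      ((expands_negSum hq1 hp0 hp1 hp hQ').div hAe (by rwa [← hAe.apply_one]))
    rwa [zero_mul, add_zero] at this
  -- the expansion of its interpolation formula
  set κ : Fin 4 → ℂ := fun k => bilateral q p Q (alphas p k)⁻¹
    * (thetaProd q Q * ∏ l ∈ Finset.univ.erase k, thetaProd q (alphas p l / alphas p k))⁻¹ with hκ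
  have hR := Expands.sum Finset.univ fun k (_ : k ∈ Finset.univ) => Expands.const_mul (κ k)
    ((expands_ratioF hq1 hp).mul (expands_ratioG hq0 hq1 hp k hQ))
  have hev : (fun P => ∑ k, κ k * (ratioF q p P * ratioG q p k Q P)) =ᶠ[𝓝 1]
      fun P => (∑' d, posTerm q p Q d P) / qPochInf q (P * q) ^ 4
        + (∑' n, negTerm q p Q n P⁻¹) / A P := by
    have ev1 : ∀ᶠ P : ℂ in 𝓝 1, P ≠ 0 := isOpen_ne.mem_nhds one_ne_zero
    have ev2 := hAa.continuousAt.eventually_ne hA1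
    have ev3 : ∀ᶠ P : ℂ in 𝓝 1, qPochInf q (P * q) ≠ 0 := by
      have hc : ContinuousAt (fun P => qPochInf q (P * q)) 1 :=
        (hqd.continuous.comp (by fun_prop : Continuous fun P : ℂ => P * q)).continuousAt
      refine hc.eventually_ne ?_
      rw [one_mul]
      exact n1 hq1
    have ev4 : ∀ᶠ P : ℂ in 𝓝 1, ∀ k, thetaProd q (P * alphas p k) ≠ 0 := by
      refine eventually_all.2 fun k => ?_
      have hc : ContinuousAt (fun P => thetaProd q (P * alphas p k)) 1 := by
        have h := (analyticAt_thetaProd hq1 (hα k)).continuousAt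
        rw [← one_mul (alphas p k)] at h
        exact h.comp (f := fun P => P * alphas p k) (by fun_prop)
      refine hc.eventually_ne ?_
      rw [one_mul]
      exact thetaProd_ne_zero hq0 hq1 (hα k) (alphas_ne_q_zpow hp0 hp1 hp k)
    filter_upwards [ev1, ev2, ev3, ev4] with P h1 h2 h3 h4
    have hb := bilateral_eq_sum hq0 hq1 hp hQ hQ1 hqQ h1
    have e : ∑ k, bilateral q p Q (alphas p k)⁻¹ * thetaLagrange q p Q k P
        = (A P * qPochInf q (P * q) ^ 4) * ∑ k, κ k * (ratioF q p P * ratioG q p k Q P) := by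
      rw [Finset.mul_sum]
      refine Finset.sum_congr rfl fun k _ => ?_
      rw [thetaLagrange_eq k h3 (h4 k)]
      simp only [hκ, hA]
      ring
    rw [e, bilateral] at hb
    change A P * _ + _ = _ at hb
    generalize ∑ k, κ k * (ratioF q p P * ratioG q p k Q P) = S at hb ⊢
    generalize A P = a at hb h2 ⊢
    generalize ∑' n, negTerm q p Q n P⁻¹ = N at hb ⊢
    field_simp
    linear_combination -hb
  have hu := hL.unique (hR.congr hev) b
  rw [coeff_jet, map_sum] at hu
  rw [hu]
  refine Finset.sum_congr rfl fun k _ => ?_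
  have e := bilateral_const_eq_baseCoeff hq0 hq1 hp k hQ hQ'
  rw [mul_mul_mul_comm (C _), ← map_mul, coeff_C_mul, coeff_C_mul, coeff_jet_mul_jet,
    mul_right_comm (baseCoeff q p k Q), ← e]
  simp only [hκ]
  ring

end Identity

/-! ### Analytic continuation to the regular set -/

section RegularSet

variable {q p : ℂ}

/-- A point of the regular set in the annulus `|q| < |Q| < 1`. -/
lemma I_mul_mem_regularSet (hp0 : p ≠ 0) (hp1 : ‖p‖ < 1) : Complex.I * p ∈ regularSet p := by
  have hp := norm_pos_iff.2 hp0
  have key : ∀ n : ℤ, ‖p‖ = ‖p ^ n‖ → n = 1 := fun n h => by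
    rw [norm_zpow] at h
    exact (zpow_right_injective₀ hp hp1.ne (by simpa using h)).symm
  refine ⟨mul_ne_zero Complex.I_ne_zero hp0, fun n => ⟨fun h => ?_, fun h => ?_⟩⟩
  · have hn := key n (by rw [← h, norm_mul, Complex.norm_I, one_mul])
    rw [hn, zpow_one] at h
    have := congrArg Complex.re (mul_right_cancel₀ hp0 (h.trans (one_mul p).symm))
    simp at this
  · have hn := key n (by rw [← norm_neg (p ^ n), ← h, norm_mul, Complex.norm_I, one_mul])
    rw [hn, zpow_one] at h
    have := congrArg Complex.re (mul_right_cancel₀ hp0 (h.trans (neg_one_mul p).symm))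
    simp at this

lemma eqOn_regularSet_of_eventuallyEq {f g : ℂ → ℂ} (hf : AnalyticOnNhd ℂ f (regularSet p))
    (hg : AnalyticOnNhd ℂ g (regularSet p)) {z : ℂ} (hz : z ∈ regularSet p) (h : f =ᶠ[𝓝 z] g) {Q : ℂ}
    (hQ : Q ∈ regularSet p) : f Q = g Q :=
  hf.eqOn_of_preconnected_of_eventuallyEq hg (isPreconnected_regularSet p) hz h hQ

lemma analyticOnNhd_oneSub (hp0 : p ≠ 0) (hp : p ^ 5 = q) {F : ℂ → ℂ}
    (hF : AnalyticOnNhd ℂ F (regularSet p)) (a : ℂ) :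
    AnalyticOnNhd ℂ (oneSub q a F) (regularSet p) := fun Q hQ =>
  (hF Q hQ).sub (analyticAt_const.mul
    ((hF _ (q_mul_mem_regularSet hp0 hp hQ)).fun_comp (f := fun Q => q * Q) (by fun_prop)))

lemma analyticOnNhd_quinticOp (hp0 : p ≠ 0) (hp : p ^ 5 = q) {F : ℂ → ℂ}
    (hF : AnalyticOnNhd ℂ F (regularSet p)) : AnalyticOnNhd ℂ (quinticOp q p F) (regularSet p) := by
  have h := fun (F : ℂ → ℂ) (a : ℂ) (hF : AnalyticOnNhd ℂ F (regularSet p)) =>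
    analyticOnNhd_oneSub hp0 hp hF a
  intro Q hQ
  refine AnalyticAt.sub ?_ (analyticAt_id.mul ?_)
  · exact h _ _ (h _ _ (h _ _ (h _ 1 hF))) Q hQ
  · exact h _ _ (h _ _ (h _ _ (h _ _ hF))) Q hQ

lemma analyticAt_binom {l : ℂ → ℂ} {Q : ℂ} (hl : AnalyticAt ℂ l Q) (k : ℕ) :
    AnalyticAt ℂ (fun Q => binom (l Q) k) Q := by
  have : AnalyticAt ℂ (fun Q => ∏ r ∈ Finset.range k, (l Q - (r : ℂ))) Q :=
    Finset.analyticAt_fun_prod _ fun r _ => hl.sub analyticAt_const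
  simp only [binom, div_eq_mul_inv]
  exact this.mul analyticAt_const

lemma analyticAt_twist {l : ℂ → ℂ} {v : Fin 4 → ℂ → ℂ} {Q : ℂ} (hl : AnalyticAt ℂ l Q)
    (hv : ∀ b, AnalyticAt ℂ (v b) Q) (m : Fin 4) :
    AnalyticAt ℂ (fun Q => twist (l Q) (fun b => v b Q) m) Q := by
  unfold twist
  refine Finset.analyticAt_fun_sum _ fun a _ => Finset.analyticAt_fun_sum _ fun b _ => ?_
  split_ifs
  · exact (analyticAt_const.mul (analyticAt_binom hl _)).mul (hv b)
  · exact analyticAt_const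

lemma analyticAt_qChar (hq0 : q ≠ 0) (hq1 : ‖q‖ < 1) (hp : p ^ 5 = q) (k : Fin 4) {Q : ℂ}
    (hQ : Q ∈ regularSet p) : AnalyticAt ℂ (qChar q (alphas p k)) Q := by
  have hp0 := ne_zero_of_pow_eq hq0 hp
  have h := alphas_mul_mem_regularSet hp0 hQ k
  exact (analyticAt_theta hq0 hq1 hQ.1).div
    ((analyticAt_theta hq0 hq1 h.1).fun_comp (f := fun Q => alphas p k * Q) (by fun_prop))
    (theta_ne_zero hq0 hq1 h.1 (ne_neg_q_zpow_of_mem_regularSet hp h))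

lemma qChar_ne_zero (hq0 : q ≠ 0) (hq1 : ‖q‖ < 1) (hp : p ^ 5 = q) (k : Fin 4) {Q : ℂ}
    (hQ : Q ∈ regularSet p) : qChar q (alphas p k) Q ≠ 0 := by
  have hp0 := ne_zero_of_pow_eq hq0 hp
  have h := alphas_mul_mem_regularSet hp0 hQ k
  exact div_ne_zero (theta_ne_zero hq0 hq1 hQ.1 (ne_neg_q_zpow_of_mem_regularSet hp hQ))
    (theta_ne_zero hq0 hq1 h.1 (ne_neg_q_zpow_of_mem_regularSet hp h))

lemma meromorphicAt_qChar (hq0 : q ≠ 0) (hq1 : ‖q‖ < 1) {l Q : ℂ} (hl : l ≠ 0) (hQ : Q ≠ 0) :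
    MeromorphicAt (qChar q l) Q :=
  (analyticAt_theta hq0 hq1 hQ).meromorphicAt.div
    ((analyticAt_theta hq0 hq1 (mul_ne_zero hl hQ)).fun_comp
      (f := fun Q => l * Q) (by fun_prop)).meromorphicAt

lemma analyticOnNhd_comp_one_div {f : ℂ → ℂ} (hf : AnalyticOnNhd ℂ f (regularSet p)) :
    AnalyticOnNhd ℂ (fun Q => f (1 / Q)) (regularSet p) := fun Q hQ => by
  have h := hf _ (inv_mem_regularSet hQ)
  simp only [one_div]
  exact h.fun_comp (f := fun Q => Q⁻¹) (analyticAt_inv hQ.1)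

/-- The first factor of `baseCoeff` is constant and the second is a quotient of theta functions. -/
lemma baseCoeff_eq (q p : ℂ) (k : Fin 4) : ∃ c, ∀ Q, baseCoeff q p k Q
    = c * (thetaProd q (alphas p k * Q) / thetaProd q Q) * (qChar q (alphas p k) (1 / Q))⁻¹ :=
  ⟨_, fun _ => rfl⟩

lemma analyticAt_baseCoeff (hq0 : q ≠ 0) (hq1 : ‖q‖ < 1) (hp : p ^ 5 = q) (k : Fin 4) {Q : ℂ}
    (hQ : Q ∈ regularSet p) : AnalyticAt ℂ (baseCoeff q p k) Q := by
  have hp0 := ne_zero_of_pow_eq hq0 hp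
  obtain ⟨c, hc⟩ := baseCoeff_eq q p k
  rw [funext hc]
  have h := alphas_mul_mem_regularSet hp0 hQ k
  refine (analyticAt_const.mul (AnalyticAt.div ((analyticAt_thetaProd hq1 h.1).fun_comp
    (f := fun Q => alphas p k * Q) (by fun_prop)) (analyticAt_thetaProd hq1 hQ.1)
    (thetaProd_ne_zero hq0 hq1 hQ.1 (ne_q_zpow_of_mem_regularSet hp hQ)))).mul
    (AnalyticAt.inv ?_ ?_)
  · exact analyticOnNhd_comp_one_div (fun Q hQ => analyticAt_qChar hq0 hq1 hp k hQ) Q hQ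
  · rw [one_div]
    exact qChar_ne_zero hq0 hq1 hp k (inv_mem_regularSet hQ)

lemma analyticAt_expCoeff (hq0 : q ≠ 0) (hq1 : ‖q‖ < 1) (hp : p ^ 5 = q) (k b : Fin 4) {Q : ℂ}
    (hQ : Q ∈ regularSet p) : AnalyticAt ℂ (fun Q => expCoeff q p k Q b) Q := by
  have h := fun j => analyticAt_bbG hq0 hq1 hp k j hQ
  have h1 := h 1
  have h2 := h 2
  have h3 := h 3
  fin_cases b
  · exact analyticAt_const
  · exact h1.add analyticAt_const
  · exact (h2.add analyticAt_const).add (h1.mul analyticAt_const)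
  · exact ((h3.add analyticAt_const).add (h2.mul analyticAt_const)).add (h1.mul analyticAt_const)

/-- The functions `S_m` satisfy the equation on the regular set. -/
lemma quinticOp_twist (hq0 : q ≠ 0) (hq1 : ‖q‖ < 1) (hp : p ^ 5 = q) {X : Fin 4 → ℂ → ℂ}
    (hXa : ∀ b, AnalyticOnNhd ℂ (X b) (regularSet p))
    (hX : ∀ b : Fin 4, ∀ Q : ℂ, ‖Q‖ < 1 →
      HasSum (fun d : ℕ => coeff (b : ℕ) (serCoeff q p d) * Q ^ d) (X b Q)) (m : Fin 4) {Q : ℂ}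
    (hQ : Q ∈ regularSet p) : quinticOp q p (fun Q => twist (qLog q Q) (fun b => X b Q) m) Q = 0 := by
  have hp0 := ne_zero_of_pow_eq hq0 hp
  have hp1 := norm_lt_one_of_pow_eq hq1 hp
  have ha : AnalyticOnNhd ℂ (fun Q => twist (qLog q Q) (fun b => X b Q) m) (regularSet p) :=
    fun Q hQ => analyticAt_twist (analyticAt_qLog hq0 hq1 hQ.1
      (ne_neg_q_zpow_of_mem_regularSet hp hQ)) (fun b => hXa b Q hQ) m
  have hz := I_mul_mem_regularSet hp0 hp1
  refine eqOn_regularSet_of_eventuallyEq (analyticOnNhd_quinticOp hp0 hp ha)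
    (g := fun _ => 0) (fun _ _ => analyticAt_const) hz ?_ hQ
  have hlt : ∀ᶠ z in 𝓝 (Complex.I * p), ‖z‖ < 1 :=
    continuous_norm.continuousAt.eventually_lt_const (by simpa using hp1)
  filter_upwards [hlt, (isOpen_regularSet hp0 hp1).mem_nhds hz] with z h1 h2
  exact quinticOp_twist_eq_zero hq0 hq1 hp hX m h2 h1

/-- The functions `W_k(1/Q)` satisfy the equation on the regular set. -/
lemma quinticOp_infty (hq0 : q ≠ 0) (hq1 : ‖q‖ < 1) (hp : p ^ 5 = q) {W : ℂ → ℂ} {k : Fin 4}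
    (hWa : AnalyticOnNhd ℂ W (regularSet p))
    (hW : ∀ w : ℂ, w ≠ 0 → ‖q ^ 2 * w‖ < 1 →
      HasSum (fun d : ℕ => qChar q (alphas p k) w * wTerm q p k w d) (W w)) {Q : ℂ}
    (hQ : Q ∈ regularSet p) : quinticOp q p (fun Q => W (1 / Q)) Q = 0 := by
  have hp0 := ne_zero_of_pow_eq hq0 hp
  have hp1 := norm_lt_one_of_pow_eq hq1 hp
  have hz := inv_mem_regularSet (q_pow_mul_mem_regularSet hp0 hp (I_mul_mem_regularSet hp0 hp1) 2)
  set z₀ := (q ^ 2 * (Complex.I * p))⁻¹ with hz₀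
  refine eqOn_regularSet_of_eventuallyEq (analyticOnNhd_quinticOp hp0 hp
    (analyticOnNhd_comp_one_div hWa)) (g := fun _ => 0) (fun _ _ => analyticAt_const) hz ?_ hQ
  have hc : ContinuousAt (fun z : ℂ => ‖q ^ 2 * (1 / (q ^ 4 * z))‖) z₀ := by
    refine continuous_norm.continuousAt.comp (continuousAt_const.mul
      (continuousAt_const.div (by fun_prop) (mul_ne_zero (pow_ne_zero _ hq0) hz.1)))
  have e : q ^ 2 * (1 / (q ^ 4 * z₀)) = Complex.I * p := by
    rw [hz₀]
    field_simp
  have hlt := hc.eventually_lt_const (u := 1) (by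
    change ‖q ^ 2 * (1 / (q ^ 4 * z₀))‖ < 1
    rw [e]
    simpa using hp1)
  filter_upwards [hlt, isOpen_ne.mem_nhds hz.1] with z h1 h2
  exact quinticOp_infty_eq_zero hq0 hq1 hp hW h2 h1

/-- The connection formula on the regular set. -/
lemma connection_formula (hq0 : q ≠ 0) (hq1 : ‖q‖ < 1) (hp : p ^ 5 = q) {X W : Fin 4 → ℂ → ℂ}
    (hXa : ∀ b, AnalyticOnNhd ℂ (X b) (regularSet p))
    (hX : ∀ b : Fin 4, ∀ Q : ℂ, ‖Q‖ < 1 →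
      HasSum (fun d : ℕ => coeff (b : ℕ) (serCoeff q p d) * Q ^ d) (X b Q))
    (hWa : ∀ k, AnalyticOnNhd ℂ (W k) (regularSet p))
    (hW : ∀ k, ∀ w : ℂ, w ≠ 0 → ‖q ^ 2 * w‖ < 1 →
      W k w = qChar q (alphas p k) w * ∑' d : ℕ, wTerm q p k w d) (b : Fin 4) {Q : ℂ}
    (hQ : Q ∈ regularSet p) :
    X b Q = ∑ k : Fin 4, baseCoeff q p k Q * expCoeff q p k Q b * W k (1 / Q) := by
  have hp0 := ne_zero_of_pow_eq hq0 hp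
  have hp1 := norm_lt_one_of_pow_eq hq1 hp
  have hz := I_mul_mem_regularSet hp0 hp1
  refine eqOn_regularSet_of_eventuallyEq (hXa b) (fun Q hQ => Finset.analyticAt_fun_sum _
    fun k _ => ((analyticAt_baseCoeff hq0 hq1 hp k hQ).mul
      (analyticAt_expCoeff hq0 hq1 hp k b hQ)).mul
      (analyticOnNhd_comp_one_div (hWa k) Q hQ)) hz ?_ hQ
  have hnorm : ‖Complex.I * p‖ = ‖p‖ := by simp
  have hqp : ‖q‖ < ‖p‖ := by
    rw [← hp, norm_pow]
    exact pow_lt_self_of_lt_one₀ (norm_pos_iff.2 hp0) hp1 (by norm_num)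
  have hlt : ∀ᶠ z in 𝓝 (Complex.I * p), ‖z‖ < 1 :=
    continuous_norm.continuousAt.eventually_lt_const (hnorm.trans_lt hp1)
  have hgt : ∀ᶠ z in 𝓝 (Complex.I * p), ‖q‖ < ‖z‖ :=
    continuous_norm.continuousAt.eventually_const_lt (hqp.trans_eq hnorm.symm)
  filter_upwards [hlt, hgt, (isOpen_regularSet hp0 hp1).mem_nhds hz] with z h1 h2 h3
  rw [connection_formula_annulus hq0 hq1 hp h3 h1 h2 (fun b => hX b z h1) b]
  refine Finset.sum_congr rfl fun k _ => ?_
  change _ = baseCoeff q p k z * expCoeff q p k z b * W k (1 / z)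
  rw [hW k _ (one_div_ne_zero h3.1)]
  rw [mul_one_div, norm_div, div_lt_one (norm_pos_iff.2 h3.1), norm_pow]
  nlinarith [norm_nonneg q]

end RegularSet

/-! ### Casorati determinants -/

section Casorati

variable {q p : ℂ}

/-- The determinant of the solution matrix satisfies a `q`-difference equation of order one. -/
lemma det_casorati_mul_q (hp : p ^ 5 = q) {f : Fin 4 → ℂ → ℂ} {Q : ℂ}
    (hf : ∀ m, quinticOp q p (f m) Q = 0) :
    (1 - q ^ 2 * Q) * (casorati q f (q * Q)).det = (1 - Q) * (casorati q f Q).det := by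
  set A : Matrix (Fin 4) (Fin 4) ℂ := !![0, 1, 0, 0; 0, 0, 1, 0; 0, 0, 0, 1;
    -(1 - Q), 4 - Q * (p + p ^ 2 + p ^ 3 + p ^ 4),
    -(6 - Q * (p ^ 3 + p ^ 4 + p ^ 5 + p ^ 5 + p ^ 6 + p ^ 7)),
    4 - Q * (p ^ 6 + p ^ 7 + p ^ 8 + p ^ 9)] with hA
  have h : Matrix.diagonal ![1, 1, 1, 1 - q ^ 2 * Q] * casorati q f (q * Q) = A * casorati q f Q := by
    ext i m
    rw [Matrix.diagonal_mul, Matrix.mul_apply, Fin.sum_univ_four]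
    have hm := hf m
    simp only [quinticOp, Function.iterate_succ, Function.iterate_zero, Function.comp_apply, id,
      oneSub] at hm
    simp only [casorati, Matrix.of_apply]
    fin_cases i
    · simp [hA]
    · simp [hA, pow_succ, mul_assoc]
    · simp [hA, pow_succ, mul_assoc]
    · simp [hA]
      have e2 : q ^ 2 * Q = q * (q * Q) := by ring
      have e3 : q ^ 3 * Q = q * (q * (q * Q)) := by ring
      have e4 : q ^ 3 * (q * Q) = q * (q * (q * (q * Q))) := by ring
      rw [e4, e3, e2]
      have e5 : q * (q * Q) = p ^ 10 * Q := by rw [← hp]; ring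
      linear_combination hm - f m (q * (q * (q * (q * Q)))) * e5
  have hdet := congrArg Matrix.det h
  rw [Matrix.det_mul, Matrix.det_mul, Matrix.det_diagonal, Fin.prod_univ_four] at hdet
  have hAdet : A.det = 1 - Q := by
    simp [hA, Matrix.det_succ_row_zero, Fin.sum_univ_succ,
      show Fin.succAbove (1 : Fin 4) (2 : Fin 3) = 3 from rfl]
  rw [hAdet] at hdet
  simpa using hdet

lemma det_casorati_pow_mul_eq_zero (hq0 : q ≠ 0) (hp : p ^ 5 = q) {f : Fin 4 → ℂ → ℂ}
    (hf : ∀ m, ∀ Q ∈ regularSet p, quinticOp q p (f m) Q = 0) {Q : ℂ} (hQ : Q ∈ regularSet p)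
    (h0 : (casorati q f Q).det = 0) (n : ℕ) : (casorati q f (q ^ n * Q)).det = 0 := by
  have hp0 := ne_zero_of_pow_eq hq0 hp
  induction n with
  | zero => simpa using h0
  | succ n ih =>
    have hm := q_pow_mul_mem_regularSet hp0 hp hQ n
    have h := det_casorati_mul_q hp fun m => hf m _ hm
    rw [ih, mul_zero, ← mul_assoc q, ← pow_succ'] at h
    refine (mul_eq_zero.1 h).resolve_left (sub_ne_zero.2 fun h => ?_)
    have hm2 := q_pow_mul_mem_regularSet hp0 hp hm 2
    exact (hm2.2 0).1 (by rw [zpow_zero, ← h])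

lemma det_casorati_inv_pow_mul_eq_zero (hq0 : q ≠ 0) (hp : p ^ 5 = q) {f : Fin 4 → ℂ → ℂ}
    (hf : ∀ m, ∀ Q ∈ regularSet p, quinticOp q p (f m) Q = 0) {Q : ℂ} (hQ : Q ∈ regularSet p)
    (h0 : (casorati q f Q).det = 0) (n : ℕ) : (casorati q f ((q ^ n)⁻¹ * Q)).det = 0 := by
  have hp0 := ne_zero_of_pow_eq hq0 hp
  induction n with
  | zero => simpa using h0
  | succ n ih =>
    have hm : (q ^ (n + 1))⁻¹ * Q ∈ regularSet p := by
      rw [← zpow_natCast, ← zpow_neg]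
      exact q_zpow_mul_mem_regularSet hp0 hp hQ _
    have h := det_casorati_mul_q hp fun m => hf m _ hm
    have e : q * ((q ^ (n + 1))⁻¹ * Q) = (q ^ n)⁻¹ * Q := by
      rw [pow_succ]
      field_simp
    rw [e, ih, mul_zero] at h
    refine (mul_eq_zero.1 h.symm).resolve_left (sub_ne_zero.2 fun h => ?_)
    exact (hm.2 0).1 (by rw [zpow_zero, ← h])

/-- The coefficients of a product of power series up to degree three, as a matrix product. -/
lemma coeff_mul_eq_sum (φ ψ : ℂ⟦X⟧) (m : Fin 4) : coeff (m : ℕ) (φ * ψ)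
    = ∑ j : Fin 4, coeff (j : ℕ) φ * if j ≤ m then coeff ((m : ℕ) - j) ψ else 0 := by
  fin_cases m
  · simp
  · simp only [Fin.mk_one, coeff_mul_one, Fin.sum_univ_four]
    simp [Fin.le_def]
  · simp only [Fin.reduceFinMk, coeff_mul_two, Fin.sum_univ_four]
    simp [Fin.le_def]
  · simp only [Fin.reduceFinMk, coeff_mul_three, Fin.sum_univ_four]
    simp [Fin.le_def]

/-- The twist by the logarithm does not change the determinant. -/
lemma det_casorati_twist (hq0 : q ≠ 0) (hq1 : ‖q‖ < 1) (hp : p ^ 5 = q) (X : Fin 4 → ℂ → ℂ)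
    {Q : ℂ} (hQ : Q ∈ regularSet p) :
    (casorati q (fun m Q => twist (qLog q Q) (fun b => X b Q) m) Q).det
      = (Matrix.of fun i j : Fin 4 => coeff (j : ℕ)
          (classP ^ (i : ℕ) * jet fun b => X b (q ^ (i : ℕ) * Q))).det := by
  set U : Matrix (Fin 4) (Fin 4) ℂ := Matrix.of fun j m =>
    if j ≤ m then coeff ((m : ℕ) - j) (powP (qLog q Q)) else 0 with hU
  have hUdet : U.det = 1 := by
    rw [Matrix.det_of_isUpperTriangular]
    · simp [hU, powP, binom_zero]
    · intro i j hij
      simp only [hU, Matrix.of_apply]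
      rw [if_neg (not_le.2 (show j < i from hij))]
  rw [← mul_one (Matrix.det (Matrix.of _)), ← hUdet, ← Matrix.det_mul]
  congr 1
  ext i m
  rw [Matrix.mul_apply]
  simp only [casorati, Matrix.of_apply, hU]
  rw [twist_eq_coeff, powP_qLog_pow_mul hq0 hq1 hp hQ, mul_assoc, mul_comm, coeff_mul_eq_sum]

lemma tendsto_q_pow_mul (hq1 : ‖q‖ < 1) (c Q : ℂ) :
    Tendsto (fun n : ℕ => c * (q ^ n * Q)) atTop (𝓝 0) := by
  have := ((tendsto_pow_atTop_nhds_zero_of_norm_lt_one hq1).mul_const Q).const_mul c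
  simpa using this

lemma det_coeff_classP_pow :
    (Matrix.of fun i j : Fin 4 => coeff (j : ℕ) (classP ^ (i : ℕ))).det = 1 := by
  have h : (Matrix.of fun i j : Fin 4 => coeff (j : ℕ) (classP ^ (i : ℕ)))
      = !![1, 0, 0, 0; 1, -1, 0, 0; 1, -2, 1, 0; 1, -3, 3, -1] := by
    have c0 : coeff 0 classP = 1 := by simp [classP]
    have c1 : coeff 1 classP = -1 := by simp [classP, coeff_one]
    have c2 : coeff 2 classP = 0 := by simp [classP, coeff_one, coeff_X]
    have c3 : coeff 3 classP = 0 := by simp [classP, coeff_one, coeff_X]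
    ext i j
    fin_cases i <;> fin_cases j <;>
      simp [pow_succ, coeff_mul_zero, coeff_mul_one, coeff_mul_two, coeff_mul_three, coeff_one,
        c0, c1, c2, c3, -coeff_zero_eq_constantCoeff] <;> norm_num
  rw [h]
  simp [Matrix.det_succ_row_zero, Fin.sum_univ_succ]

/-- The functions `S_m` are a fundamental system: as `q^n Q → 0`, the determinant tends to that of
the powers of the class `P`. -/
lemma det_casorati_twist_ne_zero (hq0 : q ≠ 0) (hq1 : ‖q‖ < 1) (hp : p ^ 5 = q) {X : Fin 4 → ℂ → ℂ}
    (hXa : ∀ b, AnalyticOnNhd ℂ (X b) (regularSet p)) (hX0 : ∀ b, ContinuousAt (X b) 0)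
    (hX : ∀ b : Fin 4, ∀ Q : ℂ, ‖Q‖ < 1 →
      HasSum (fun d : ℕ => coeff (b : ℕ) (serCoeff q p d) * Q ^ d) (X b Q)) {Q : ℂ}
    (hQ : Q ∈ regularSet p) :
    (casorati q (fun m Q => twist (qLog q Q) (fun b => X b Q) m) Q).det ≠ 0 := by
  intro h0
  have hp0 := ne_zero_of_pow_eq hq0 hp
  have hz := det_casorati_pow_mul_eq_zero hq0 hp
    (fun m Q hQ => quinticOp_twist hq0 hq1 hp hXa hX m hQ) hQ h0
  have hval : ∀ b, X b 0 = coeff (b : ℕ) (1 : ℂ⟦X⟧) := fun b => by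
    have h1 := hX b 0 (by simp)
    have h2 := hasSum_single (f := fun d : ℕ => coeff (b : ℕ) (serCoeff q p d) * (0 : ℂ) ^ d) 0
      fun d hd => by simp [hd]
    rw [h1.unique h2, serCoeff_zero, pow_zero, mul_one]
  have hlim : Tendsto (fun n : ℕ => (Matrix.of fun i j : Fin 4 => coeff (j : ℕ)
      (classP ^ (i : ℕ) * jet fun b => X b (q ^ (i : ℕ) * (q ^ n * Q)))).det) atTop
      (𝓝 (Matrix.of fun i j : Fin 4 => coeff (j : ℕ) (classP ^ (i : ℕ))).det) := by
    refine (continuous_id.matrix_det.tendsto _).comp (tendsto_pi_nhds.2 fun i => tendsto_pi_nhds.2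
      fun j => ?_)
    have e : coeff (j : ℕ) (classP ^ (i : ℕ))
        = coeff (j : ℕ) (classP ^ (i : ℕ) * jet fun b => X b 0) := by
      conv_lhs => rw [← mul_one (classP ^ (i : ℕ))]
      exact coeff_mul_congr (fun b => by rw [coeff_jet, hval]) j
    simp only [Matrix.of_apply]
    rw [e]
    simp only [mul_comm (classP ^ (i : ℕ)), coeff_mul_eq_sum, coeff_jet]
    refine tendsto_finsetSum _ fun b _ => Tendsto.mul_const _ ?_
    exact (hX0 b).tendsto.comp (tendsto_q_pow_mul hq1 _ Q)
  have hzero : ∀ n : ℕ, (Matrix.of fun i j : Fin 4 => coeff (j : ℕ)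
      (classP ^ (i : ℕ) * jet fun b => X b (q ^ (i : ℕ) * (q ^ n * Q)))).det = 0 := fun n => by
    rw [← det_casorati_twist hq0 hq1 hp X (q_pow_mul_mem_regularSet hp0 hp hQ n), hz n]
  rw [det_coeff_classP_pow] at hlim
  simp only [hzero] at hlim
  exact zero_ne_one (tendsto_nhds_unique tendsto_const_nhds hlim)

/-- The functions `W_k(1/Q)` are a fundamental system: up to the characters, the determinant tends
to the Vandermonde determinant of the `1 / α_k` as `Q / q^n → ∞`. -/
lemma det_casorati_infty_ne_zero (hq0 : q ≠ 0) (hq1 : ‖q‖ < 1) (hp : p ^ 5 = q)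
    {W Φ : Fin 4 → ℂ → ℂ} (hWΦ : ∀ k w, W k w = qChar q (alphas p k) w * Φ k (q ^ 2 * w))
    (hΦ : ∀ k, ContinuousAt (Φ k) 0) (hΦ0 : ∀ k, Φ k 0 = 1)
    (hW : ∀ k, ∀ Q ∈ regularSet p, quinticOp q p (fun Q => W k (1 / Q)) Q = 0) {Q : ℂ}
    (hQ : Q ∈ regularSet p) : (casorati q (fun k Q => W k (1 / Q)) Q).det ≠ 0 := by
  intro h0
  have hp0 := ne_zero_of_pow_eq hq0 hp
  have hp1 := norm_lt_one_of_pow_eq hq1 hp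
  have hz := det_casorati_inv_pow_mul_eq_zero hq0 hp hW hQ h0
  have hlim : Tendsto (fun n : ℕ => (Matrix.of fun i k : Fin 4 => ((alphas p k)⁻¹) ^ (i : ℕ)
      * Φ k (q ^ 2 * (q ^ (i : ℕ))⁻¹ * (q ^ n * Q⁻¹))).det) atTop
      (𝓝 (Matrix.of fun i k : Fin 4 => ((alphas p k)⁻¹) ^ (i : ℕ)).det) := by
    refine (continuous_id.matrix_det.tendsto _).comp (tendsto_pi_nhds.2 fun i => tendsto_pi_nhds.2
      fun k => ?_)
    have := (((hΦ k).tendsto.comp (tendsto_q_pow_mul hq1 (q ^ 2 * (q ^ (i : ℕ))⁻¹) Q⁻¹)).const_mul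
      (((alphas p k)⁻¹) ^ (i : ℕ)))
    rw [hΦ0, mul_one] at this
    exact this
  have hzero : ∀ n : ℕ, (Matrix.of fun i k : Fin 4 => ((alphas p k)⁻¹) ^ (i : ℕ)
      * Φ k (q ^ 2 * (q ^ (i : ℕ))⁻¹ * (q ^ n * Q⁻¹))).det = 0 := fun n => by
    have hm : (q ^ n)⁻¹ * Q ∈ regularSet p := by
      simpa using q_zpow_mul_mem_regularSet hp0 hp hQ (-(n : ℤ))
    set Q' := (q ^ n)⁻¹ * Q with hQ'
    have e : casorati q (fun k Q => W k (1 / Q)) Q'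
        = (Matrix.of fun i k : Fin 4 => ((alphas p k)⁻¹) ^ (i : ℕ)
      * Φ k (q ^ 2 * (q ^ (i : ℕ))⁻¹ * (q ^ n * Q⁻¹)))
          * Matrix.diagonal fun k => qChar q (alphas p k) (1 / Q') := by
      ext i k
      have e1 : q ^ 2 * (1 / (q ^ (i : ℕ) * Q')) = q ^ 2 * (q ^ (i : ℕ))⁻¹ * (q ^ n * Q⁻¹) := by
        rw [hQ', one_div, mul_inv, mul_inv, inv_inv, mul_assoc]
      rw [Matrix.mul_diagonal]
      simp only [casorati, Matrix.of_apply]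
      rw [hWΦ, e1, qChar_inv_pow_mul hq0 (alphas_ne_zero hp0 k) hm.1]
      ring
    have hd := hz n
    rw [e, Matrix.det_mul, Matrix.det_diagonal] at hd
    refine (mul_eq_zero.1 hd).resolve_right (Finset.prod_ne_zero_iff.2 fun k _ => ?_)
    rw [one_div]
    exact qChar_ne_zero hq0 hq1 hp k (inv_mem_regularSet hm)
  simp only [hzero] at hlim
  have hv : (Matrix.of fun i k : Fin 4 => ((alphas p k)⁻¹) ^ (i : ℕ))
      = (Matrix.vandermonde fun k => (alphas p k)⁻¹).transpose := by
    ext i k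
    simp [Matrix.vandermonde_apply]
  rw [hv, Matrix.det_transpose] at hlim
  refine Matrix.det_vandermonde_ne_zero_iff.2 (fun k l hkl => ?_)
    (tendsto_nhds_unique tendsto_const_nhds hlim).symm
  by_contra h
  refine alphas_div_alphas_ne_q_zpow hp0 hp1 hp h 0 ?_
  rw [zpow_zero, div_eq_one_iff_eq (alphas_ne_zero hp0 l)]
  exact inv_injective hkl

end Casorati

/-! ### The connection matrix -/

section ConnectionMatrix

variable {q p Q : ℂ}

lemma baseCoeff_mul_q (hq0 : q ≠ 0) (hq1 : ‖q‖ < 1) (hp : p ^ 5 = q) (k : Fin 4)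
    (hQ : Q ∈ regularSet p) : baseCoeff q p k (q * Q) = baseCoeff q p k Q := by
  have hp0 := ne_zero_of_pow_eq hq0 hp
  have hα := alphas_ne_zero hp0 k
  have hQ0 := hQ.1
  obtain ⟨c, hc⟩ := baseCoeff_eq q p k
  rw [hc, hc, mul_left_comm (alphas p k), thetaProd_mul_q hq0 hq1 (mul_ne_zero hα hQ0),
    thetaProd_mul_q hq0 hq1 hQ0, qChar_inv_mul_q hq0 hα hQ0]
  have hT := thetaProd_ne_zero hq0 hq1 hQ0 (ne_q_zpow_of_mem_regularSet hp hQ)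
  have hχ : qChar q (alphas p k) (1 / Q) ≠ 0 := by
    rw [one_div]
    exact qChar_ne_zero hq0 hq1 hp k (inv_mem_regularSet hQ)
  generalize qChar q (alphas p k) (1 / Q) = χ at hχ
  field_simp

/-- The quasi-periodicity `P · ratioG(q Q, P) = -ratioG(Q, P) / (α_k Q)`, on the level of the
coefficients. -/
lemma coeff_classP_mul_jet_bbG (hq0 : q ≠ 0) (hq1 : ‖q‖ < 1) (hp : p ^ 5 = q) (k : Fin 4)
    (hQ : Q ∈ regularSet p) (j : Fin 4) :
    coeff (j : ℕ) (classP * jet (bbG q p k (q * Q))) = coeff (j : ℕ) (jet (bbG q p k Q)) := by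
  have hp0 := ne_zero_of_pow_eq hq0 hp
  have hp1 := norm_lt_one_of_pow_eq hq1 hp
  have hα := alphas_ne_zero hp0 k
  have hαQ := alphas_mul_mem_regularSet hp0 hQ k
  have h1 := expands_id.mul (expands_ratioG hq0 hq1 hp k (q_mul_mem_regularSet hp0 hp hQ))
  have h2 := (expands_ratioG hq0 hq1 hp k hQ).const_mul (-(alphas p k * Q)⁻¹)
  have h3 := h1.congr (g := fun P => -(alphas p k * Q)⁻¹ * ratioG q p k Q P) (by
    filter_upwards [isOpen_ne.mem_nhds (one_ne_zero (α := ℂ))] with P hP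
    have hP : P ≠ 0 := hP
    have e : P * (alphas p k * (q * Q)) = q * (P * (alphas p k * Q)) := by ring
    rw [ratioG_eq_thetaProd_div, ratioG_eq_thetaProd_div, e,
      thetaProd_mul_q hq0 hq1 (mul_ne_zero hP hαQ.1)]
    have := hαQ.1
    generalize alphas p k * Q = a at this
    field_simp)
  have h4 := h3.unique h2 j
  rw [mul_left_comm (alphas p k), thetaProd_mul_q hq0 hq1 hαQ.1, mul_left_comm classP, coeff_C_mul,
    ← mul_assoc, ← map_mul, coeff_C_mul] at h4
  have hT := thetaProd_ne_zero hq0 hq1 hαQ.1 (ne_q_zpow_of_mem_regularSet hp hαQ)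
  have hTα := thetaProd_ne_zero hq0 hq1 hα (alphas_ne_q_zpow hp0 hp1 hp k)
  have e : -(thetaProd q (alphas p k * Q) / (alphas p k * Q)) / thetaProd q (alphas p k)
      = -(alphas p k * Q)⁻¹ * (thetaProd q (alphas p k * Q) / thetaProd q (alphas p k)) := by ring
  rw [e] at h4
  exact mul_left_cancel₀ (mul_ne_zero (neg_ne_zero.2 (inv_ne_zero hαQ.1)) (div_ne_zero hT hTα)) h4

lemma connMatrix_apply (k m : Fin 4) : connMatrix q p Q k m
    = baseCoeff q p k Q
      * coeff (m : ℕ) (powP (qLog q Q) * (jet (bbF q p) * jet (bbG q p k Q))) := by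
  rw [connMatrix, Matrix.of_apply, twist_eq_coeff, ← coeff_C_mul, mul_left_comm]
  refine coeff_mul_congr (fun b => ?_) m
  rw [coeff_jet, coeff_C_mul, coeff_jet_mul_jet]

lemma connMatrix_mul_q (hq0 : q ≠ 0) (hq1 : ‖q‖ < 1) (hp : p ^ 5 = q) (hQ : Q ∈ regularSet p) :
    connMatrix q p (q * Q) = connMatrix q p Q := by
  ext k m
  rw [connMatrix_apply, connMatrix_apply, baseCoeff_mul_q hq0 hq1 hp k hQ,
    qLog_mul_q hq0 hq1 hQ.1 (ne_neg_q_zpow_of_mem_regularSet hp hQ), powP_add_one]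
  congr 1
  have e : powP (qLog q Q) * classP * (jet (bbF q p) * jet (bbG q p k (q * Q)))
      = powP (qLog q Q) * jet (bbF q p) * (classP * jet (bbG q p k (q * Q))) := by ring
  rw [e, ← mul_assoc _ _ (jet (bbG q p k Q))]
  exact coeff_mul_congr (coeff_classP_mul_jet_bbG hq0 hq1 hp k hQ) m

lemma connMatrix_pow_mul (hq0 : q ≠ 0) (hq1 : ‖q‖ < 1) (hp : p ^ 5 = q) (hQ : Q ∈ regularSet p)
    (n : ℕ) : connMatrix q p (q ^ n * Q) = connMatrix q p Q := by
  induction n with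
  | zero => simp
  | succ n ih =>
    rw [pow_succ', mul_assoc, connMatrix_mul_q hq0 hq1 hp
      (q_pow_mul_mem_regularSet (ne_zero_of_pow_eq hq0 hp) hp hQ n), ih]

lemma twist_sum_mul (l : ℂ) (w : Fin 4 → ℂ) (v : Fin 4 → Fin 4 → ℂ) (m : Fin 4) :
    twist l (fun b => ∑ k, v k b * w k) m = ∑ k, w k * twist l (v k) m := by
  simp only [twist_eq_coeff, coeff_mul, Finset.mul_sum]
  rw [Finset.sum_comm]
  refine Finset.sum_congr rfl fun ij hij => ?_
  have := Finset.HasAntidiagonal.mem_antidiagonal.1 hij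
  have hlt : ij.2 < 4 := by omega
  have e : ∀ u : Fin 4 → ℂ, coeff ij.2 (jet u) = u ⟨ij.2, hlt⟩ := fun u => coeff_jet u ⟨ij.2, hlt⟩
  simp only [e, Finset.mul_sum]
  exact Finset.sum_congr rfl fun k _ => by ring

/-- The connection formula in matrix form. -/
lemma casorati_twist_eq_mul (hq0 : q ≠ 0) (hq1 : ‖q‖ < 1) (hp : p ^ 5 = q) {X W : Fin 4 → ℂ → ℂ}
    (h : ∀ b : Fin 4, ∀ Q ∈ regularSet p,
      X b Q = ∑ k : Fin 4, baseCoeff q p k Q * expCoeff q p k Q b * W k (1 / Q))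
    (hQ : Q ∈ regularSet p) :
    casorati q (fun m Q => twist (qLog q Q) (fun b => X b Q) m) Q
      = casorati q (fun k Q => W k (1 / Q)) Q * connMatrix q p Q := by
  ext i m
  have hm := q_pow_mul_mem_regularSet (ne_zero_of_pow_eq hq0 hp) hp hQ i
  rw [Matrix.mul_apply, ← connMatrix_pow_mul hq0 hq1 hp hQ i]
  simp only [casorati, connMatrix, Matrix.of_apply, h _ _ hm]
  exact twist_sum_mul _ _ _ _

end ConnectionMatrix

end QConn

open QConn
theorem mainTheorem3 (q p : ℂ) (hq0 : q ≠ 0) (hq1 : ‖q‖ < 1) (hp : p ^ 5 = q) :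
    -- `𝔽_j` and `𝔾_j` are the coefficients of the expansions at `P = 1`
    ((fun P : ℂ => ratioF q p P - ratioF q p 1 * ∑ j : Fin 4, bbF q p j * (1 - P) ^ (j : ℕ))
        =O[nhds 1] fun P : ℂ => (1 - P) ^ 4) ∧
    (∀ k : Fin 4, ∀ Q ∈ regularSet p,
      (fun P : ℂ => ratioG q p k Q P
          - theta q (-(alphas p k * Q)) / theta q (-alphas p k)
            * ∑ j : Fin 4, bbG q p k Q j * (1 - P) ^ (j : ℕ))
        =O[nhds 1] fun P : ℂ => (1 - P) ^ 4) ∧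
    -- the functions `X_b(Q)` and `W_k(w)`, `w = 1 / Q`, as meromorphic functions on `ℂ^*`
    ∃ X W : Fin 4 → ℂ → ℂ,
      (∀ b, MeromorphicOn (X b) {0}ᶜ ∧ AnalyticOnNhd ℂ (X b) (regularSet p)) ∧
      (∀ k, MeromorphicOn (W k) {0}ᶜ ∧ AnalyticOnNhd ℂ (W k) (regularSet p)) ∧
      (∀ b : Fin 4, ∀ Q : ℂ, ‖Q‖ < 1 →
        HasSum (fun d : ℕ => PowerSeries.coeff (b : ℕ) (serCoeff q p d) * Q ^ d) (X b Q)) ∧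
      (∀ Q : ℂ, ‖Q‖ < 1 →
        HasSum (fun d : ℕ => (∏ i, qPoch q (alphas p i) d) / qPoch q q d ^ 4 * Q ^ d) (X 0 Q)) ∧
      (∀ k : Fin 4, ∀ w : ℂ, w ≠ 0 → ‖q ^ 2 * w‖ < 1 →
        Summable (wTerm q p k w) ∧
          W k w = qChar q (alphas p k) w * ∑' d : ℕ, wTerm q p k w d) ∧
      -- the coefficients of `F_{4,4}`
      (∀ m : Fin 4, ∀ Q ∈ regularSet p, ‖Q‖ < 1 →
        PowerSeries.coeff (m : ℕ) (F44 q p Q) = twist (qLog q Q) (fun b => X b Q) m) ∧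
      -- they form a fundamental system of solutions
      (∀ m : Fin 4, ∀ Q ∈ regularSet p,
        quinticOp q p (fun Q => twist (qLog q Q) (fun b => X b Q) m) Q = 0) ∧
      (∀ Q ∈ regularSet p,
        (casorati q (fun m Q => twist (qLog q Q) (fun b => X b Q) m) Q).det ≠ 0) ∧
      -- so do the functions `W_k(1 / Q)`
      (∀ k : Fin 4, ∀ Q ∈ regularSet p, quinticOp q p (fun Q => W k (1 / Q)) Q = 0) ∧
      (∀ Q ∈ regularSet p, (casorati q (fun k Q => W k (1 / Q)) Q).det ≠ 0) ∧
      -- the expressions of the `X_b` through the `W_k`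
      (∀ b : Fin 4, ∀ Q ∈ regularSet p,
        X b Q = ∑ k : Fin 4, baseCoeff q p k Q * expCoeff q p k Q b * W k (1 / Q)) ∧
      -- the connection matrix
      (∀ Q ∈ regularSet p,
        (casorati q (fun k Q => W k (1 / Q)) Q)⁻¹
            * casorati q (fun m Q => twist (qLog q Q) (fun b => X b Q) m) Q
          = connMatrix q p Q ∧
        connMatrix q p (q * Q) = connMatrix q p Q) := by
  have hp0 := ne_zero_of_pow_eq hq0 hp
  have hp1 := norm_lt_one_of_pow_eq hq1 hp
  have hα := alphas_ne_zero hp0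
  refine ⟨?_, fun k Q hQ => ?_, ?_⟩
  · have h := expands_ratioF hq1 hp
    unfold Expands at h
    simpa only [PowerSeries.coeff_C_mul, coeff_jet, mul_assoc, ← Finset.mul_sum] using h
  · have h := expands_ratioG hq0 hq1 hp k hQ
    unfold Expands at h
    rw [theta_neg_div_theta_neg hq0 hq1 (alphas_mul_mem_regularSet hp0 hQ k).1 (hα k)]
    simpa only [PowerSeries.coeff_C_mul, coeff_jet, mul_assoc, ← Finset.mul_sum] using h
  -- the continuations of the series
  choose X hXan hXmer hX using fun b => exists_continuation_zero hq0 hq1 hp b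
  choose Φ hΦan hΦmer hΦ using fun k => exists_continuation_infty hq0 hq1 hp k
  set W : Fin 4 → ℂ → ℂ := fun k w => qChar q (alphas p k) w * Φ k (q ^ 2 * w) with hWdef
  have hne : ∀ Q ∈ regularSet p, ∀ m : ℕ, q ^ m * Q ≠ 1 := fun Q hQ m h =>
    ((q_pow_mul_mem_regularSet hp0 hp hQ m).2 0).1 (by rw [h, zpow_zero])
  have hXa : ∀ b, AnalyticOnNhd ℂ (X b) (regularSet p) := fun b Q hQ => hXan b Q (hne Q hQ)
  have hWa : ∀ k, AnalyticOnNhd ℂ (W k) (regularSet p) := fun k Q hQ =>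
    (analyticAt_qChar hq0 hq1 hp k hQ).mul
      ((hΦan k _ (hne _ (q_pow_mul_mem_regularSet hp0 hp hQ 2))).fun_comp
        (f := fun w => q ^ 2 * w) (by fun_prop))
  have hW : ∀ k, ∀ w : ℂ, w ≠ 0 → ‖q ^ 2 * w‖ < 1 →
      Summable (wTerm q p k w) ∧ W k w = qChar q (alphas p k) w * ∑' d : ℕ, wTerm q p k w d :=
    fun k w _ hw => ⟨(hΦ k w hw).summable, by rw [(hΦ k w hw).tsum_eq]⟩
  have hWeq : ∀ k, ∀ Q ∈ regularSet p, quinticOp q p (fun Q => W k (1 / Q)) Q = 0 := fun k Q hQ =>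
    quinticOp_infty hq0 hq1 hp (hWa k) (fun w _ hw => (hΦ k w hw).mul_left _) hQ
  have hdetW : ∀ Q ∈ regularSet p, (casorati q (fun k Q => W k (1 / Q)) Q).det ≠ 0 := fun Q hQ => by
    refine det_casorati_infty_ne_zero hq0 hq1 hp (fun _ _ => rfl)
      (fun k => (hΦan k 0 (by simp)).continuousAt) (fun k => ?_) hWeq hQ
    have h1 := hΦ k 0 (by simp)
    rw [mul_zero] at h1
    have h2 := hasSum_single (f := fun d : ℕ => wTerm q p k 0 d) 0 fun d hd => by
      simp [wTerm, phiTerm, hd]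
    rw [h1.unique h2]
    simp [wTerm, phiTerm, qPoch]
  have hconn : ∀ b : Fin 4, ∀ Q ∈ regularSet p,
      X b Q = ∑ k : Fin 4, baseCoeff q p k Q * expCoeff q p k Q b * W k (1 / Q) := fun b Q hQ =>
    connection_formula hq0 hq1 hp hXa hX hWa (fun k w h0 h1 => (hW k w h0 h1).2) b hQ
  refine ⟨X, W, fun b => ⟨fun Q _ => hXmer b Q, hXa b⟩, fun k => ⟨fun w hw => ?_, hWa k⟩, hX,
    fun Q hQ => ?_, hW, fun m Q _ hQ => ?_, fun m Q hQ => quinticOp_twist hq0 hq1 hp hXa hX m hQ,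
    fun Q hQ => det_casorati_twist_ne_zero hq0 hq1 hp hXa
      (fun b => (hXan b 0 (by simp)).continuousAt) hX hQ, hWeq, hdetW, hconn,
    fun Q hQ => ⟨?_, connMatrix_mul_q hq0 hq1 hp hQ⟩⟩
  · exact (meromorphicAt_qChar hq0 hq1 (hα k) hw).mul
      ((hΦmer k _).comp_analyticAt (g := fun w => q ^ 2 * w) (by fun_prop))
  · refine (hX 0 Q hQ).congr_fun fun d => ?_
    have h := (expands_serCoeff (p := p) hq1 d).apply_one
    simp only [one_mul] at h
    rw [h]
    rfl
  · rw [twist_eq_coeff, F44]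
    refine coeff_mul_congr (fun b => ?_) m
    rw [PowerSeries.coeff_mk, coeff_jet, (hX b Q hQ).tsum_eq]
  · rw [casorati_twist_eq_mul hq0 hq1 hp hconn hQ,
      Matrix.nonsing_inv_mul_cancel_left _ _ (hdetW Q hQ).isUnit]
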